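/- Let $m\ge 2$, $n=2m+1$, and let $(V,Q)$ be a non-degenerate quadratic space of dimension $n$ over $\mathbb F_3$. Let $I(V)$ be its isometry group, let $\Omega(V)=\Omega_{2m+1}(3)$ be the commutator subgroup of $I(V)$, and let $G$ be a group with $\Omega(V)\le G\le I(V)$. For a sign $\xi\in\{+,-\}$ let $\mathfrak E_\xi(V)$ be the set of points (one-dimensional subspaces) $\langle x\rangle$ of $V$ with $Q(x)\neq 0$ such that the $2m$-dimensional space $x^\perp$ has sign $\xi$, where the sign is $+$ if $x^\perp$ contains a totally singular subspace of dimension $m$ and $-$ otherwise. For $x\in\mathfrak E_\xi(V)$ let $\Delta(x)$ be the set of points of $\mathfrak E_\xi(V)$ lying in $x^\perp$, and let $\Gamma(x)=\mathfrak E_\xi(V)\setminus(\Delta(x)\cup\{x\})$. Let $\alpha$ be a prime and let $M\le G$ be of field-extension type $O_{n/\alpha}(3^\alpha)$. That is, let $\mathbb F_\sharp$ be the field with $3^\alpha$ elements, suppose that $V$ is the underlying $\mathbb F_3$-space of an $\mathbb F_\sharp$-vector space $V_\sharp$ (so $\alpha\mid n$), and that $Q=\mathrm{Tr}_{\mathbb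 F_\sharp/\mathbb F_3}\circ Q_\sharp$ for a quadratic form $Q_\sharp$ on $V_\sharp$; let $M$ be the group of all elements of $G$ that are $\mathbb F_\sharp$-semilinear. Then for each $\xi\in\{+,-\}$ the numbers $k=|\Delta(x)|$, $l=|\Gamma(x)|$, $\lambda=|\Delta(x)\cap\Delta(y)|$ for $y\in\Delta(x)$, and $\mu=|\Delta(x)\cap\Delta(y)|$ for $y\in\Gamma(x)$, do not depend on the choice of $x\in\mathfrak E_\xi(V)$ and $y$. Put $D=(\lambda-\mu)^2+4(k-\mu)$, $s=\tfrac12(\lambda-\mu+\sqrt D)$, $t=\tfrac12(\lambda-\mu-\sqrt D)$. For $x\in\mathfrak E_\xi(V)$ with $M$-orbit $xM$ put $d=|xM\cap\Delta(x)|$ and $c=|xM\cap\Gamma(x)|$, and for $r\in\{s,t\}$ consider the equation $$1+\frac{dr}{k}=\frac{(r+1)c}{l}.\qquad(1)$$ (a) If $\alpha\ne 3$, then there is an $M$-orbit $xM$ on $\mathfrak E_\xi(V)$ for which (1) holds neither for $r=s$ nor for $r=t$. (b) If $\alpha=3$, then $M$ has exactly three orbits on $\mathfrak E_\xi(V)$,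 and (1) holds for all of them with $r=s$ if $\xi=+$, and with $r=t$ if $\xi=-$. Moreover, if $P$ is the stabilizer in $G$ of a point of $\mathfrak E_\xi(V)$, then $1_P^G\not\le 1_M^G$, that is, the difference $1_M^G-1_P^G$ of the complex permutation characters of $G$ on the cosets of $M$ and of $P$ is not a character of $G$ (the zero function being counted as a character). -/

import Mathlib

open scoped LinearAlgebra.Projectivization

noncomputable section

namespace OrthRankThree

section Geometry

variable {F V : Type*} [Field F] [AddCommGroup V] [Module F V]

/-- The full isometry group `I(V)` of the quadratic space `(V, Q)`. -/
def isometryGroup (Q : QuadraticForm F V) : Subgroup (V ≃ₗ[F] V) where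
  carrier := {g | ∀ v, Q (g v) = Q v}
  mul_mem' {g h} hg hh v := (hg (h v)).trans (hh v)
  one_mem' _ := rfl
  inv_mem' {g} hg v := by
    have h := hg (g⁻¹ v)
    rw [← LinearEquiv.mul_apply, mul_inv_cancel] at h
    exact h.symm

/-- The group `Ω(V)`: the commutator subgroup of the full isometry group. For a nondegenerate
quadratic space of odd dimension at least three over a finite field of odd order, this is the
subgroup of index two in the special orthogonal group. -/
def Omega (Q : QuadraticForm F V) : Subgroup (V ≃ₗ[F] V) :=
  ⁅isometryGroup Q, isometryGroup Q⁆

/-- The subspace `x^⊥` of `V`, for a point `x` (a one-dimensional subspace) of `V`. -/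
def perp (Q : QuadraticForm F V) (x : ℙ F V) : Submodule F V :=
  LinearMap.BilinForm.orthogonal Q.polarBilin x.submodule

open Classical in
/-- The sign of (the restriction of `Q` to) a nondegenerate even-dimensional subspace `W`: it is
`+` if `W` has a totally singular subspace of half its dimension and `-` otherwise. -/
def sgn (Q : QuadraticForm F V) (W : Submodule F V) : ℤˣ :=
  if ∃ U : Submodule F V, U ≤ W ∧ (∀ u ∈ U, Q u = 0) ∧
    2 * Module.finrank F U = Module.finrank F W then 1 else -1

/-- The set `𝔈_ξ(V)` of non-singular points of type `ξ`, for `V` of odd dimension: the points `x`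
with `Q x ≠ 0` and `sgn (x^⊥) = ξ`. -/
def nonsingPoints (Q : QuadraticForm F V) (ξ : ℤˣ) : Set (ℙ F V) :=
  {x | Q x.rep ≠ 0 ∧ sgn Q (perp Q x) = ξ}

/-- `Δ(x)`: the points of `𝔈_ξ(V)` that lie in `x^⊥`. -/
def Delta (Q : QuadraticForm F V) (ξ : ℤˣ) (x : ℙ F V) : Set (ℙ F V) :=
  {y | y ∈ nonsingPoints Q ξ ∧ y.submodule ≤ perp Q x}

/-- `Γ(x)`: the points of `𝔈_ξ(V)` that are different from `x` and do not lie in `x^⊥`. -/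
def Gamma (Q : QuadraticForm F V) (ξ : ℤˣ) (x : ℙ F V) : Set (ℙ F V) :=
  {y | y ∈ nonsingPoints Q ξ ∧ y ≠ x ∧ ¬ y.submodule ≤ perp Q x}

/-- The subgroup of `G ≤ GL(V)` of those elements that are semilinear over the extension field `K`
of `F`, with respect to a given `K`-vector space structure on `V`. -/
def fieldExtSubgroup (K : Type*) [Field K] [Module K V] (G : Subgroup (V ≃ₗ[F] V)) :
    Subgroup G where
  carrier := {g | ∃ σ : K ≃+* K, ∀ (a : K) (v : V), g.1 (a • v) = σ a • g.1 v}
  mul_mem' := by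
    rintro g h ⟨σ, hσ⟩ ⟨τ, hτ⟩
    refine ⟨τ.trans σ, fun a v => ?_⟩
    change g.1 (h.1 (a • v)) = σ (τ a) • g.1 (h.1 v)
    rw [hτ, hσ]
  one_mem' := ⟨RingEquiv.refl K, fun _ _ => rfl⟩
  inv_mem' := by
    rintro g ⟨σ, hσ⟩
    refine ⟨σ.symm, fun a v => ?_⟩
    have key : ∀ w : V, g.1 ((g⁻¹).1 w) = w := fun w => by
      change (g.1 * g.1⁻¹) w = w
      rw [mul_inv_cancel]
      rfl
    apply g.1.injective
    rw [key, hσ, key, RingEquiv.apply_symm_apply]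

end Geometry

section RankThree

/-- Higman's parameters `k`, `l`, `λ`, `μ` of a set `E` with suborbits `Δ(x)` and `Γ(x)`. -/
structure IsHigmanParams {X : Type*} (E : Set X) (Δ Γ : X → Set X) (k l lam mu : ℕ) : Prop where
  card_Delta : ∀ x ∈ E, (Δ x).ncard = k
  card_Gamma : ∀ x ∈ E, (Γ x).ncard = l
  card_inter_of_mem_Delta : ∀ x ∈ E, ∀ y ∈ Δ x, (Δ x ∩ Δ y).ncard = lam
  card_inter_of_mem_Gamma : ∀ x ∈ E, ∀ y ∈ Γ x, (Δ x ∩ Δ y).ncard = mu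

/-- `D = (λ - μ)² + 4 (k - μ)`. -/
def discr (k lam mu : ℕ) : ℝ := ((lam : ℝ) - mu) ^ 2 + 4 * ((k : ℝ) - mu)

/-- The eigenvalue `s = (λ - μ + √D) / 2`. -/
def eigS (k lam mu : ℕ) : ℝ := ((lam : ℝ) - mu + √(discr k lam mu)) / 2

/-- The eigenvalue `t = (λ - μ - √D) / 2`. -/
def eigT (k lam mu : ℕ) : ℝ := ((lam : ℝ) - mu - √(discr k lam mu)) / 2

/-- The equation `1 + d r / k = (r + 1) c / l` for the `M`-orbit of `x`, where `d` and `c` are the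
numbers of points of that orbit in `Δ(x)` and in `Γ(x)`. -/
def OrbitEquation {X M : Type*} [Group M] [MulAction M X] (Δ Γ : X → Set X) (k l : ℕ) (r : ℝ)
    (x : X) : Prop :=
  1 + ((MulAction.orbit M x ∩ Δ x).ncard : ℝ) * r / k =
    (r + 1) * ((MulAction.orbit M x ∩ Γ x).ncard : ℝ) / l

end RankThree

section Characters

variable {G : Type*} [Group G]

/-- The permutation character `1_H^G` of `G` on the cosets of `H`, over `ℂ`. -/
def permChar (H : Subgroup G) : G → ℂ :=
  (Representation.ofMulAction ℂ G (G ⧸ H)).character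

/-- `χ ≤ ψ`: the difference `ψ - χ` is the character of a (finite-dimensional, possibly zero)
complex representation of `G`. -/
def CharLE (χ ψ : G → ℂ) : Prop :=
  ∃ (n : ℕ) (ρ : Representation ℂ G (Fin n → ℂ)), ψ - χ = ρ.character

end Characters

end OrthRankThree

end

/-!
For a nondegenerate form `Q` on a space of dimension `d` over a field of odd order `q`, the number
of solutions of `Q v = c` deviates from `q ^ (d - 1)` by an explicit term that depends on `Q` only
through a sign, which for even `d` is the type of `Q`. Applied to `V`, to `x^⊥` and to the forms
over the extension field, this gives all the counts: Higman's parameters satisfy `λ = μ`, so that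
`s = 3 ^ n` and `t = -3 ^ n` with `n = m - 1`, and the numbers `c` and `d` in equation (1) can be
computed whenever the `M`-orbit of `⟨x⟩` is described by the norm `Q_♯ x`.

Let `K` be the extension field. If `dim_K V ≥ 3`, then `Ω(V)` contains enough `K`-linear isometries
for two points of the same nonzero norm to lie in one `M`-orbit. For `α ≠ 3` some point has norm in
`𝔽₃`; its orbit consists of the points with this norm and violates (1). If `dim_K V = 1`, the orbits
are too small to satisfy (1). For `α = 3` the orbits correspond to the classes of conjugate norms of
a given trace, which are told apart by the trace of the square of the norm.

If (1) holds for the orbit of every `x`, then the indicator function of every `M`-orbit is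
orthogonal to the eigenspace of `r` of the rank three graph. So this eigenspace, a constituent of
`1_P^G` that contains a nonzero vector fixed by `P`, contains none fixed by `M`.
-/

noncomputable section

namespace OrthRankThree

/-! ### Orthogonal decompositions -/

section Splitting

variable {F V : Type*} [Field F] [AddCommGroup V] [Module F V] (Q : QuadraticForm F V)

/-- The subspace `x^⊥` of the vectors orthogonal to a vector `x`; the vector counterpart of `perp`,
which takes a point. -/
def vperp (x : V) : Submodule F V := LinearMap.ker (Q.polarBilin x)

/-- The number of vectors at which `Q` takes the value `c`. -/
def valueCount (c : F) : ℕ := Nat.card {v : V // Q v = c}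

variable {Q}

lemma mem_vperp {x y : V} : y ∈ vperp Q x ↔ QuadraticMap.polar Q x y = 0 := Iff.rfl

lemma polarBilin_nondegenerate_iff :
    Q.polarBilin.Nondegenerate ↔ ∀ x, (∀ y, QuadraticMap.polar Q x y = 0) → x = 0 :=
  LinearMap.IsRefl.nondegenerate_iff_separatingLeft fun x y h =>
    (QuadraticMap.polar_comm Q y x).trans h

lemma polar_self_eq_two_mul (x : V) : QuadraticMap.polar Q x x = 2 * Q x := by
  rw [QuadraticMap.polar_self, two_smul, two_mul]

lemma map_smul_add (b : F) (x z : V) :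
    Q (b • x + z) = b * b * Q x + Q z + b * QuadraticMap.polar Q x z := by
  rw [QuadraticMap.map_add Q, QuadraticMap.map_smul, QuadraticMap.polar_smul_left, smul_eq_mul,
    smul_eq_mul]

lemma polar_smul_add_right (b : F) (x z : V) :
    QuadraticMap.polar Q x (b • x + z) = 2 * b * Q x + QuadraticMap.polar Q x z := by
  rw [QuadraticMap.polar_add_right, QuadraticMap.polar_smul_right, polar_self_eq_two_mul,
    smul_eq_mul, mul_left_comm, mul_assoc]

/-- The orthogonal decomposition `V = ⟨x⟩ ⊕ x^⊥` for a nonsingular vector `x`. -/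
def splitEquiv (h2 : (2 : F) ≠ 0) {x : V} (hx : Q x ≠ 0) : (F × vperp Q x) ≃ₗ[F] V where
  toFun p := p.1 • x + p.2
  map_add' p p' := by simp only [Prod.fst_add, Prod.snd_add, Submodule.coe_add]; module
  map_smul' a p := by simp only [Prod.smul_fst, Prod.smul_snd, Submodule.coe_smul,
    RingHom.id_apply, smul_eq_mul]; module
  invFun v := ⟨QuadraticMap.polar Q x v / (2 * Q x),
    ⟨v - (QuadraticMap.polar Q x v / (2 * Q x)) • x, by
      rw [mem_vperp, QuadraticMap.polar_sub_right, QuadraticMap.polar_smul_right,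
        polar_self_eq_two_mul, smul_eq_mul]
      field_simp
      ring⟩⟩
  left_inv p := by
    obtain ⟨b, z, hz⟩ := p
    have hb : QuadraticMap.polar Q x (b • x + z) / (2 * Q x) = b := by
      rw [polar_smul_add_right, mem_vperp.1 hz]
      field_simp
      ring
    refine Prod.ext hb (Subtype.ext ?_)
    change b • x + z - (QuadraticMap.polar Q x (b • x + z) / (2 * Q x)) • x = z
    rw [hb, add_sub_cancel_left]
  right_inv v := by simp

lemma splitEquiv_apply (h2 : (2 : F) ≠ 0) {x : V} (hx : Q x ≠ 0) (p : F × vperp Q x) :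
    splitEquiv h2 hx p = p.1 • x + p.2 := rfl

lemma map_splitEquiv (h2 : (2 : F) ≠ 0) {x : V} (hx : Q x ≠ 0) (p : F × vperp Q x) :
    Q (splitEquiv h2 hx p) = p.1 * p.1 * Q x + Q p.2 := by
  rw [splitEquiv_apply, map_smul_add, mem_vperp.1 p.2.2, mul_zero, add_zero]

lemma polar_splitEquiv (h2 : (2 : F) ≠ 0) {x : V} (hx : Q x ≠ 0) (p : F × vperp Q x) :
    QuadraticMap.polar Q x (splitEquiv h2 hx p) = 2 * p.1 * Q x := by
  rw [splitEquiv_apply, polar_smul_add_right, mem_vperp.1 p.2.2, add_zero]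

lemma finrank_vperp [FiniteDimensional F V] (h2 : (2 : F) ≠ 0) {x : V} (hx : Q x ≠ 0) :
    Module.finrank F (vperp Q x) + 1 = Module.finrank F V := by
  rw [← (splitEquiv h2 hx).finrank_eq, Module.finrank_prod, Module.finrank_self, add_comm]

lemma nondegenerate_restrict_vperp (h2 : (2 : F) ≠ 0) (hQ : Q.polarBilin.Nondegenerate) {x : V}
    (hx : Q x ≠ 0) : (Q.restrict (vperp Q x)).polarBilin.Nondegenerate := by
  refine polarBilin_nondegenerate_iff.2 fun z hz => Subtype.ext (hQ.1 _ fun v => ?_)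
  obtain ⟨⟨b, w⟩, rfl⟩ := (splitEquiv h2 hx).surjective v
  have hzw : QuadraticMap.polar Q z w = 0 := hz w
  rw [splitEquiv_apply, QuadraticMap.polarBilin_apply_apply, QuadraticMap.polar_add_right,
    QuadraticMap.polar_smul_right, hzw, QuadraticMap.polar_comm, mem_vperp.1 z.2, smul_zero,
    add_zero]

lemma exists_map_ne_zero (hQ : Q.polarBilin.Nondegenerate) [Nontrivial V] : ∃ x, Q x ≠ 0 := by
  by_contra! h
  obtain ⟨x, hx⟩ := exists_ne (0 : V)
  exact hx (hQ.1 x fun y => by simp [QuadraticMap.polar, h])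

lemma card_subtype_prod_and {A B : Type*} [Fintype A] [Finite B] (p : A → Prop) [DecidablePred p]
    (r : A → B → Prop) :
    Nat.card {q : A × B // p q.1 ∧ r q.1 q.2} = ∑ a with p a, Nat.card {b // r a b} := by
  rw [Nat.card_congr (Equiv.subtypeProdEquivSigmaSubtype fun a b => p a ∧ r a b), Nat.card_sigma,
    Finset.sum_filter]
  refine Finset.sum_congr rfl fun a _ => ?_
  split_ifs with ha <;> simp [ha]

lemma card_eq_and_polar [Fintype F] [Finite V] (h2 : (2 : F) ≠ 0) {x : V} (hx : Q x ≠ 0) (c : F)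
    (p : F → Prop) [DecidablePred p] :
    Nat.card {v : V // Q v = c ∧ p (QuadraticMap.polar Q x v)} =
      ∑ b : F with p (2 * b * Q x),
        valueCount (Q.restrict (vperp Q x)) (c - b * b * Q x) := by
  have hsplit : {q : F × vperp Q x //
        p (2 * q.1 * Q x) ∧ Q.restrict (vperp Q x) q.2 = c - q.1 * q.1 * Q x} ≃
      {v : V // Q v = c ∧ p (QuadraticMap.polar Q x v)} :=
    (splitEquiv h2 hx).toEquiv.subtypeEquiv fun q => by
      simp only [LinearEquiv.coe_toEquiv, map_splitEquiv, polar_splitEquiv,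
        QuadraticMap.restrict_apply, eq_sub_iff_add_eq', and_comm]
  rw [← Nat.card_congr hsplit]
  exact card_subtype_prod_and (fun b => p (2 * b * Q x)) fun b z =>
    Q.restrict (vperp Q x) z = c - b * b * Q x

lemma valueCount_eq_sum [Fintype F] [Finite V] (h2 : (2 : F) ≠ 0) {x : V} (hx : Q x ≠ 0)
    (c : F) :
    valueCount Q c = ∑ b : F, valueCount (Q.restrict (vperp Q x)) (c - b * b * Q x) := by
  simpa [valueCount] using card_eq_and_polar h2 hx c fun _ => True

end Splitting

/-! ### The number of solutions of `Q v = c` -/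

section CharacterSums

variable {F : Type*} [Field F] [Fintype F] [DecidableEq F]

variable (F) in
/-- The function `|F| · 1_{c = 0} - 1` on a finite field `F`, written `v(c)` by Lidl and
Niederreiter; it has sum zero. -/
def centeredDelta (c : F) : ℤ := if c = 0 then (Fintype.card F : ℤ) - 1 else -1

lemma sum_quadraticChar_sub_mul (hF : ringChar F ≠ 2) {a : F} (ha : a ≠ 0) (c : F) :
    ∑ t : F, quadraticChar F (c - a * t) = 0 := by
  rw [← quadraticChar_sum_zero hF]
  exact Fintype.sum_equiv ((Equiv.mulLeft₀ a ha).trans (Equiv.subLeft c)) _ _ fun t => by simp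

lemma sum_comp_mul_self (hF : ringChar F ≠ 2) (f : F → ℤ) :
    ∑ b : F, f (b * b) = ∑ t : F, f t * (quadraticChar F t + 1) := by
  rw [← Finset.sum_fiberwise_of_maps_to (g := fun b : F => b * b) (t := Finset.univ)
    (fun _ _ => Finset.mem_univ _)]
  refine Finset.sum_congr rfl fun t _ => ?_
  have hfib : {b : F | b ^ 2 = t}.toFinset = ({b | b * b = t} : Finset F) := by
    ext b; simp [pow_two]
  rw [← quadraticChar_card_sqrts hF t, hfib, mul_comm, ← nsmul_eq_mul, ← Finset.sum_const]
  exact Finset.sum_congr rfl fun b hb => by rw [(Finset.mem_filter.1 hb).2]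

lemma quadraticChar_div {a : F} (ha : a ≠ 0) (c : F) :
    quadraticChar F (c / a) = quadraticChar F a * quadraticChar F c := by
  rw [← map_mul, show a * c = a ^ 2 * (c / a) by field_simp, map_mul, quadraticChar_sq_one' ha,
    one_mul]

lemma sum_centeredDelta_sub_mul_self (hF : ringChar F ≠ 2) {a : F} (ha : a ≠ 0) (c : F) :
    ∑ b : F, centeredDelta F (c - b * b * a) =
      Fintype.card F * quadraticChar F a * quadraticChar F c := by
  have hsummand (t : F) : centeredDelta F (c - t * a) * (quadraticChar F t + 1) =
      (if t = c / a then Fintype.card F * (quadraticChar F t + 1) else 0) -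
        quadraticChar F t - 1 := by
    have : c - t * a = 0 ↔ t = c / a := by rw [sub_eq_zero, eq_div_iff ha, eq_comm]
    simp only [centeredDelta, this]
    split_ifs <;> ring
  rw [sum_comp_mul_self hF fun t => centeredDelta F (c - t * a)]
  simp only [hsummand, Finset.sum_sub_distrib, quadraticChar_sum_zero hF, Finset.sum_ite_eq',
    Finset.mem_univ, if_true, quadraticChar_div ha, Finset.sum_const, Finset.card_univ,
    nsmul_eq_mul]
  ring

lemma sum_quadraticChar_neg_mul_self {a : F} :
    ∑ b : F, quadraticChar F (-(b * b * a)) =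
      quadraticChar F (-a) * ((Fintype.card F : ℤ) - 1) := by
  have hsummand (b : F) : quadraticChar F (-(b * b * a)) =
      quadraticChar F (-a) - (if b = 0 then quadraticChar F (-a) else 0) := by
    split_ifs with hb
    · simp [hb]
    · rw [show -(b * b * a) = b ^ 2 * (-a) by ring, map_mul, quadraticChar_sq_one' hb, one_mul,
        sub_zero]
  simp only [hsummand, Finset.sum_sub_distrib, Finset.sum_ite_eq', Finset.mem_univ, if_true,
    Finset.sum_const, Finset.card_univ, nsmul_eq_mul]
  ring

lemma sum_quadraticChar_sub_mul_mul_quadraticChar (hF : ringChar F ≠ 2) (a : F) {c : F}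
    (hc : c ≠ 0) :
    ∑ t : F, quadraticChar F (c - a * t) * quadraticChar F t = -quadraticChar F (-a) := by
  have hinv : ∑ t : F, quadraticChar F (c - a * t) * quadraticChar F t =
      ∑ t : F, (quadraticChar F (-a - (-c) * t) - if t = 0 then quadraticChar F (-a) else 0) := by
    refine Fintype.sum_equiv (Equiv.inv F) _ _ fun t => ?_
    simp only [Equiv.inv_apply, inv_eq_zero]
    split_ifs with ht
    · simp [ht]
    · rw [sub_zero, ← map_mul, show (c - a * t) * t = t ^ 2 * (-a - -c * t⁻¹) by
        field_simp; ring, map_mul, quadraticChar_sq_one' ht, one_mul]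
  rw [hinv, Finset.sum_sub_distrib, sum_quadraticChar_sub_mul hF (neg_ne_zero.2 hc),
    Finset.sum_ite_eq', if_pos (Finset.mem_univ _), zero_sub]

lemma sum_quadraticChar_sub_mul_self (hF : ringChar F ≠ 2) {a : F} (ha : a ≠ 0) (c : F) :
    ∑ b : F, quadraticChar F (c - b * b * a) = quadraticChar F (-a) * centeredDelta F c := by
  rw [centeredDelta]
  split_ifs with hc
  · simp only [hc, zero_sub, sum_quadraticChar_neg_mul_self]
  · rw [sum_comp_mul_self hF fun t => quadraticChar F (c - t * a)]
    simp only [mul_add, mul_one, Finset.sum_add_distrib,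
      sum_quadraticChar_sub_mul_mul_quadraticChar hF a hc, mul_comm _ a,
      sum_quadraticChar_sub_mul hF ha]
    ring

end CharacterSums

section Discrepancy

variable {F V : Type*} [Field F] [Fintype F] [DecidableEq F] [AddCommGroup V] [Module F V]

/-- The function of `c` to which the deviation of `#{v | Q v = c}` from its mean is proportional,
for a nondegenerate form `Q` in dimension `d`. -/
def discrepancyKernel (F : Type*) [Field F] [Fintype F] [DecidableEq F] (d : ℕ) (c : F) : ℤ :=
  if Even d then centeredDelta F c else quadraticChar F c

/-- The integer `T` determines the distribution of the values of `Q`: with `q = |F|` and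
`d = dim V`, one has `q #{v | Q v = c} = q ^ d + T φ c`, where `φ` is `discrepancyKernel F d`, and
`|T| = q ^ ⌈d / 2⌉`. For `d` even, the sign of `T` is the type of `Q`. -/
structure HasDiscrepancy (Q : QuadraticForm F V) (T : ℤ) : Prop where
  sq_eq : T ^ 2 = (Fintype.card F : ℤ) ^ (2 * ((Module.finrank F V + 1) / 2))
  card_mul : ∀ c, (Fintype.card F : ℤ) * valueCount Q c =
    (Fintype.card F : ℤ) ^ Module.finrank F V + T * discrepancyKernel F (Module.finrank F V) c

variable {Q : QuadraticForm F V}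

lemma HasDiscrepancy.of_even [Finite V] (hF : ringChar F ≠ 2) {x : V} (hx : Q x ≠ 0) {T : ℤ}
    (hd : Even (Module.finrank F (vperp Q x)))
    (h : HasDiscrepancy (Q.restrict (vperp Q x)) T) :
    HasDiscrepancy Q (Fintype.card F * quadraticChar F (Q x) * T) := by
  have h2 := Ring.two_ne_zero hF
  have hfr := finrank_vperp h2 hx
  have hd' : ¬ Even (Module.finrank F (vperp Q x) + 1) := by rwa [Nat.even_add_one, not_not]
  refine ⟨?_, fun c => ?_⟩
  · obtain ⟨j, hj⟩ := hd
    rw [mul_pow, mul_pow, quadraticChar_sq_one hx, h.sq_eq, ← hfr, hj,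
      show (j + j + 1) / 2 = j by lia, show (j + j + 1 + 1) / 2 = j + 1 by lia]
    ring
  · rw [valueCount_eq_sum h2 hx c, Nat.cast_sum, Finset.mul_sum]
    simp only [h.card_mul, Finset.sum_add_distrib, ← Finset.mul_sum, discrepancyKernel, if_pos hd,
      ← hfr, if_neg hd', sum_centeredDelta_sub_mul_self hF hx, Finset.sum_const, Finset.card_univ,
      nsmul_eq_mul]
    ring

lemma HasDiscrepancy.of_odd [Finite V] (hF : ringChar F ≠ 2) {x : V} (hx : Q x ≠ 0) {T : ℤ}
    (hd : Odd (Module.finrank F (vperp Q x)))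
    (h : HasDiscrepancy (Q.restrict (vperp Q x)) T) :
    HasDiscrepancy Q (quadraticChar F (-Q x) * T) := by
  have h2 := Ring.two_ne_zero hF
  have hfr := finrank_vperp h2 hx
  have hd' : Even (Module.finrank F (vperp Q x) + 1) := hd.add_one
  refine ⟨?_, fun c => ?_⟩
  · obtain ⟨j, hj⟩ := hd
    rw [mul_pow, quadraticChar_sq_one (neg_ne_zero.2 hx), h.sq_eq, ← hfr, hj,
      show (2 * j + 1 + 1) / 2 = j + 1 by lia, show (2 * j + 1 + 1 + 1) / 2 = j + 1 by lia]
    ring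
  · rw [valueCount_eq_sum h2 hx c, Nat.cast_sum, Finset.mul_sum]
    simp only [h.card_mul, Finset.sum_add_distrib, ← Finset.mul_sum, discrepancyKernel,
      if_neg (Nat.not_even_iff_odd.2 hd), ← hfr, if_pos hd', sum_quadraticChar_sub_mul_self hF hx,
      Finset.sum_const, Finset.card_univ, nsmul_eq_mul]
    ring

lemma hasDiscrepancy_one_of_finrank_eq_zero [Finite V] (hd : Module.finrank F V = 0) :
    HasDiscrepancy Q 1 := by
  have : Subsingleton V := Module.finrank_zero_iff.1 hd
  have hQ (v : V) : Q v = 0 := by rw [Subsingleton.elim v 0, QuadraticMap.map_zero]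
  refine ⟨by simp [hd], fun c => ?_⟩
  have hcount : valueCount Q c = if c = 0 then 1 else 0 := by
    simp only [valueCount, hQ, eq_comm (a := (0 : F))]
    split_ifs with hc <;> simp [hc]
  simp only [hcount, hd, discrepancyKernel, centeredDelta, Even.zero, if_true]
  split_ifs <;> simp

theorem exists_hasDiscrepancy [Finite V] (hF : ringChar F ≠ 2)
    (hQ : Q.polarBilin.Nondegenerate) : ∃ T, HasDiscrepancy Q T := by
  have h2 := Ring.two_ne_zero hF
  obtain ⟨d, hd⟩ : ∃ d, Module.finrank F V = d := ⟨_, rfl⟩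
  induction d generalizing V with
  | zero => exact ⟨1, hasDiscrepancy_one_of_finrank_eq_zero hd⟩
  | succ d ih =>
    have : Nontrivial V := Module.nontrivial_of_finrank_pos (R := F) (by lia)
    obtain ⟨x, hx⟩ := exists_map_ne_zero hQ
    have hfr := finrank_vperp h2 hx
    obtain ⟨T, hT⟩ := ih (nondegenerate_restrict_vperp h2 hQ hx) (by lia)
    rcases Nat.even_or_odd (Module.finrank F (vperp Q x)) with heven | hodd
    · exact ⟨_, hT.of_even hF hx heven⟩
    · exact ⟨_, hT.of_odd hF hx hodd⟩

lemma HasDiscrepancy.unique {T T' : ℤ} (h : HasDiscrepancy Q T) (h' : HasDiscrepancy Q T') :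
    T = T' := by
  have hker : discrepancyKernel F (Module.finrank F V) 1 ≠ 0 := by
    rw [discrepancyKernel]; split_ifs <;> simp [centeredDelta]
  exact mul_right_cancel₀ hker (add_left_cancel ((h.card_mul 1).symm.trans (h'.card_mul 1)))

end Discrepancy

/-! ### Totally singular subspaces and the sign -/

section TotallySingular

variable {F V : Type*} [Field F] [AddCommGroup V] [Module F V]

lemma card_mul_card_fibre [Finite V] {f : V →ₗ[F] F} (hf : f ≠ 0) (t : F) :
    Nat.card F * Nat.card {v : V // f v = t} = Nat.card V := by
  have hsurj := LinearMap.surjective hf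
  have : Finite F := Finite.of_surjective f hsurj
  have := Fintype.ofFinite F
  have hconst (s : F) : Nat.card {v : V // f v = s} = Nat.card {v : V // f v = t} := by
    obtain ⟨w, hw⟩ := hsurj (t - s)
    refine Nat.card_congr ((Equiv.addRight w).subtypeEquiv fun v => ?_)
    rw [Equiv.coe_addRight, map_add, hw, add_sub, sub_eq_iff_eq_add, add_comm t, add_left_inj]
  rw [← Nat.card_congr (Equiv.sigmaFiberEquiv f), Nat.card_sigma]
  simp only [hconst, Finset.sum_const, Finset.card_univ, Nat.card_eq_fintype_card, smul_eq_mul]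

lemma le_orthogonal_of_totallySingular {Q : QuadraticForm F V} {U : Submodule F V}
    (hU : ∀ u ∈ U, Q u = 0) : U ≤ LinearMap.BilinForm.orthogonal Q.polarBilin U := by
  intro v hv u hu
  change QuadraticMap.polar Q u v = 0
  rw [QuadraticMap.polar, hU _ (U.add_mem hu hv), hU u hu, hU v hv, sub_zero, sub_zero]

lemma sum_card_translate [Fintype V] {X : Type*} (f : V → X) (U : Submodule F V) (c : X) :
    ∑ v : V, Nat.card {u : U // f (v + u) = c} = Nat.card U * Nat.card {v : V // f v = c} := by
  have := Fintype.ofFinite U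
  have htranslate (u : U) : Nat.card {v : V // f (v + u) = c} = Nat.card {v : V // f v = c} :=
    Nat.card_congr ((Equiv.addRight (u : V)).subtypeEquiv fun v => Iff.rfl)
  have hswap : Nat.card {p : V × U // f (p.1 + p.2) = c} =
      Nat.card {p : U × V // f (p.2 + p.1) = c} :=
    Nat.card_congr ((Equiv.prodComm V U).subtypeEquiv fun _ => Iff.rfl)
  rw [← Nat.card_sigma, ← Nat.card_congr (Equiv.subtypeProdEquivSigmaSubtype
    fun (v : V) (u : U) => f (v + u) = c), hswap, Nat.card_congr
    (Equiv.subtypeProdEquivSigmaSubtype fun (u : U) (v : V) => f (v + u) = c), Nat.card_sigma]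
  simp only [htranslate, Finset.sum_const, Finset.card_univ, Nat.card_eq_fintype_card, smul_eq_mul]

open Classical in
lemma card_mul_card_translate [Finite V] {Q : QuadraticForm F V} {U : Submodule F V}
    (hU : ∀ u ∈ U, Q u = 0) (c : F) (v : V) :
    Nat.card F * Nat.card {u : U // Q (v + u) = c} + Nat.card U *
        (if v ∈ LinearMap.BilinForm.orthogonal Q.polarBilin U then 1 else 0) =
      Nat.card U + Nat.card F * Nat.card U *
        (if v ∈ LinearMap.BilinForm.orthogonal Q.polarBilin U ∧ Q v = c then 1 else 0) := by
  have hQ (u : U) : Q (v + u) = Q v + QuadraticMap.polar Q v u := by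
    rw [QuadraticMap.map_add Q, hU u u.2, add_zero]
  by_cases hv : v ∈ LinearMap.BilinForm.orthogonal Q.polarBilin U
  · have hvu (u : U) : QuadraticMap.polar Q v u = 0 := by
      rw [QuadraticMap.polar_comm]; exact hv u u.2
    simp only [hQ, hvu, add_zero, hv, true_and, if_true, mul_one]
    split_ifs with hc
    · rw [Nat.card_congr (Equiv.subtypeUnivEquiv fun _ : U => hc)]
      ring
    · simp [hc]
  · have hf : (Q.polarBilin v).comp U.subtype ≠ 0 := fun h => hv fun u hu =>
      (QuadraticMap.polar_comm Q u v).trans (LinearMap.congr_fun h ⟨u, hu⟩)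
    simp only [hv, if_false, false_and, mul_zero, add_zero, ← card_mul_card_fibre hf (c - Q v),
      hQ, eq_sub_iff_add_eq', LinearMap.comp_apply, Submodule.subtype_apply,
      QuadraticMap.polarBilin_apply_apply]

-- On a coset `v + U` the form is affine, hence equidistributed unless `v` is orthogonal to `U`.
lemma card_mul_valueCount_of_totallySingular [Finite V] {Q : QuadraticForm F V}
    {U : Submodule F V} (hU : ∀ u ∈ U, Q u = 0) (c : F) :
    Nat.card F * valueCount Q c + Nat.card (LinearMap.BilinForm.orthogonal Q.polarBilin U) =
      Nat.card V + Nat.card F *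
        Nat.card {v : V // v ∈ LinearMap.BilinForm.orthogonal Q.polarBilin U ∧ Q v = c} := by
  classical
  have := Fintype.ofFinite V
  have hind (p : V → Prop) [DecidablePred p] :
      Nat.card {v // p v} = ∑ v : V, if p v then 1 else 0 := by
    rw [Nat.card_eq_fintype_card, Fintype.card_subtype, Finset.card_filter]
  have hsum := Finset.sum_congr rfl fun (v : V) (_ : v ∈ Finset.univ) =>
    card_mul_card_translate hU c v
  simp only [Finset.sum_add_distrib, ← Finset.mul_sum, sum_card_translate, ← hind,
    Finset.sum_const, Finset.card_univ, ← Nat.card_eq_fintype_card, smul_eq_mul] at hsum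
  apply Nat.eq_of_mul_eq_mul_left (Nat.card_pos (α := U))
  rw [valueCount]
  linear_combination hsum

end TotallySingular

section Sign

variable {F V : Type*} [Field F] [AddCommGroup V] [Module F V] {Q : QuadraticForm F V}

lemma exists_maximal_totallySingular [Finite V] (Q : QuadraticForm F V) :
    ∃ U : Submodule F V, (∀ u ∈ U, Q u = 0) ∧
      ∀ v ∈ LinearMap.BilinForm.orthogonal Q.polarBilin U, Q v = 0 → v ∈ U := by
  have : Finite (Submodule F V) := Finite.of_injective _ SetLike.coe_injective
  obtain ⟨U, hU⟩ := Set.Finite.exists_maximal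
    (Set.toFinite {U : Submodule F V | ∀ u ∈ U, Q u = 0})
    ⟨⊥, fun u hu => by rw [(Submodule.mem_bot _).1 hu]; exact QuadraticMap.map_zero Q⟩
  refine ⟨U, hU.prop, fun v hv hv0 => ?_⟩
  have hsup : ∀ w ∈ U ⊔ Submodule.span F {v}, Q w = 0 := by
    intro w hw
    obtain ⟨u, hu, z, hz, rfl⟩ := Submodule.mem_sup.1 hw
    obtain ⟨b, rfl⟩ := Submodule.mem_span_singleton.1 hz
    have huv : QuadraticMap.polar Q u v = 0 := hv u hu
    rw [QuadraticMap.map_add Q, hU.prop u hu, QuadraticMap.map_smul, hv0,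
      QuadraticMap.polar_smul_right, huv, smul_zero, smul_zero, add_zero, add_zero]
  exact hU.le_of_ge hsup le_sup_left
    (Submodule.mem_sup_right (Submodule.mem_span_singleton_self v))

lemma exists_totallySingular_restrict_iff (W : Submodule F V) (k : ℕ) :
    (∃ U : Submodule F W, (∀ u ∈ U, Q.restrict W u = 0) ∧ 2 * Module.finrank F U = k) ↔
      ∃ U : Submodule F V, U ≤ W ∧ (∀ u ∈ U, Q u = 0) ∧ 2 * Module.finrank F U = k := by
  constructor
  · rintro ⟨U, hU, hdim⟩
    refine ⟨U.map W.subtype, Submodule.map_subtype_le W U, ?_, ?_⟩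
    · rintro _ ⟨u, hu, rfl⟩
      exact hU u hu
    · rw [Submodule.finrank_map_subtype_eq, hdim]
  · rintro ⟨U, hUW, hU, hdim⟩
    refine ⟨U.comap W.subtype, fun u hu => hU u hu, ?_⟩
    rw [(Submodule.comapSubtypeEquivOfLe hUW).finrank_eq, hdim]

variable [Fintype F] [DecidableEq F]

lemma HasDiscrepancy.mul_add_pow_of_maximal [Finite V] (hQ : Q.polarBilin.Nondegenerate) {m : ℕ}
    (hm : Module.finrank F V = 2 * m) {T : ℤ} (hT : HasDiscrepancy Q T) {U : Submodule F V}
    (hU : ∀ u ∈ U, Q u = 0)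
    (hmax : ∀ v ∈ LinearMap.BilinForm.orthogonal Q.polarBilin U, Q v = 0 → v ∈ U) :
    ∃ i, Module.finrank F U + i = m ∧
      T * ((Fintype.card F : ℤ) - 1) + (Fintype.card F : ℤ) ^ (Module.finrank F U + 2 * i) =
        (Fintype.card F : ℤ) ^ (Module.finrank F U + 1) := by
  have horth := LinearMap.BilinForm.finrank_orthogonal hQ U
  have hle := Submodule.finrank_mono (le_orthogonal_of_totallySingular hU)
  have hUV := Submodule.finrank_le U
  obtain ⟨i, hi⟩ : ∃ i, m = Module.finrank F U + i := ⟨m - Module.finrank F U, by lia⟩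
  refine ⟨i, hi.symm, ?_⟩
  have hsing : Nat.card {v : V // v ∈ LinearMap.BilinForm.orthogonal Q.polarBilin U ∧ Q v = 0} =
      Nat.card U :=
    Nat.card_congr (Equiv.subtypeEquivRight fun v =>
      ⟨fun h => hmax v h.1 h.2, fun h => ⟨le_orthogonal_of_totallySingular hU h, hU v h⟩⟩)
  have hcount := card_mul_valueCount_of_totallySingular hU 0
  rw [hsing, Module.natCard_eq_pow_finrank (K := F) (V := V),
    Module.natCard_eq_pow_finrank (K := F) (V := U),
    Module.natCard_eq_pow_finrank (K := F)
      (V := LinearMap.BilinForm.orthogonal Q.polarBilin U), horth, hm, Nat.card_eq_fintype_card,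
    show 2 * m - Module.finrank F U = Module.finrank F U + 2 * i by lia] at hcount
  have hzero := hT.card_mul 0
  simp only [hm, discrepancyKernel, centeredDelta, even_two_mul, if_true] at hzero
  zify at hcount
  rw [hzero] at hcount
  linear_combination hcount

theorem HasDiscrepancy.exists_totallySingular_iff [Finite V] (hQ : Q.polarBilin.Nondegenerate)
    {m : ℕ} (hm : Module.finrank F V = 2 * m) {T : ℤ} (hT : HasDiscrepancy Q T) :
    (∃ U : Submodule F V, (∀ u ∈ U, Q u = 0) ∧ 2 * Module.finrank F U = Module.finrank F V) ↔
      T = (Fintype.card F : ℤ) ^ m := by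
  have hq : (1 : ℤ) < Fintype.card F := by exact_mod_cast Fintype.one_lt_card
  constructor
  · rintro ⟨U, hU, hdim⟩
    have heq : U = LinearMap.BilinForm.orthogonal Q.polarBilin U :=
      Submodule.eq_of_le_of_finrank_eq (le_orthogonal_of_totallySingular hU) (by
        rw [LinearMap.BilinForm.finrank_orthogonal hQ U]; lia)
    obtain ⟨i, hi, h⟩ := hT.mul_add_pow_of_maximal hQ hm hU fun v hv _ => heq.symm ▸ hv
    obtain rfl : i = 0 := by lia
    obtain rfl : Module.finrank F U = m := by lia
    refine mul_right_cancel₀ (sub_pos.2 hq).ne' ?_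
    linear_combination h
  · intro hTm
    obtain ⟨U, hU, hmax⟩ := exists_maximal_totallySingular Q
    refine ⟨U, hU, ?_⟩
    obtain ⟨i, hi, h⟩ := hT.mul_add_pow_of_maximal hQ hm hU hmax
    rcases Nat.eq_zero_or_pos i with rfl | hpos
    · lia
    · have hlt : (Fintype.card F : ℤ) ^ (Module.finrank F U + 1) <
          (Fintype.card F : ℤ) ^ (Module.finrank F U + 2 * i) :=
        pow_lt_pow_right₀ hq (by lia)
      have hnonneg : 0 ≤ T * ((Fintype.card F : ℤ) - 1) := by
        rw [hTm]; exact mul_nonneg (by positivity) (sub_pos.2 hq).le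
      linarith

theorem sgn_eq_of_hasDiscrepancy [Finite V] {W : Submodule F V}
    (hW : (Q.restrict W).polarBilin.Nondegenerate) {m : ℕ} (hm : Module.finrank F W = 2 * m)
    {ξ : ℤˣ} (hT : HasDiscrepancy (Q.restrict W) (ξ * (Fintype.card F : ℤ) ^ m)) :
    sgn Q W = ξ := by
  have hpos : (0 : ℤ) < (Fintype.card F : ℤ) ^ m := by
    exact_mod_cast pow_pos Fintype.card_pos m
  rw [sgn, ← exists_totallySingular_restrict_iff, hT.exists_totallySingular_iff hW hm]
  rcases Int.units_eq_one_or ξ with rfl | rfl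
  · simp
  · rw [if_neg]
    simp only [Units.val_neg, Units.val_one]
    linarith

end Sign

/-! ### Points and Higman parameters -/

section HyperplaneCounts

variable {F V : Type*} [Field F] [AddCommGroup V] [Module F V] {Q : QuadraticForm F V}

lemma orthogonal_span_singleton (x : V) :
    LinearMap.BilinForm.orthogonal Q.polarBilin (Submodule.span F {x}) = vperp Q x := by
  ext v
  refine ⟨fun h => h x (Submodule.mem_span_singleton_self x), fun h y hy => ?_⟩
  obtain ⟨b, rfl⟩ := Submodule.mem_span_singleton.1 hy
  change QuadraticMap.polar Q (b • x) v = 0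
  rw [QuadraticMap.polar_smul_left, mem_vperp.1 h, smul_zero]

lemma valueCount_restrict (W : Submodule F V) (c : F) :
    valueCount (Q.restrict W) c = Nat.card {v : V // v ∈ W ∧ Q v = c} :=
  Nat.card_congr (Equiv.subtypeSubtypeEquivSubtypeInter (· ∈ W) fun v => Q v = c)

lemma valueCount_restrict_vperp_restrict_vperp {x : V} (y : vperp Q x) (c : F) :
    valueCount ((Q.restrict (vperp Q x)).restrict (vperp (Q.restrict (vperp Q x)) y)) c =
      Nat.card {z : V // QuadraticMap.polar Q x z = 0 ∧ QuadraticMap.polar Q y z = 0 ∧ Q z = c} :=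
  (valueCount_restrict _ c).trans <| Nat.card_congr <|
    Equiv.subtypeSubtypeEquivSubtypeInter (· ∈ vperp Q x) fun z : V =>
      QuadraticMap.polar Q y z = 0 ∧ Q z = c

variable [Fintype F] [DecidableEq F]

lemma HasDiscrepancy.card_mul_valueCount_of_even {n : ℕ} (hd : Module.finrank F V = 2 * n) {T : ℤ}
    (hT : HasDiscrepancy Q T) {c : F} (hc : c ≠ 0) :
    (Fintype.card F : ℤ) * valueCount Q c = (Fintype.card F : ℤ) ^ (2 * n) - T := by
  rw [hT.card_mul, hd, discrepancyKernel, if_pos (even_two_mul n), centeredDelta, if_neg hc,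
    mul_neg_one, sub_eq_add_neg]

lemma HasDiscrepancy.card_mul_valueCount_vperp_of_eq_zero [Finite V]
    (hQ : Q.polarBilin.Nondegenerate) {n : ℕ} (hd : Module.finrank F V = 2 * (n + 1)) {T : ℤ}
    (hT : HasDiscrepancy Q T) {u : V} (hu0 : u ≠ 0) (hu : Q u = 0) {c : F} (hc : c ≠ 0) :
    (Fintype.card F : ℤ) * valueCount (Q.restrict (vperp Q u)) c =
      (Fintype.card F : ℤ) ^ (2 * n + 1) - T := by
  have hspan (y : V) (hy : y ∈ Submodule.span F {u}) : Q y = 0 := by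
    obtain ⟨b, rfl⟩ := Submodule.mem_span_singleton.1 hy
    rw [QuadraticMap.map_smul, hu, smul_zero]
  have hcount := card_mul_valueCount_of_totallySingular hspan c
  have hf : Q.polarBilin u ≠ 0 := fun h => hu0 (hQ.1 u (LinearMap.congr_fun h))
  have hhyper : Nat.card F * Nat.card (vperp Q u) = Nat.card V := card_mul_card_fibre hf 0
  rw [orthogonal_span_singleton, ← valueCount_restrict] at hcount
  rw [Module.natCard_eq_pow_finrank (K := F) (V := V), hd] at hcount hhyper
  rw [Nat.card_eq_fintype_card] at hcount hhyper
  zify at hcount hhyper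
  have hq : (Fintype.card F : ℤ) ≠ 0 := Nat.cast_ne_zero.2 Fintype.card_ne_zero
  apply mul_left_cancel₀ hq
  linear_combination (Fintype.card F : ℤ) * hT.card_mul_valueCount_of_even hd hc + hhyper -
    (Fintype.card F : ℤ) * hcount

lemma HasDiscrepancy.card_mul_valueCount_vperp_of_eq [Finite V] (hF : ringChar F ≠ 2)
    (hQ : Q.polarBilin.Nondegenerate) {n : ℕ} (hd : Module.finrank F V = 2 * (n + 1)) {T : ℤ}
    (hT : HasDiscrepancy Q T) {u : V} {c : F} (hc : c ≠ 0) (hu : Q u = c) :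
    (Fintype.card F : ℤ) * valueCount (Q.restrict (vperp Q u)) c =
      (Fintype.card F : ℤ) ^ (2 * n + 1) + quadraticChar F (-1) * T := by
  subst hu
  have h2 := Ring.two_ne_zero hF
  have hfr : Module.finrank F (vperp Q u) = 2 * n + 1 := by
    have := finrank_vperp h2 hc
    lia
  obtain ⟨T', hT'⟩ := exists_hasDiscrepancy hF (nondegenerate_restrict_vperp h2 hQ hc)
  have hodd : Odd (Module.finrank F (vperp Q u)) := hfr ▸ odd_two_mul_add_one n
  have hmul : quadraticChar F (-1) * quadraticChar F (-Q u) = quadraticChar F (Q u) := by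
    rw [← map_mul, neg_one_mul, neg_neg]
  rw [hT'.card_mul, hT.unique (hT'.of_odd hF hc hodd), discrepancyKernel,
    if_neg (Nat.not_even_iff_odd.2 hodd), hfr, ← mul_assoc, hmul, mul_comm T']

lemma HasDiscrepancy.restrict_vperp [Finite V] (hF : ringChar F ≠ 2)
    (hQ : Q.polarBilin.Nondegenerate) {m : ℕ} (hd : Module.finrank F V = 2 * m + 1) {a : ℤ}
    (hT : HasDiscrepancy Q (a * (Fintype.card F : ℤ) ^ (m + 1))) {v : V} (hv : Q v ≠ 0) :
    HasDiscrepancy (Q.restrict (vperp Q v))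
      (a * quadraticChar F (Q v) * (Fintype.card F : ℤ) ^ m) := by
  have h2 := Ring.two_ne_zero hF
  have hfr : Module.finrank F (vperp Q v) = 2 * m := by
    have := finrank_vperp h2 hv
    lia
  obtain ⟨T, hT'⟩ := exists_hasDiscrepancy hF (nondegenerate_restrict_vperp h2 hQ hv)
  have huniq := hT.unique (hT'.of_even hF hv (hfr ▸ even_two_mul m))
  have hq : (Fintype.card F : ℤ) ≠ 0 := Nat.cast_ne_zero.2 Fintype.card_ne_zero
  have hT_eq : a * quadraticChar F (Q v) * (Fintype.card F : ℤ) ^ m = T := by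
    apply mul_left_cancel₀ hq
    linear_combination quadraticChar F (Q v) * huniq +
      (Fintype.card F : ℤ) * T * quadraticChar_sq_one hv
  rwa [hT_eq]

end HyperplaneCounts

section Points

variable {F V : Type*} [Field F] [AddCommGroup V] [Module F V]

lemma ncard_points_mul_card_units {p : V → Prop} (hp : ∀ (a : Fˣ) v, p (a • v) ↔ p v)
    (h0 : ¬ p 0) :
    {x : ℙ F V | p x.rep}.ncard * Nat.card Fˣ = Nat.card {v : V // p v} := by
  let f (y : {x : ℙ F V // p x.rep} × Fˣ) : {v : V // p v} :=
    ⟨y.2 • y.1.1.rep, (hp _ _).2 y.1.2⟩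
  have hf : Function.Bijective f := by
    constructor
    · rintro ⟨⟨x, hx⟩, a⟩ ⟨⟨y, hy⟩, b⟩ h
      replace h : a • x.rep = b • y.rep := congrArg Subtype.val h
      obtain rfl : x = y := by
        rw [← x.mk_rep, ← y.mk_rep, Projectivization.mk_eq_mk_iff]
        exact ⟨a⁻¹ * b, by rw [mul_smul, ← h, inv_smul_smul]⟩
      rw [Units.ext (smul_left_injective F x.rep_nonzero h)]
    · rintro ⟨v, hv⟩
      have hv0 : v ≠ 0 := by rintro rfl; exact h0 hv
      obtain ⟨a, ha⟩ := Projectivization.exists_smul_eq_mk_rep F v hv0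
      refine ⟨⟨⟨Projectivization.mk F v hv0, ?_⟩, a⁻¹⟩, Subtype.ext ?_⟩
      · rwa [← ha, hp]
      · change a⁻¹ • (Projectivization.mk F v hv0).rep = v
        rw [← ha, inv_smul_smul]
  rw [← Nat.card_congr (Equiv.ofBijective f hf), Nat.card_prod, ← Nat.card_coe_set_eq]
  rfl

variable {Q : QuadraticForm F V}

lemma perp_eq_vperp (x : ℙ F V) : perp Q x = vperp Q x.rep := by
  rw [perp, Projectivization.submodule_eq, orthogonal_span_singleton]

lemma submodule_le_perp_iff (x y : ℙ F V) :
    y.submodule ≤ perp Q x ↔ QuadraticMap.polar Q x.rep y.rep = 0 := by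
  rw [Projectivization.submodule_eq, Submodule.span_singleton_le_iff_mem, perp_eq_vperp, mem_vperp]

end Points

section TernaryPoints

variable {V : Type*} [AddCommGroup V] [Module (ZMod 3) V] {Q : QuadraticForm (ZMod 3) V}

lemma ringChar_zmod_three : ringChar (ZMod 3) ≠ 2 := by
  rw [ZMod.ringChar_zmod_n]; decide

lemma two_ne_zero_zmod_three : (2 : ZMod 3) ≠ 0 := by decide

lemma mk_eq_mk_iff_eq_or_eq_neg {v w : V} (hv : v ≠ 0) (hw : w ≠ 0) :
    Projectivization.mk (ZMod 3) v hv = Projectivization.mk (ZMod 3) w hw ↔ v = w ∨ v = -w := by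
  have hcases (a : ZMod 3) : a = 0 ∨ a = 1 ∨ a = -1 := by revert a; decide
  rw [Projectivization.mk_eq_mk_iff']
  constructor
  · rintro ⟨a, rfl⟩
    rcases hcases a with rfl | rfl | rfl
    · exact absurd (zero_smul _ w) hv
    · exact Or.inl (one_smul _ w)
    · exact Or.inr (by rw [neg_smul, one_smul])
  · rintro (rfl | rfl)
    · exact ⟨1, one_smul _ _⟩
    · exact ⟨-1, by rw [neg_smul, one_smul]⟩

lemma rep_mk_eq_or_eq_neg (v : V) (hv : v ≠ 0) :
    (Projectivization.mk (ZMod 3) v hv).rep = v ∨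
      (Projectivization.mk (ZMod 3) v hv).rep = -v := by
  rw [← mk_eq_mk_iff_eq_or_eq_neg (Projectivization.rep_nonzero _) hv, Projectivization.mk_rep]

lemma two_mul_ncard_points {p : V → Prop} (hneg : ∀ v, p (-v) ↔ p v) (h0 : ¬ p 0) :
    2 * {x : ℙ (ZMod 3) V | p x.rep}.ncard = Nat.card {v : V // p v} := by
  have hunits (a : (ZMod 3)ˣ) (v : V) : p (a • v) ↔ p v := by
    obtain rfl | rfl : a = 1 ∨ a = -1 := by revert a; decide
    · rw [one_smul]
    · rw [Units.neg_smul, one_smul, hneg]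
  have hcard : Nat.card (ZMod 3)ˣ = 2 := by
    rw [Nat.card_eq_fintype_card, ZMod.card_units_eq_totient, Nat.totient_prime Nat.prime_three]
  rw [← ncard_points_mul_card_units hunits h0, hcard, mul_comm]

lemma quadraticChar_zmod_three_injective : Function.Injective (quadraticChar (ZMod 3)) := by
  decide

/-- `ε` is the value of `Q` at the vectors that span the points of type `ξ`. For `|F| = 3` it does
not depend on the choice of the vectors, and the points of type `ξ` are those of norm `ε`. -/
structure IsPointNorm (Q : QuadraticForm (ZMod 3) V) (ξ : ℤˣ) (ε : ZMod 3) : Prop where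
  ne_zero : ε ≠ 0
  mem_iff : ∀ x, x ∈ nonsingPoints Q ξ ↔ Q x.rep = ε

lemma exists_hasDiscrepancy_units_mul [Finite V] (hQ : Q.polarBilin.Nondegenerate) {m : ℕ}
    (hd : Module.finrank (ZMod 3) V = 2 * m + 1) (ξ : ℤˣ) :
    ∃ ε : ZMod 3, ε ≠ 0 ∧ HasDiscrepancy Q (ξ * quadraticChar (ZMod 3) ε * 3 ^ (m + 1)) := by
  obtain ⟨T, hT⟩ := exists_hasDiscrepancy ringChar_zmod_three hQ
  have hsq := hT.sq_eq
  rw [hd, show (2 * m + 1 + 1) / 2 = m + 1 by lia, mul_comm, pow_mul] at hsq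
  obtain ⟨η, rfl⟩ : ∃ η : ℤˣ, T = η * 3 ^ (m + 1) := by
    rcases sq_eq_sq_iff_eq_or_eq_neg.1 hsq with rfl | rfl
    · exact ⟨1, by simp⟩
    · exact ⟨-1, by simp⟩
  obtain ⟨ε, hε, hη⟩ := (by decide : ∀ η ξ : ℤˣ, ∃ ε : ZMod 3, ε ≠ 0 ∧
    (η : ℤ) = ξ * quadraticChar (ZMod 3) ε) η ξ
  exact ⟨ε, hε, hη ▸ hT⟩

lemma hasDiscrepancy_restrict_vperp_of_eq [Finite V] (hQ : Q.polarBilin.Nondegenerate) {m : ℕ}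
    (hd : Module.finrank (ZMod 3) V = 2 * m + 1) {ξ : ℤˣ} {ε : ZMod 3} (hε : ε ≠ 0)
    (hT : HasDiscrepancy Q (ξ * quadraticChar (ZMod 3) ε * 3 ^ (m + 1))) {v : V} (hv : Q v = ε) :
    HasDiscrepancy (Q.restrict (vperp Q v)) (ξ * 3 ^ m) := by
  have h := HasDiscrepancy.restrict_vperp ringChar_zmod_three hQ hd hT (v := v) (by rwa [hv])
  rwa [hv, mul_assoc (ξ : ℤ), ← sq, quadraticChar_sq_one hε, mul_one] at h

lemma isPointNorm_of_hasDiscrepancy [Finite V] (hQ : Q.polarBilin.Nondegenerate) {m : ℕ}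
    (hd : Module.finrank (ZMod 3) V = 2 * m + 1) {ξ : ℤˣ} {ε : ZMod 3} (hε : ε ≠ 0)
    (hT : HasDiscrepancy Q (ξ * quadraticChar (ZMod 3) ε * 3 ^ (m + 1))) :
    IsPointNorm Q ξ ε := by
  refine ⟨hε, fun x => ?_⟩
  have hsgn (hx : Q x.rep ≠ 0) {η : ℤˣ} (hη : (η : ℤ) * quadraticChar (ZMod 3) (Q x.rep) =
      ξ * quadraticChar (ZMod 3) ε) : sgn Q (vperp Q x.rep) = η := by
    have hfr := finrank_vperp two_ne_zero_zmod_three hx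
    rw [← hη] at hT
    exact sgn_eq_of_hasDiscrepancy
      (nondegenerate_restrict_vperp two_ne_zero_zmod_three hQ hx) (by lia)
      (hasDiscrepancy_restrict_vperp_of_eq hQ hd hx hT rfl)
  rw [nonsingPoints, Set.mem_ofPred_eq, perp_eq_vperp]
  constructor
  · rintro ⟨hx, hξ⟩
    obtain ⟨η, hη⟩ := (by decide : ∀ (ξ : ℤˣ) (ε a : ZMod 3), ε ≠ 0 → a ≠ 0 → ∃ η : ℤˣ,
      (η : ℤ) * quadraticChar (ZMod 3) a = ξ * quadraticChar (ZMod 3) ε) ξ ε _ hε hx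
    obtain rfl : η = ξ := (hsgn hx hη).symm.trans hξ
    exact quadraticChar_zmod_three_injective (mul_left_cancel₀ η.ne_zero hη)
  · rintro hx
    exact ⟨hx ▸ hε, hsgn (hx ▸ hε) (by rw [hx])⟩

-- `w - v` is a singular vector of `v^⊥`.
lemma card_perp_perp_of_polar_eq_neg [Finite V] (hQ : Q.polarBilin.Nondegenerate) {n : ℕ} {T : ℤ}
    {ε : ZMod 3} (hε : ε ≠ 0) {v w : V} (hd : Module.finrank (ZMod 3) (vperp Q v) = 2 * (n + 1))
    (hT : HasDiscrepancy (Q.restrict (vperp Q v)) T) (hv : Q v = ε) (hw : Q w = ε)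
    (hvw : QuadraticMap.polar Q v w = -ε) (hne : v ≠ w) :
    (3 : ℤ) * Nat.card {z : V // QuadraticMap.polar Q v z = 0 ∧ QuadraticMap.polar Q w z = 0 ∧
      Q z = ε} = 3 ^ (2 * n + 1) - T := by
  have hperp : QuadraticMap.polar Q v (w - v) = 0 := by
    rw [QuadraticMap.polar_sub_right, hvw, polar_self_eq_two_mul, hv,
      (by decide : ∀ a : ZMod 3, 2 * a = -a), sub_self]
  have hzero : Q (w - v) = 0 := by
    have h := QuadraticMap.map_add Q v (w - v)
    rw [add_sub_cancel, hperp, add_zero, hw, hv] at h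
    exact left_eq_add.1 h
  have hcount := hT.card_mul_valueCount_vperp_of_eq_zero
    (nondegenerate_restrict_vperp two_ne_zero_zmod_three hQ (hv ▸ hε : Q v ≠ 0)) hd
    (u := ⟨w - v, hperp⟩) (fun h => hne (sub_eq_zero.1 (congrArg Subtype.val h)).symm) hzero hε
  rw [valueCount_restrict_vperp_restrict_vperp, ZMod.card] at hcount
  rw [← Nat.cast_three, ← hcount]
  congr 2
  refine Nat.card_congr (Equiv.subtypeEquivRight fun z => and_congr_right fun hz => ?_)
  rw [QuadraticMap.polar_sub_left, hz, sub_zero]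

lemma card_perp_perp_of_ne [Finite V] (hQ : Q.polarBilin.Nondegenerate) {n : ℕ} {T : ℤ}
    {ε : ZMod 3} (hε : ε ≠ 0) {v w : V} (hd : Module.finrank (ZMod 3) (vperp Q v) = 2 * (n + 1))
    (hT : HasDiscrepancy (Q.restrict (vperp Q v)) T) (hv : Q v = ε) (hw : Q w = ε)
    (hne : v ≠ w) (hne' : v ≠ -w) :
    (3 : ℤ) * Nat.card {z : V // QuadraticMap.polar Q v z = 0 ∧ QuadraticMap.polar Q w z = 0 ∧
      Q z = ε} = 3 ^ (2 * n + 1) - T := by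
  rcases (by decide : ∀ a ε : ZMod 3, ε ≠ 0 → a = 0 ∨ a = -ε ∨ a = ε)
    (QuadraticMap.polar Q v w) ε hε with h | h | h
  · have hcount := hT.card_mul_valueCount_vperp_of_eq ringChar_zmod_three
      (nondegenerate_restrict_vperp two_ne_zero_zmod_three hQ (hv ▸ hε : Q v ≠ 0)) hd
      (u := ⟨w, h⟩) hε hw
    rw [valueCount_restrict_vperp_restrict_vperp, ZMod.card,
      show quadraticChar (ZMod 3) (-1) = -1 by decide] at hcount
    linear_combination hcount
  · exact card_perp_perp_of_polar_eq_neg hQ hε hd hT hv hw h hne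
  · have hcount := card_perp_perp_of_polar_eq_neg hQ hε hd hT hv
      ((QuadraticMap.map_neg Q w).trans hw) (by rw [QuadraticMap.polar_neg_right, h]) hne'
    simpa only [QuadraticMap.polar_neg_left, neg_eq_zero] using hcount

variable {ξ : ℤˣ} {ε : ZMod 3}

lemma Delta_eq (hε : IsPointNorm Q ξ ε) (x : ℙ (ZMod 3) V) :
    Delta Q ξ x = {y : ℙ (ZMod 3) V | QuadraticMap.polar Q x.rep y.rep = 0 ∧ Q y.rep = ε} := by
  ext y
  simp only [Delta, Set.mem_ofPred_eq, hε.mem_iff, submodule_le_perp_iff, and_comm]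

lemma notMem_Delta_self {x : ℙ (ZMod 3) V} (hx : x ∈ nonsingPoints Q ξ) : x ∉ Delta Q ξ x := by
  rintro ⟨-, h⟩
  rw [submodule_le_perp_iff, polar_self_eq_two_mul] at h
  exact hx.1 ((mul_eq_zero.1 h).resolve_left two_ne_zero_zmod_three)

lemma ncard_eq_add_one [Finite V] {x : ℙ (ZMod 3) V} {O : Set (ℙ (ZMod 3) V)}
    (hO : O ⊆ nonsingPoints Q ξ) (hx : x ∈ O) :
    O.ncard = (O ∩ Delta Q ξ x).ncard + (O ∩ Gamma Q ξ x).ncard + 1 := by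
  have hself := notMem_Delta_self (hO hx)
  have hinsert : O = insert x (O ∩ Delta Q ξ x ∪ O ∩ Gamma Q ξ x) := by
    ext y
    simp only [Set.mem_insert_iff, Set.mem_union, Set.mem_inter_iff, Delta, Gamma,
      Set.mem_ofPred_eq]
    constructor
    · intro hy
      have := hO hy
      tauto
    · rintro (rfl | h | h)
      exacts [hx, h.1, h.1]
  conv_lhs => rw [hinsert]
  rw [Set.ncard_insert_of_notMem, Set.ncard_union_eq]
  · exact Set.disjoint_left.2 fun y hy hy' => hy'.2.2.2 hy.2.2
  · rintro (h | h)
    exacts [hself h.2, h.2.2.1 rfl]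

lemma two_mul_ncard_Delta [Finite V] {m : ℕ} (hd : Module.finrank (ZMod 3) V = 2 * m + 1)
    (hQ : Q.polarBilin.Nondegenerate) (hε : IsPointNorm Q ξ ε)
    (hT : HasDiscrepancy Q (ξ * quadraticChar (ZMod 3) ε * 3 ^ (m + 1))) {x : ℙ (ZMod 3) V}
    (hx : x ∈ nonsingPoints Q ξ) :
    3 * (2 * ((Delta Q ξ x).ncard : ℤ)) = 3 ^ (2 * m) - ξ * 3 ^ m := by
  have hxε := (hε.mem_iff x).1 hx
  have hfr := finrank_vperp two_ne_zero_zmod_three hx.1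
  have hcount := (hasDiscrepancy_restrict_vperp_of_eq hQ hd hε.ne_zero hT
    hxε).card_mul_valueCount_of_even (n := m) (by lia) hε.ne_zero
  have hpoints := two_mul_ncard_points
    (p := fun w => QuadraticMap.polar Q x.rep w = 0 ∧ Q w = ε)
    (fun v => by rw [QuadraticMap.polar_neg_right, neg_eq_zero, QuadraticMap.map_neg])
    (fun h => hε.ne_zero (h.2.symm.trans (QuadraticMap.map_zero Q)))
  rw [valueCount_restrict] at hcount
  simp only [mem_vperp, ← hpoints, ← Delta_eq hε, ZMod.card] at hcount
  exact_mod_cast hcount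

lemma two_mul_ncard_Delta_inter_Delta [Finite V] {n : ℕ}
    (hd : Module.finrank (ZMod 3) V = 2 * (n + 1) + 1) (hQ : Q.polarBilin.Nondegenerate)
    (hε : IsPointNorm Q ξ ε)
    (hT : HasDiscrepancy Q (ξ * quadraticChar (ZMod 3) ε * 3 ^ (n + 2))) {x y : ℙ (ZMod 3) V}
    (hx : x ∈ nonsingPoints Q ξ) (hy : y ∈ nonsingPoints Q ξ) (hxy : x ≠ y) :
    3 * (2 * ((Delta Q ξ x ∩ Delta Q ξ y).ncard : ℤ)) = 3 ^ (2 * n + 1) - ξ * 3 ^ (n + 1) := by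
  have hxε := (hε.mem_iff x).1 hx
  have hfr := finrank_vperp two_ne_zero_zmod_three hx.1
  obtain ⟨hne, hne'⟩ := not_or.1 fun h => hxy <| by
    rwa [← mk_eq_mk_iff_eq_or_eq_neg x.rep_nonzero y.rep_nonzero, Projectivization.mk_rep,
      Projectivization.mk_rep] at h
  have hcount := card_perp_perp_of_ne hQ hε.ne_zero (n := n) (by lia)
    (hasDiscrepancy_restrict_vperp_of_eq hQ hd hε.ne_zero hT hxε) hxε ((hε.mem_iff y).1 hy) hne hne'
  have hpoints := two_mul_ncard_points
    (p := fun w => QuadraticMap.polar Q x.rep w = 0 ∧ QuadraticMap.polar Q y.rep w = 0 ∧ Q w = ε)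
    (fun v => by simp only [QuadraticMap.polar_neg_right, neg_eq_zero, QuadraticMap.map_neg])
    (fun h => hε.ne_zero (h.2.2.symm.trans (QuadraticMap.map_zero Q)))
  have hinter : Delta Q ξ x ∩ Delta Q ξ y = {z : ℙ (ZMod 3) V |
      QuadraticMap.polar Q x.rep z.rep = 0 ∧ QuadraticMap.polar Q y.rep z.rep = 0 ∧
        Q z.rep = ε} := by
    ext z
    simp only [Delta_eq hε, Set.mem_inter_iff, Set.mem_ofPred_eq]
    tauto
  rw [← hpoints, ← hinter] at hcount
  exact_mod_cast hcount

lemma two_mul_ncard_nonsingPoints {m : ℕ} (hd : Module.finrank (ZMod 3) V = 2 * m + 1)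
    (hε : IsPointNorm Q ξ ε)
    (hT : HasDiscrepancy Q (ξ * quadraticChar (ZMod 3) ε * 3 ^ (m + 1))) :
    2 * ((nonsingPoints Q ξ).ncard : ℤ) = 3 ^ m * (3 ^ m + ξ) := by
  have hcount := hT.card_mul ε
  have hpoints := two_mul_ncard_points (p := fun w => Q w = ε)
    (fun v => by rw [QuadraticMap.map_neg])
    (fun h => hε.ne_zero (h.symm.trans (QuadraticMap.map_zero Q)))
  have hset : nonsingPoints Q ξ = {z : ℙ (ZMod 3) V | Q z.rep = ε} := Set.ext hε.mem_iff
  rw [valueCount, ← hpoints, ← hset, hd, discrepancyKernel,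
    if_neg (Nat.not_even_bit1 m), ZMod.card] at hcount
  push_cast at hcount
  refine mul_left_cancel₀ (three_ne_zero (α := ℤ)) ?_
  linear_combination hcount + ξ * 3 ^ (m + 1) * quadraticChar_sq_one hε.ne_zero

/-- Higman's parameters of the points of type `ξ` in dimension `2 n + 3`, where `λ = μ`. -/
structure PointParams (n : ℕ) (ξ : ℤˣ) (k l mu : ℕ) : Prop where
  two_mul_k : 2 * (k : ℤ) = 3 ^ n * (3 ^ (n + 1) - ξ)
  l_eq : (l : ℤ) = (3 ^ (n + 1) - ξ) * (3 ^ n + ξ)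
  two_mul_mu : 2 * (mu : ℤ) = 3 ^ n * (3 ^ n - ξ)

lemma exists_pointParams (n : ℕ) (ξ : ℤˣ) : ∃ k l mu, PointParams n ξ k l mu := by
  have hodd (j : ℕ) : Odd ((3 : ℤ) ^ j) := Odd.pow (by decide)
  have hξ : |(ξ : ℤ)| = 1 := Int.isUnit_iff_abs_eq.1 ξ.isUnit
  have hξ_odd : Odd (ξ : ℤ) := by rcases Int.units_eq_one_or ξ with rfl | rfl <;> decide
  have hle (j : ℕ) : |(ξ : ℤ)| ≤ 3 ^ j := hξ.trans_le (one_le_pow₀ (by norm_num))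
  have hhalf (j : ℕ) : ∃ k : ℕ, 2 * (k : ℤ) = 3 ^ n * (3 ^ j - ξ) := by
    obtain ⟨a, ha⟩ := ((hodd j).sub_odd hξ_odd)
    have ha0 : 0 ≤ a := by linarith [le_of_abs_le (hle j)]
    refine ⟨(3 ^ n * a).toNat, ?_⟩
    rw [Int.toNat_of_nonneg (by positivity), ha]
    ring
  obtain ⟨k, hk⟩ := hhalf (n + 1)
  obtain ⟨mu, hmu⟩ := hhalf n
  have hl : 0 ≤ ((3 : ℤ) ^ (n + 1) - ξ) * (3 ^ n + ξ) :=
    mul_nonneg (sub_nonneg.2 (le_of_abs_le (hle (n + 1)))) (by linarith [neg_le_of_abs_le (hle n)])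
  exact ⟨k, _, mu, hk, Int.toNat_of_nonneg hl, hmu⟩

theorem PointParams.isHigmanParams [Finite V] {n : ℕ}
    (hd : Module.finrank (ZMod 3) V = 2 * (n + 1) + 1) (hQ : Q.polarBilin.Nondegenerate)
    (hε : IsPointNorm Q ξ ε)
    (hT : HasDiscrepancy Q (ξ * quadraticChar (ZMod 3) ε * 3 ^ (n + 2))) {k l mu : ℕ}
    (hP : PointParams n ξ k l mu) :
    IsHigmanParams (nonsingPoints Q ξ) (Delta Q ξ) (Gamma Q ξ) k l mu mu := by
  have hDelta (x) (hx : x ∈ nonsingPoints Q ξ) : (Delta Q ξ x).ncard = k := by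
    zify
    refine mul_left_cancel₀ (by norm_num : (6 : ℤ) ≠ 0) ?_
    linear_combination two_mul_ncard_Delta hd hQ hε hT hx - 3 * hP.two_mul_k
  have hinter (x) (hx : x ∈ nonsingPoints Q ξ) (y) (hy : y ∈ nonsingPoints Q ξ) (hxy : x ≠ y) :
      (Delta Q ξ x ∩ Delta Q ξ y).ncard = mu := by
    zify
    refine mul_left_cancel₀ (by norm_num : (6 : ℤ) ≠ 0) ?_
    linear_combination
      two_mul_ncard_Delta_inter_Delta hd hQ hε hT hx hy hxy - 3 * hP.two_mul_mu
  refine ⟨hDelta, fun x hx => ?_, fun x hx y hy => hinter x hx y hy.1 ?_,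
    fun x hx y hy => hinter x hx y hy.1 hy.2.1.symm⟩
  · have hpart := ncard_eq_add_one subset_rfl hx
    rw [Set.inter_eq_right.2 fun _ hy => hy.1, Set.inter_eq_right.2 fun _ hy => hy.1,
      hDelta x hx] at hpart
    have hξ : (ξ : ℤ) * ξ = 1 := by rw [← Units.val_mul, Int.units_mul_self, Units.val_one]
    zify at hpart ⊢
    refine mul_left_cancel₀ (two_ne_zero (α := ℤ)) ?_
    linear_combination two_mul_ncard_nonsingPoints hd hε hT - 2 * hpart - hP.two_mul_k -
      2 * hP.l_eq + 2 * hξ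
  · rintro rfl
    exact notMem_Delta_self hx hy

end TernaryPoints

/-! ### Reflections and transitivity -/

section Reflections

open scoped commutatorElement

variable {F V : Type*} [Field F] [AddCommGroup V] [Module F V] {Q : QuadraticForm F V}

/-- The orthogonal reflection in a nonsingular vector `v`. -/
def orthRefl (Q : QuadraticForm F V) {v : V} (hv : Q v ≠ 0) : V ≃ₗ[F] V :=
  Module.reflection (x := v) (f := (Q v)⁻¹ • Q.polarBilin v) (by
    change (Q v)⁻¹ * QuadraticMap.polar Q v v = 2
    rw [polar_self_eq_two_mul]
    field_simp)

lemma orthRefl_apply {v : V} (hv : Q v ≠ 0) (w : V) :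
    orthRefl Q hv w = w - ((Q v)⁻¹ * QuadraticMap.polar Q v w) • v := rfl

lemma orthRefl_mem {v : V} (hv : Q v ≠ 0) : orthRefl Q hv ∈ isometryGroup Q := by
  intro w
  rw [orthRefl_apply, sub_eq_add_neg, QuadraticMap.map_add Q, QuadraticMap.map_neg,
    QuadraticMap.map_smul, QuadraticMap.polar_neg_right, QuadraticMap.polar_smul_right,
    QuadraticMap.polar_comm Q w v]
  simp only [smul_eq_mul]
  field_simp
  ring

lemma orthRefl_mul_self {v : V} (hv : Q v ≠ 0) : orthRefl Q hv * orthRefl Q hv = 1 :=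
  LinearEquiv.ext fun w => Module.involutive_reflection _ w

lemma orthRefl_of_polar_eq_zero {v : V} (hv : Q v ≠ 0) {w : V}
    (h : QuadraticMap.polar Q v w = 0) : orthRefl Q hv w = w := by
  rw [orthRefl_apply, h, mul_zero, zero_smul, sub_zero]

lemma orthRefl_self {v : V} (hv : Q v ≠ 0) : orthRefl Q hv v = -v := by
  rw [orthRefl_apply, polar_self_eq_two_mul, mul_comm 2, inv_mul_cancel_left₀ hv, two_smul]
  abel

lemma polar_map {g : V ≃ₗ[F] V} (hg : g ∈ isometryGroup Q) (v w : V) :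
    QuadraticMap.polar Q (g v) (g w) = QuadraticMap.polar Q v w := by
  rw [QuadraticMap.polar, ← map_add, hg, hg, hg, QuadraticMap.polar]

lemma orthRefl_conj {g : V ≃ₗ[F] V} (hg : g ∈ isometryGroup Q) {v w : V} (hv : Q v ≠ 0)
    (hw : Q w ≠ 0) (h : g v = w ∨ g v = -w) : g * orthRefl Q hv = orthRefl Q hw * g := by
  ext u
  change g (orthRefl Q hv u) = orthRefl Q hw (g u)
  rw [orthRefl_apply, orthRefl_apply, map_sub, map_smul, ← polar_map hg, ← hg v]
  rcases h with h | h
  · rw [h]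
  · rw [h, QuadraticMap.map_neg, QuadraticMap.polar_neg_left]
    module

lemma orthRefl_sub_apply {x y : V} (hxy : Q x = Q y) (hv : Q (x - y) ≠ 0) :
    orthRefl Q hv x = y := by
  have hnorm : Q (x - y) = QuadraticMap.polar Q (x - y) x := by
    rw [sub_eq_add_neg, QuadraticMap.map_add Q, QuadraticMap.polar_add_left, polar_self_eq_two_mul,
      QuadraticMap.map_neg, QuadraticMap.polar_neg_right, QuadraticMap.polar_neg_left,
      QuadraticMap.polar_comm Q y, hxy]
    ring
  rw [orthRefl_apply, ← hnorm, inv_mul_cancel₀ hv, one_smul, sub_sub_cancel]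

lemma orthRefl_add_apply {x y : V} (hxy : Q x = Q y) (hv : Q (x + y) ≠ 0) :
    orthRefl Q hv x = -y := by
  have hnorm : Q (x + y) = QuadraticMap.polar Q (x + y) x := by
    rw [QuadraticMap.map_add Q, QuadraticMap.polar_add_left, polar_self_eq_two_mul,
      QuadraticMap.polar_comm Q y, hxy]
    ring
  rw [orthRefl_apply, ← hnorm, inv_mul_cancel₀ hv, one_smul, sub_add_cancel_left]

lemma exists_orthRefl (h2 : (2 : F) ≠ 0) {x y : V} (hxy : Q x = Q y) (hx : Q x ≠ 0) :
    ∃ v ∈ Submodule.span F {x, y}, ∃ hv : Q v ≠ 0,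
      orthRefl Q hv x = y ∨ orthRefl Q hv x = -y := by
  have hx_mem : x ∈ Submodule.span F {x, y} := Submodule.subset_span (Set.mem_insert x {y})
  have hy_mem : y ∈ Submodule.span F {x, y} := Submodule.subset_span (Set.mem_insert_of_mem x rfl)
  by_cases hsub : Q (x - y) = 0
  · have hadd : Q (x + y) ≠ 0 := by
      have hparallelogram : Q (x + y) + Q (x - y) = 2 * (2 * Q x) := by
        rw [sub_eq_add_neg, QuadraticMap.map_add Q, QuadraticMap.map_add Q, QuadraticMap.map_neg,
          QuadraticMap.polar_neg_right, hxy]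
        ring
      rw [hsub, add_zero] at hparallelogram
      exact hparallelogram ▸ mul_ne_zero h2 (mul_ne_zero h2 hx)
    exact ⟨x + y, add_mem hx_mem hy_mem, hadd, Or.inr (orthRefl_add_apply hxy hadd)⟩
  · exact ⟨x - y, sub_mem hx_mem hy_mem, hsub, Or.inl (orthRefl_sub_apply hxy hsub)⟩

lemma polar_eq_zero_of_mem_span {s : Set V} {v z : V} (hv : v ∈ Submodule.span F s)
    (hz : ∀ w ∈ s, QuadraticMap.polar Q w z = 0) : QuadraticMap.polar Q v z = 0 := by
  induction hv using Submodule.span_induction with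
  | mem w hw => exact hz w hw
  | zero => exact QuadraticMap.polar_zero_left Q z
  | add u w _ _ hu hw => rw [QuadraticMap.polar_add_left, hu, hw, add_zero]
  | smul a w _ hw => rw [QuadraticMap.polar_smul_left, hw, smul_zero]

lemma orthRefl_mul_mem_Omega (h2 : (2 : F) ≠ 0) {v w : V} (hv : Q v ≠ 0) (hw : Q w ≠ 0)
    (hvw : Q v = Q w) : orthRefl Q hv * orthRefl Q hw ∈ Omega Q := by
  obtain ⟨u, -, hu, h⟩ := exists_orthRefl h2 hvw hv
  have hconj := orthRefl_conj (orthRefl_mem hu) hv hw h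
  have hinv : (orthRefl Q hv)⁻¹ = orthRefl Q hv := inv_eq_of_mul_eq_one_left (orthRefl_mul_self hv)
  have : orthRefl Q hv * orthRefl Q hw = ⁅orthRefl Q hv, orthRefl Q hu⁆ := by
    rw [commutatorElement_def, hinv, mul_assoc (orthRefl Q hv), hconj]
    group
  rw [this]
  exact Subgroup.commutator_mem_commutator (orthRefl_mem hv) (orthRefl_mem hu)

lemma mul_self_mul_mem_Omega {g h : V ≃ₗ[F] V} (hg : g ∈ isometryGroup Q)
    (hh : h ∈ isometryGroup Q) (hg_sq : g * g ∈ Omega Q) (hh_sq : h * h ∈ Omega Q) :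
    (g * h) * (g * h) ∈ Omega Q := by
  have : (g * h) * (g * h) = (g * g) * ⁅g⁻¹, h⁆ * (h * h) := by
    rw [commutatorElement_def]; group
  rw [this]
  exact mul_mem (mul_mem hg_sq (Subgroup.commutator_mem_commutator (inv_mem hg) hh)) hh_sq

/-- The group generated by the orthogonal reflections. -/
def reflectionGroup (Q : QuadraticForm F V) : Subgroup (V ≃ₗ[F] V) :=
  Subgroup.closure {g | ∃ v, ∃ hv : Q v ≠ 0, g = orthRefl Q hv}

lemma orthRefl_mem_reflectionGroup {v : V} (hv : Q v ≠ 0) : orthRefl Q hv ∈ reflectionGroup Q :=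
  Subgroup.subset_closure ⟨v, hv, rfl⟩

lemma reflectionGroup_le_isometryGroup : reflectionGroup Q ≤ isometryGroup Q := by
  rw [reflectionGroup, Subgroup.closure_le]
  rintro _ ⟨v, hv, rfl⟩
  exact orthRefl_mem hv

lemma exists_mem_reflectionGroup (h2 : (2 : F) ≠ 0) {x y : V} (hxy : Q x = Q y) (hx : Q x ≠ 0) :
    ∃ r ∈ reflectionGroup Q, r x = y ∧
      ∀ z, QuadraticMap.polar Q x z = 0 → QuadraticMap.polar Q y z = 0 → r z = z := by
  obtain ⟨v, hv_span, hv, h⟩ := exists_orthRefl h2 hxy hx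
  have hy : Q y ≠ 0 := hxy ▸ hx
  have hfix (z) (hxz : QuadraticMap.polar Q x z = 0) (hyz : QuadraticMap.polar Q y z = 0) :
      orthRefl Q hv z = z := by
    refine orthRefl_of_polar_eq_zero hv (polar_eq_zero_of_mem_span hv_span ?_)
    rintro w (rfl | rfl)
    exacts [hxz, hyz]
  rcases h with h | h
  · exact ⟨_, orthRefl_mem_reflectionGroup hv, h, hfix⟩
  · refine ⟨_, mul_mem (orthRefl_mem_reflectionGroup hy) (orthRefl_mem_reflectionGroup hv),
      ?_, fun z hxz hyz => ?_⟩
    · rw [LinearEquiv.mul_apply, h, map_neg, orthRefl_self, neg_neg]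
    · rw [LinearEquiv.mul_apply, hfix z hxz hyz, orthRefl_of_polar_eq_zero hy hyz]

lemma mem_reflectionGroup_of_fixes {ι : Type*} (h2 : (2 : F) ≠ 0) (b : Module.Basis ι F V)
    (hb : Pairwise fun i j => QuadraticMap.polar Q (b i) (b j) = 0) (hb0 : ∀ i, Q (b i) ≠ 0)
    (s : Finset ι) {g : V ≃ₗ[F] V} (hg : g ∈ isometryGroup Q)
    (hfix : ∀ i ∉ s, g (b i) = b i) : g ∈ reflectionGroup Q := by
  classical
  induction s using Finset.induction_on generalizing g with
  | empty =>
    have : g = 1 :=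
      LinearEquiv.toLinearMap_injective (b.ext fun i => hfix i (Finset.notMem_empty i))
    exact this ▸ one_mem _
  | insert i s _ ih =>
    obtain ⟨r, hr, hri, hrz⟩ := exists_mem_reflectionGroup h2 (hg (b i))
      ((hg (b i)).symm ▸ hb0 i)
    have hrg : r * g ∈ reflectionGroup Q := by
      refine ih (mul_mem (reflectionGroup_le_isometryGroup hr) hg) fun j hj => ?_
      by_cases hji : j = i
      · rw [hji, LinearEquiv.mul_apply, hri]
      · have hgj := hfix j (by simp [hj, hji])
        have horth := hb (Ne.symm hji)
        rw [LinearEquiv.mul_apply, hgj, hrz (b j) _ horth]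
        rw [← hgj, polar_map hg, horth]
    simpa using mul_mem (inv_mem hr) hrg

theorem reflectionGroup_eq_isometryGroup [FiniteDimensional F V] (h2 : (2 : F) ≠ 0)
    (hQ : Q.polarBilin.Nondegenerate) : reflectionGroup Q = isometryGroup Q := by
  refine le_antisymm reflectionGroup_le_isometryGroup fun g hg => ?_
  have := invertibleOfNonzero h2
  obtain ⟨b, hb⟩ := LinearMap.BilinForm.exists_orthogonal_basis
    (B := Q.polarBilin) ⟨fun v w => QuadraticMap.polar_comm Q v w⟩
  refine mem_reflectionGroup_of_fixes h2 b (fun i j hij => hb hij) (fun i hi => ?_)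
    Finset.univ hg fun i hi => absurd (Finset.mem_univ i) hi
  refine hb.not_isOrtho_basis_self_of_separatingLeft hQ.1 i ?_
  change QuadraticMap.polar Q (b i) (b i) = 0
  rw [polar_self_eq_two_mul, hi, mul_zero]

theorem mul_self_mem_Omega [FiniteDimensional F V] (h2 : (2 : F) ≠ 0)
    (hQ : Q.polarBilin.Nondegenerate) {g : V ≃ₗ[F] V} (hg : g ∈ isometryGroup Q) :
    g * g ∈ Omega Q := by
  rw [← reflectionGroup_eq_isometryGroup h2 hQ] at hg
  induction hg using Subgroup.closure_induction with
  | mem g hg =>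
    obtain ⟨v, hv, rfl⟩ := hg
    exact orthRefl_mul_self hv ▸ one_mem _
  | one => exact one_mem _
  | mul g h hg hh hg_sq hh_sq =>
    exact mul_self_mul_mem_Omega (reflectionGroup_le_isometryGroup hg)
      (reflectionGroup_le_isometryGroup hh) hg_sq hh_sq
  | inv g _ hg_sq => simpa only [mul_inv_rev] using inv_mem hg_sq

lemma HasDiscrepancy.valueCount_pos [Fintype F] [DecidableEq F] {T : ℤ} (h : HasDiscrepancy Q T)
    (hd : 2 ≤ Module.finrank F V) {c : F} (hc : c ≠ 0) : 0 < valueCount Q c := by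
  by_contra! hzero
  have hcount := h.card_mul c
  rw [Nat.le_zero.1 hzero, Nat.cast_zero, mul_zero, eq_comm, add_eq_zero_iff_eq_neg] at hcount
  have hker : discrepancyKernel F (Module.finrank F V) c ^ 2 = 1 := by
    rw [discrepancyKernel, centeredDelta]
    split_ifs
    · norm_num
    · exact quadraticChar_sq_one hc
  have hpow : (Fintype.card F : ℤ) ^ (Module.finrank F V * 2) =
      (Fintype.card F : ℤ) ^ (2 * ((Module.finrank F V + 1) / 2)) := by
    rw [pow_mul, hcount, neg_sq, mul_pow, hker, mul_one, h.sq_eq]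
  have hq : 1 < Fintype.card F := Fintype.one_lt_card
  have := pow_right_injective₀ (by lia) (by lia) hpow
  lia

lemma exists_norm_eq [Finite F] [Finite V] (hF : ringChar F ≠ 2)
    (hQ : Q.polarBilin.Nondegenerate) (hd : 2 ≤ Module.finrank F V) {c : F} (hc : c ≠ 0) :
    ∃ v, Q v = c := by
  classical
  have := Fintype.ofFinite F
  obtain ⟨T, hT⟩ := exists_hasDiscrepancy hF hQ
  obtain ⟨⟨⟨v, hv⟩⟩, -⟩ := Nat.card_pos_iff.1 (hT.valueCount_pos hd hc)
  exact ⟨v, hv⟩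

theorem exists_mem_Omega [Finite F] [Finite V] (hF : ringChar F ≠ 2)
    (hQ : Q.polarBilin.Nondegenerate) (hd : 3 ≤ Module.finrank F V) {x y : V} (hxy : Q x = Q y)
    (hx : Q x ≠ 0) : ∃ g ∈ Omega Q, g x = y ∨ g x = -y := by
  have h2 := Ring.two_ne_zero hF
  obtain ⟨v, -, hv, h⟩ := exists_orthRefl h2 hxy hx
  have hfr := finrank_vperp h2 hx
  -- A reflection fixing `x` whose vector has the same norm as `v` corrects the spinor norm.
  obtain ⟨⟨w, hxw⟩, hwv : Q w = Q v⟩ :=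
    exists_norm_eq hF (nondegenerate_restrict_vperp h2 hQ hx) (by lia) hv
  have hw : Q w ≠ 0 := hwv ▸ hv
  refine ⟨_, orthRefl_mul_mem_Omega h2 hv hw hwv.symm, ?_⟩
  rwa [LinearEquiv.mul_apply,
    orthRefl_of_polar_eq_zero hw ((QuadraticMap.polar_comm Q w x).trans hxw)]

end Reflections

/-! ### Isometries over the extension field and the orbits of `M` -/

section Trace

variable {F K V : Type*} [Field F] [Field K] [Algebra F K] [AddCommGroup V] [Module F V]
  [Module K V] {Q : QuadraticForm F V} {Qs : QuadraticForm K V}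

lemma polar_eq_trace (hQs : ∀ v, Q v = Algebra.trace F K (Qs v)) (v w : V) :
    QuadraticMap.polar Q v w = Algebra.trace F K (QuadraticMap.polar Qs v w) := by
  simp only [QuadraticMap.polar, hQs, map_sub]

lemma nondegenerate_of_trace (hQs : ∀ v, Q v = Algebra.trace F K (Qs v))
    (hQ : Q.polarBilin.Nondegenerate) : Qs.polarBilin.Nondegenerate := by
  refine polarBilin_nondegenerate_iff.2 fun x hx => hQ.1 x fun y => ?_
  rw [QuadraticMap.polarBilin_apply_apply, polar_eq_trace hQs, hx, map_zero]

lemma eq_of_trace_mul_self_mul_eq [FiniteDimensional F K] [Algebra.IsSeparable F K]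
    (h2 : (2 : K) ≠ 0) {c d : K}
    (h : ∀ a : K, Algebra.trace F K (a * a * c) = Algebra.trace F K (a * a * d)) : c = d := by
  refine sub_eq_zero.1 ((traceForm_nondegenerate F K).1 _ fun b => ?_)
  have hsquares : (c - d) * b =
      ((b + 1) / 2 * ((b + 1) / 2) * c - (b + 1) / 2 * ((b + 1) / 2) * d) -
        ((b - 1) / 2 * ((b - 1) / 2) * c - (b - 1) / 2 * ((b - 1) / 2) * d) := by
    field_simp
    ring
  rw [Algebra.traceForm_apply, hsquares]
  simp only [map_sub, h, sub_self]

lemma exists_linearEquiv_of_isometry [FiniteDimensional F V] (hQ : Q.polarBilin.Nondegenerate)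
    (f : V →ₗ[F] V) (hf : ∀ v, Q (f v) = Q v) : ∃ g ∈ isometryGroup Q, ∀ v, g v = f v := by
  have hinj : Function.Injective f := by
    rw [← LinearMap.ker_eq_bot, LinearMap.ker_eq_bot']
    refine fun v hv => hQ.1 v fun w => ?_
    rw [QuadraticMap.polarBilin_apply_apply, QuadraticMap.polar, ← hf (v + w), map_add, hv,
      zero_add, hf, ← hf v, hv, QuadraticMap.map_zero, sub_zero, sub_self]
  exact ⟨LinearEquiv.ofInjectiveEndo f hinj, hf, fun _ => rfl⟩

/-- Restriction of scalars as a homomorphism of general linear groups. -/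
def restrictScalarsHom (F K V : Type*) [Field F] [Field K] [Algebra F K] [AddCommGroup V]
    [Module F V] [Module K V] [IsScalarTower F K V] : (V ≃ₗ[K] V) →* (V ≃ₗ[F] V) where
  toFun g := g.restrictScalars F
  map_one' := rfl
  map_mul' _ _ := rfl

lemma restrictScalarsHom_apply [IsScalarTower F K V] (g : V ≃ₗ[K] V) (v : V) :
    restrictScalarsHom F K V g v = g v := rfl

lemma restrictScalarsHom_mem_Omega [IsScalarTower F K V]
    (hQs : ∀ v, Q v = Algebra.trace F K (Qs v)) {g : V ≃ₗ[K] V} (hg : g ∈ Omega Qs) :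
    restrictScalarsHom F K V g ∈ Omega Q := by
  have hle : (isometryGroup Qs).map (restrictScalarsHom F K V) ≤ isometryGroup Q := by
    rintro _ ⟨g, hg, rfl⟩ v
    rw [hQs, hQs, restrictScalarsHom_apply, hg v]
  have hcomm := Subgroup.commutator_mono hle hle
  rw [← Subgroup.map_commutator] at hcomm
  exact hcomm (Subgroup.mem_map_of_mem _ hg)

end Trace

section Frobenius

lemma exists_frobenius_semilinear {K V : Type*} [Field K] [CharP K 3] [AddCommGroup V]
    [Module K V] [FiniteDimensional K V] (Qs : QuadraticForm K V) :
    ∃ f : V →ₛₗ[frobenius K 3] V, ∀ v, Qs (f v) = Qs v ^ 3 := by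
  have h2 : (2 : K) ≠ 0 := Ring.two_ne_zero (by rw [ringChar.eq K 3]; norm_num)
  have := invertibleOfNonzero h2
  -- On `∑ wᵢ xᵢ²` the map `x ↦ (wᵢ xᵢ³)ᵢ` has the required effect, as `wᵢ (wᵢ xᵢ³)² = (wᵢ xᵢ²)³`.
  obtain ⟨w, ⟨e⟩⟩ := Qs.equivalent_weightedSumSquares
  refine ⟨⟨⟨fun v => e.symm fun i => w i * e v i ^ 3, fun v v' => ?_⟩, fun a v => ?_⟩,
    fun v => ?_⟩
  · rw [← map_add]
    refine congrArg e.symm (funext fun i => ?_)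
    simp only [map_add, Pi.add_apply, add_pow_char, mul_add]
  · refine Eq.trans (congrArg e.symm (funext fun i => ?_)) (e.symm.toLinearEquiv.map_smul _ _)
    simp only [map_smul, Pi.smul_apply, smul_eq_mul, frobenius_def]
    ring
  · change Qs (e.symm fun i => w i * e v i ^ 3) = Qs v ^ 3
    rw [e.symm.map_app, ← e.map_app v, QuadraticMap.weightedSumSquares_apply,
      QuadraticMap.weightedSumSquares_apply, ← frobenius_def, map_sum]
    refine Finset.sum_congr rfl fun i _ => ?_
    rw [frobenius_def, smul_eq_mul, smul_eq_mul]
    ring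

lemma charP_three (K : Type*) [Field K] [Algebra (ZMod 3) K] : CharP K 3 :=
  charP_of_injective_algebraMap (algebraMap (ZMod 3) K).injective 3

lemma ringChar_ne_two_of_algebra (K : Type*) [Field K] [Algebra (ZMod 3) K] : ringChar K ≠ 2 := by
  have := charP_three K
  rw [ringChar.eq K 3]; norm_num

lemma three_eq_zero_of_algebra (K : Type*) [Field K] [Algebra (ZMod 3) K] : (3 : K) = 0 := by
  have := charP_three K
  exact_mod_cast CharP.cast_eq_zero K 3

lemma trace_ringEquiv {n : ℕ} {K : Type*} [Field K] [Algebra (ZMod n) K] (σ : K ≃+* K) (a : K) :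
    Algebra.trace (ZMod n) K (σ a) = Algebra.trace (ZMod n) K a :=
  Algebra.trace_eq_of_algEquiv (AlgEquiv.ofRingEquiv (f := σ) fun r =>
    RingHom.congr_fun (Subsingleton.elim ((σ : K →+* K).comp (algebraMap (ZMod n) K))
      (algebraMap (ZMod n) K)) r) a

variable {K V : Type*} [Field K] [Finite K] [Algebra (ZMod 3) K]
  [AddCommGroup V] [Module (ZMod 3) V] [Module K V]

lemma trace_cube (a : K) : Algebra.trace (ZMod 3) K (a ^ 3) = Algebra.trace (ZMod 3) K a :=
  have := charP_three K
  trace_ringEquiv (frobeniusEquiv K 3) a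

variable {Q : QuadraticForm (ZMod 3) V} {Qs : QuadraticForm K V}

lemma norm_semilinear (hQs : ∀ v, Q v = Algebra.trace (ZMod 3) K (Qs v)) {g : V ≃ₗ[ZMod 3] V}
    (hg : g ∈ isometryGroup Q) {σ : K ≃+* K} (hσ : ∀ (a : K) (v : V), g (a • v) = σ a • g v)
    (v : V) : Qs (g v) = σ (Qs v) := by
  rw [← RingEquiv.symm_apply_eq]
  refine eq_of_trace_mul_self_mul_eq (F := ZMod 3)
    (Ring.two_ne_zero (ringChar_ne_two_of_algebra K)) fun a => ?_
  have hnorm := hg (a • v)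
  rwa [hσ, hQs, hQs, QuadraticMap.map_smul, QuadraticMap.map_smul, smul_eq_mul, smul_eq_mul,
    ← trace_ringEquiv σ.symm, map_mul σ.symm, map_mul σ.symm,
    RingEquiv.symm_apply_apply] at hnorm

variable [Finite V]

lemma exists_frobenius_isometry (hQs : ∀ v, Q v = Algebra.trace (ZMod 3) K (Qs v))
    (hQ : Q.polarBilin.Nondegenerate) :
    ∃ h ∈ isometryGroup Q, (∀ (a : K) (v : V), h (a • v) = a ^ 3 • h v) ∧
      ∀ v, Qs (h v) = Qs v ^ 3 := by
  have := charP_three K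
  obtain ⟨f, hf⟩ := exists_frobenius_semilinear Qs
  obtain ⟨h, hh, hhf⟩ := exists_linearEquiv_of_isometry hQ (f.toAddMonoidHom.toZModLinearMap 3)
    fun v => by rw [hQs, hQs, ← trace_cube (Qs v), ← hf]; rfl
  exact ⟨h, hh, fun a v => by rw [hhf, hhf]; exact f.map_smulₛₗ a v,
    fun v => by rw [hhf]; exact hf v⟩

lemma exists_frobenius_mem_Omega (hQs : ∀ v, Q v = Algebra.trace (ZMod 3) K (Qs v))
    (hQ : Q.polarBilin.Nondegenerate) (hK : ∀ a : K, a ^ 27 = a) :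
    ∃ h ∈ Omega Q, (∀ (a : K) (v : V), h (a • v) = a ^ 3 • h v) ∧ ∀ v, Qs (h v) = Qs v ^ 3 := by
  obtain ⟨h, hh, hsmul, hnorm⟩ := exists_frobenius_isometry hQs hQ
  have hpow (a : K) : (((a ^ 3) ^ 3) ^ 3) ^ 3 = a ^ 3 := by
    rw [show (((a ^ 3) ^ 3) ^ 3) ^ 3 = (a ^ 27) ^ 3 by ring, hK]
  -- The Frobenius automorphism has order `3`, so the fourth power of `h` acts like `h` on norms.
  exact ⟨(h * h) * (h * h), mul_self_mem_Omega two_ne_zero_zmod_three hQ (mul_mem hh hh),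
    fun a v => by simp only [LinearEquiv.mul_apply, hsmul, hpow],
    fun v => by simp only [LinearEquiv.mul_apply, hnorm, hpow]⟩

end Frobenius

section Orbits

variable {K V : Type*} [Field K] [AddCommGroup V] [Module (ZMod 3) V] [Module K V]
  {G : Subgroup (V ≃ₗ[ZMod 3] V)}

lemma eq_mk_iff {x : ℙ (ZMod 3) V} {v : V} (hv : v ≠ 0) :
    x = Projectivization.mk (ZMod 3) v hv ↔ x.rep = v ∨ x.rep = -v := by
  rw [← mk_eq_mk_iff_eq_or_eq_neg x.rep_nonzero hv, Projectivization.mk_rep]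

lemma smul_eq_mk (g : fieldExtSubgroup K G) (x : ℙ (ZMod 3) V) :
    g • x = Projectivization.mk (ZMod 3) (g.1.1 x.rep)
      (g.1.1.map_ne_zero_iff.2 x.rep_nonzero) := by
  conv_lhs => rw [← x.mk_rep]
  rfl

lemma mem_orbit_of_semilinear {g : V ≃ₗ[ZMod 3] V} (hg : g ∈ G) {σ : K ≃+* K}
    (hσ : ∀ (a : K) (v : V), g (a • v) = σ a • g v) {x y : ℙ (ZMod 3) V}
    (h : g x.rep = y.rep ∨ g x.rep = -y.rep) :
    y ∈ MulAction.orbit (fieldExtSubgroup K G) x := by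
  refine ⟨⟨⟨g, hg⟩, σ, hσ⟩, (smul_eq_mk _ x).trans (Eq.symm ((eq_mk_iff _).2 ?_))⟩
  exact h.imp Eq.symm fun h => (neg_eq_iff_eq_neg.2 h).symm

variable [Finite K] [Algebra (ZMod 3) K] {Q : QuadraticForm (ZMod 3) V} {Qs : QuadraticForm K V}

lemma exists_norm_eq_of_mem_orbit (hQs : ∀ v, Q v = Algebra.trace (ZMod 3) K (Qs v))
    (hGI : G ≤ isometryGroup Q) {x y : ℙ (ZMod 3) V}
    (h : y ∈ MulAction.orbit (fieldExtSubgroup K G) x) :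
    ∃ σ : K ≃+* K, Qs y.rep = σ (Qs x.rep) := by
  obtain ⟨g, rfl⟩ := h
  obtain ⟨σ, hσ⟩ := g.2
  refine ⟨σ, (norm_semilinear hQs (hGI g.1.2) hσ x.rep).symm ▸ ?_⟩
  rcases (eq_mk_iff _).1 (smul_eq_mk g x) with h | h
  · exact congrArg Qs h
  · exact (congrArg Qs h).trans (QuadraticMap.map_neg Qs _)

variable [Finite V] [IsScalarTower (ZMod 3) K V]

lemma mem_orbit_of_norm_eq (hQs : ∀ v, Q v = Algebra.trace (ZMod 3) K (Qs v))
    (hQ : Q.polarBilin.Nondegenerate) (hΩG : Omega Q ≤ G) (hd : 3 ≤ Module.finrank K V)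
    {x y : ℙ (ZMod 3) V} (hxy : Qs x.rep = Qs y.rep) (hx : Qs x.rep ≠ 0) :
    y ∈ MulAction.orbit (fieldExtSubgroup K G) x := by
  obtain ⟨g, hg, h⟩ := exists_mem_Omega (ringChar_ne_two_of_algebra K)
    (nondegenerate_of_trace hQs hQ) hd hxy hx
  exact mem_orbit_of_semilinear (g := restrictScalarsHom (ZMod 3) K V g) (σ := RingEquiv.refl K)
    (hΩG (restrictScalarsHom_mem_Omega hQs hg)) (fun a v => map_smul g a v) h

lemma mem_orbit_of_norm_eq_cube (hQs : ∀ v, Q v = Algebra.trace (ZMod 3) K (Qs v))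
    (hQ : Q.polarBilin.Nondegenerate) (hΩG : Omega Q ≤ G) (hd : 3 ≤ Module.finrank K V)
    (hK : ∀ a : K, a ^ 27 = a) {x y : ℙ (ZMod 3) V} (hxy : Qs x.rep ^ 3 = Qs y.rep)
    (hx : Qs x.rep ≠ 0) : y ∈ MulAction.orbit (fieldExtSubgroup K G) x := by
  have := charP_three K
  obtain ⟨h, hh, hsmul, hnorm⟩ := exists_frobenius_mem_Omega hQs hQ hK
  obtain ⟨g, hg, hgy⟩ := exists_mem_Omega (ringChar_ne_two_of_algebra K)
    (nondegenerate_of_trace hQs hQ) hd (x := h x.rep) (y := y.rep) ((hnorm _).trans hxy)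
    ((hnorm _).symm ▸ pow_ne_zero 3 hx)
  refine mem_orbit_of_semilinear (g := restrictScalarsHom (ZMod 3) K V g * h)
    (σ := frobeniusEquiv K 3) (hΩG (mul_mem (restrictScalarsHom_mem_Omega hQs hg) hh))
    (fun a v => ?_) hgy
  rw [LinearEquiv.mul_apply, hsmul, restrictScalarsHom_apply, map_smul]
  rfl

end Orbits

section TraceCounts

lemma card_mem_and_eq_sum {V X : Type*} [Finite V] (f : V → X) (p : V → Prop) (C : Finset X) :
    Nat.card {y : V // f y ∈ C ∧ p y} = ∑ c ∈ C, Nat.card {y : V // f y = c ∧ p y} := by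
  classical
  have := Fintype.ofFinite V
  simp only [Nat.card_eq_fintype_card, Fintype.card_subtype]
  rw [Finset.card_eq_sum_card_fiberwise (f := f) (t := C) fun y hy => (Finset.mem_filter.1 hy).2.1]
  refine Finset.sum_congr rfl fun c hc => congrArg _ ?_
  ext y
  simp only [Finset.mem_filter, Finset.mem_univ, true_and]
  constructor
  · rintro ⟨⟨-, hp⟩, hy⟩
    exact ⟨hy, hp⟩
  · rintro ⟨rfl, hp⟩
    exact ⟨⟨hc, hp⟩, rfl⟩

lemma card_mem_eq_sum {V X : Type*} [Finite V] (f : V → X) (C : Finset X) :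
    Nat.card {y : V // f y ∈ C} = ∑ c ∈ C, Nat.card {y : V // f y = c} := by
  simpa only [and_true] using card_mem_and_eq_sum f (fun _ => True) C

variable {K V : Type*} [Field K] [Fintype K]

lemma card_mul_card_trace_mul_eq {F : Type*} [Field F] [Finite F] [Algebra F K] {a : K}
    (ha : a ≠ 0) (t : F) :
    Nat.card F * Nat.card {b : K // Algebra.trace F K (a * b) = t} = Fintype.card K := by
  have hf : Algebra.traceForm F K a ≠ 0 := fun h =>
    ha ((traceForm_nondegenerate F K).1 a fun b => LinearMap.congr_fun h b)
  exact (card_mul_card_fibre hf t).trans Nat.card_eq_fintype_card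

variable [DecidableEq K] [AddCommGroup V] [Module K V] [Finite V] {Qs : QuadraticForm K V}

lemma HasDiscrepancy.card_norm_eq_and_trace_polar_eq_zero {F : Type*} [Field F] [Finite F]
    [Algebra F K] (hF : ringChar K ≠ 2) {x : V} (hx : Qs x ≠ 0) {T : ℤ}
    (hd : Even (Module.finrank K (vperp Qs x)))
    (hT : HasDiscrepancy (Qs.restrict (vperp Qs x)) T) (c : K) :
    Nat.card F * Nat.card {y : V // Qs y = c ∧
        Algebra.trace F K (QuadraticMap.polar Qs x y) = 0} =
      (Fintype.card K : ℤ) ^ Module.finrank K (vperp Qs x) - T + Nat.card F * T *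
        Nat.card {b : K // b * b * Qs x = c ∧ Algebra.trace F K (Qs x * b) = 0} := by
  classical
  have h2 := Ring.two_ne_zero hF
  have h2F : (2 : F) ≠ 0 := fun h => h2 (by rw [← map_ofNat (algebraMap F K), h, map_zero])
  have htrace (b : K) : Algebra.trace F K (2 * b * Qs x) = 0 ↔
      Algebra.trace F K (Qs x * b) = 0 := by
    rw [show 2 * b * Qs x = (2 : F) • (Qs x * b) by rw [Algebra.smul_def, map_ofNat]; ring,
      map_smul, smul_eq_zero, or_iff_right h2F]
  have hvalue (b : K) : (Fintype.card K : ℤ) *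
      valueCount (Qs.restrict (vperp Qs x)) (c - b * b * Qs x) =
        (Fintype.card K : ℤ) ^ Module.finrank K (vperp Qs x) - T +
          Fintype.card K * T * (if b * b * Qs x = c then 1 else 0) := by
    rw [hT.card_mul, discrepancyKernel, if_pos hd, centeredDelta]
    simp only [sub_eq_zero, eq_comm (a := c)]
    split_ifs <;> ring
  have hB : (Nat.card F : ℤ) * Finset.card {b : K | Algebra.trace F K (Qs x * b) = 0} =
      Fintype.card K := by
    have hcount := card_mul_card_trace_mul_eq hx (0 : F)
    rw [Nat.card_eq_fintype_card (α := Subtype _), Fintype.card_subtype] at hcount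
    exact_mod_cast hcount
  have hsum : (Fintype.card K : ℤ) * Nat.card {y : V // Qs y = c ∧
        Algebra.trace F K (QuadraticMap.polar Qs x y) = 0} =
      Finset.card {b : K | Algebra.trace F K (Qs x * b) = 0} *
        ((Fintype.card K : ℤ) ^ Module.finrank K (vperp Qs x) - T) + Fintype.card K * T *
          Nat.card {b : K // b * b * Qs x = c ∧ Algebra.trace F K (Qs x * b) = 0} := by
    rw [card_eq_and_polar h2 hx c fun z => Algebra.trace F K z = 0, Nat.cast_sum, Finset.mul_sum]
    simp only [htrace, hvalue, Finset.sum_add_distrib, Finset.sum_const, nsmul_eq_mul,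
      ← Finset.mul_sum, Finset.sum_boole, Finset.filter_filter, Nat.card_eq_fintype_card,
      Fintype.card_subtype, and_comm]
  refine mul_left_cancel₀ (Nat.cast_ne_zero.2 Fintype.card_ne_zero : (Fintype.card K : ℤ) ≠ 0) ?_
  linear_combination (Nat.card F : ℤ) * hsum +
    ((Fintype.card K : ℤ) ^ Module.finrank K (vperp Qs x) - T) * hB

lemma HasDiscrepancy.card_norm_mem_and_trace_polar_eq_zero {F : Type*} [Field F] [Finite F]
    [Algebra F K] (hF : ringChar K ≠ 2) {x : V} (hx : Qs x ≠ 0) {T : ℤ}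
    (hd : Even (Module.finrank K (vperp Qs x)))
    (hT : HasDiscrepancy (Qs.restrict (vperp Qs x)) T) (C : Finset K) :
    Nat.card F * Nat.card {y : V // Qs y ∈ C ∧
        Algebra.trace F K (QuadraticMap.polar Qs x y) = 0} =
      C.card * ((Fintype.card K : ℤ) ^ Module.finrank K (vperp Qs x) - T) + Nat.card F * T *
        Nat.card {b : K // b * b * Qs x ∈ C ∧ Algebra.trace F K (Qs x * b) = 0} := by
  rw [card_mem_and_eq_sum, card_mem_and_eq_sum (fun b => b * b * Qs x), Nat.cast_sum,
    Nat.cast_sum, Finset.mul_sum, Finset.mul_sum]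
  simp only [hT.card_norm_eq_and_trace_polar_eq_zero hF hx hd, Finset.sum_add_distrib,
    Finset.sum_const, nsmul_eq_mul]

lemma HasDiscrepancy.card_norm_mem (hF : ringChar K ≠ 2) {x : V} (hx : Qs x ≠ 0) {T : ℤ}
    (hd : Even (Module.finrank K (vperp Qs x)))
    (hT : HasDiscrepancy (Qs.restrict (vperp Qs x)) T) (C : Finset K)
    (hC : ∀ c ∈ C, quadraticChar K c = quadraticChar K (Qs x)) :
    (Nat.card {y : V // Qs y ∈ C} : ℤ) =
      C.card * ((Fintype.card K : ℤ) ^ Module.finrank K (vperp Qs x) + T) := by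
  have hfr := finrank_vperp (Ring.two_ne_zero hF) hx
  have hodd : ¬ Even (Module.finrank K V) := by rwa [← hfr, Nat.even_add_one, not_not]
  have hterm (c) (hc : c ∈ C) : (Nat.card {y : V // Qs y = c} : ℤ) =
      (Fintype.card K : ℤ) ^ Module.finrank K (vperp Qs x) + T := by
    have hcount := (hT.of_even hF hx hd).card_mul c
    rw [valueCount, discrepancyKernel, if_neg hodd, hC c hc, ← hfr] at hcount
    refine mul_left_cancel₀ (Nat.cast_ne_zero.2 Fintype.card_ne_zero : (Fintype.card K : ℤ) ≠ 0) ?_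
    linear_combination hcount + (Fintype.card K * T : ℤ) * quadraticChar_sq_one hx
  rw [card_mem_eq_sum, Nat.cast_sum, Finset.sum_congr rfl hterm, Finset.sum_const, nsmul_eq_mul]

end TraceCounts

/-! ### Extensions of degree three -/

section CubicField

lemma trace_algebraMap_mul {F K : Type*} [CommRing F] [CommRing K] [Algebra F K] (r : F) (a : K) :
    Algebra.trace F K (algebraMap F K r * a) = r * Algebra.trace F K a := by
  rw [← Algebra.smul_def, map_smul, smul_eq_mul]

variable {K : Type*} [Field K] [Algebra (ZMod 3) K]

lemma exists_algebraMap_eq_of_cube_eq {z : K} (hz : z ^ 3 = z) :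
    ∃ r : ZMod 3, algebraMap (ZMod 3) K r = z := by
  have hprod : z * ((z - 1) * (z + 1)) = 0 := by linear_combination hz
  simp only [mul_eq_zero, sub_eq_zero, add_eq_zero_iff_eq_neg] at hprod
  rcases hprod with rfl | rfl | rfl
  · exact ⟨0, map_zero _⟩
  · exact ⟨1, map_one _⟩
  · exact ⟨-1, by rw [map_neg, map_one]⟩

lemma ne_zero_of_trace_ne_zero {a : K} (ha : Algebra.trace (ZMod 3) K a ≠ 0) : a ≠ 0 := by
  rintro rfl
  exact ha (map_zero _)

/-- The characteristic polynomial over `𝔽₃` of the element `a` of the field with 27 elements is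
`X³ - tr(a) X² + b X - c`: its coefficients `b` and `c` are the elementary symmetric functions of
the conjugates `a`, `a³`, `a⁹`. -/
structure HasCharpolyCoeffs (a : K) (b c : ZMod 3) : Prop where
  algebraMap_linear : algebraMap (ZMod 3) K b = a ^ 4 + a ^ 10 + a ^ 12
  algebraMap_norm : algebraMap (ZMod 3) K c = a ^ 13

variable (hK : Module.finrank (ZMod 3) K = 3)

include hK

lemma natCard_cubic : Nat.card K = 27 := by
  have : FiniteDimensional (ZMod 3) K := FiniteDimensional.of_finrank_pos (by lia)
  rw [Module.natCard_eq_pow_finrank (K := ZMod 3), Nat.card_zmod, hK]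
  norm_num

lemma finite_cubic : Finite K := Nat.finite_of_card_ne_zero (by rw [natCard_cubic hK]; norm_num)

lemma card_cubic [Fintype K] : Fintype.card K = 27 := by
  rw [← Nat.card_eq_fintype_card, natCard_cubic hK]

lemma pow_card_cubic (a : K) : a ^ 27 = a := by
  have := finite_cubic hK
  have := Fintype.ofFinite K
  exact card_cubic hK ▸ FiniteField.pow_card a

lemma trace_cubic (a : K) :
    algebraMap (ZMod 3) K (Algebra.trace (ZMod 3) K a) = a + a ^ 3 + a ^ 9 := by
  have := finite_cubic hK
  rw [FiniteField.algebraMap_trace_eq_sum_pow, hK, Nat.card_zmod]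
  simp [Finset.sum_range_succ]

lemma trace_algebraMap_cubic (r : ZMod 3) :
    Algebra.trace (ZMod 3) K (algebraMap (ZMod 3) K r) = 0 := by
  rw [Algebra.trace_algebraMap, hK]
  exact (by decide : ∀ r : ZMod 3, 3 • r = 0) r

lemma exists_hasCharpolyCoeffs (a : K) : ∃ b c, HasCharpolyCoeffs a b c := by
  have := charP_three K
  have ha := pow_card_cubic hK a
  obtain ⟨b, hb⟩ := exists_algebraMap_eq_of_cube_eq (z := a ^ 4 + a ^ 10 + a ^ 12) (by
    rw [add_pow_char, add_pow_char]
    linear_combination (a ^ 3 + a ^ 9) * ha)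
  obtain ⟨c, hc⟩ := exists_algebraMap_eq_of_cube_eq (z := a ^ 13) (by
    linear_combination a ^ 12 * ha)
  exact ⟨b, c, hb, hc⟩

namespace HasCharpolyCoeffs

variable {a : K} {b c : ZMod 3} (h : HasCharpolyCoeffs a b c)

include h

lemma cube_eq : a ^ 3 = algebraMap (ZMod 3) K (Algebra.trace (ZMod 3) K a) * a ^ 2 -
    algebraMap (ZMod 3) K b * a + algebraMap (ZMod 3) K c := by
  rw [trace_cubic hK, h.algebraMap_linear, h.algebraMap_norm]
  ring

lemma eval_ne_zero (ha : Algebra.trace (ZMod 3) K a ≠ 0) (s : ZMod 3) :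
    s ^ 3 - Algebra.trace (ZMod 3) K a * s ^ 2 + b * s - c ≠ 0 := by
  have := charP_three K
  intro hs
  have hs' := congrArg (algebraMap (ZMod 3) K) hs
  simp only [map_add, map_sub, map_mul, map_pow, map_zero, trace_cubic hK, h.algebraMap_linear,
    h.algebraMap_norm] at hs'
  set σ := algebraMap (ZMod 3) K s with hσ
  have hσ3 : σ ^ 3 = σ := by rw [hσ, ← map_pow, ZMod.pow_card]
  have hprod : (σ - a) ^ 13 = 0 := calc
    (σ - a) ^ 13 = (σ - a) * (σ - a) ^ 3 * ((σ - a) ^ 3) ^ 3 := by ring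
    _ = (σ - a) * (σ - a ^ 3) * (σ - (a ^ 3) ^ 3) := by simp only [sub_pow_char, hσ3]
    _ = 0 := by linear_combination hs'
  have hsa : σ = a := sub_eq_zero.1 (eq_zero_of_pow_eq_zero hprod)
  exact ha (hsa ▸ trace_algebraMap_cubic hK s)

lemma trace_sq : Algebra.trace (ZMod 3) K (a ^ 2) = Algebra.trace (ZMod 3) K a ^ 2 + b := by
  apply (algebraMap (ZMod 3) K).injective
  rw [trace_cubic hK, map_add, map_pow, trace_cubic hK, h.algebraMap_linear]
  linear_combination -(a ^ 4 + a ^ 10 + a ^ 12) * three_eq_zero_of_algebra K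

lemma trace_sq_of_trace_ne_zero (ha : Algebra.trace (ZMod 3) K a ≠ 0) :
    Algebra.trace (ZMod 3) K (a ^ 2) = 1 + b := by
  rw [h.trace_sq hK, (by decide : ∀ e : ZMod 3, e ≠ 0 → e ^ 2 = 1) _ ha]

lemma trace_sq_eq_zero_iff (ha : Algebra.trace (ZMod 3) K a ≠ 0) :
    Algebra.trace (ZMod 3) K (a ^ 2) = 0 ↔ b = -1 := by
  rw [h.trace_sq_of_trace_ne_zero hK ha, add_comm, add_eq_zero_iff_eq_neg]

lemma norm_eq (ha : Algebra.trace (ZMod 3) K a ≠ 0) :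
    c = (if b = -1 then 1 else -1) * Algebra.trace (ZMod 3) K a :=
  (by decide : ∀ e b c : ZMod 3, e ≠ 0 → (∀ s, s ^ 3 - e * s ^ 2 + b * s - c ≠ 0) →
    c = (if b = -1 then 1 else -1) * e) _ _ _ ha (h.eval_ne_zero hK ha)

lemma trace_pow_five : Algebra.trace (ZMod 3) K (a ^ 5) =
    ((Algebra.trace (ZMod 3) K a ^ 2 - b) * Algebra.trace (ZMod 3) K a -
      Algebra.trace (ZMod 3) K a * b + c) * (Algebra.trace (ZMod 3) K a ^ 2 + b) +
    (Algebra.trace (ZMod 3) K a * c - (Algebra.trace (ZMod 3) K a ^ 2 - b) * b) *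
      Algebra.trace (ZMod 3) K a := by
  set e := Algebra.trace (ZMod 3) K a with he
  -- The remainder of `X⁵` modulo `X³ - e X² + b X - c`.
  have hpow : a ^ 5 = algebraMap (ZMod 3) K ((e ^ 2 - b) * e - e * b + c) * a ^ 2 +
      algebraMap (ZMod 3) K (e * c - (e ^ 2 - b) * b) * a +
      algebraMap (ZMod 3) K ((e ^ 2 - b) * c) := by
    have hcube := h.cube_eq hK
    simp only [← he, map_add, map_sub, map_mul, map_pow] at hcube ⊢
    linear_combination (a ^ 2 + algebraMap (ZMod 3) K e * a +
      (algebraMap (ZMod 3) K e ^ 2 - algebraMap (ZMod 3) K b)) * hcube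
  rw [hpow, map_add, map_add, trace_algebraMap_mul, trace_algebraMap_mul,
    trace_algebraMap_cubic hK, h.trace_sq hK, ← he, add_zero]

lemma trace_pow_five_eq_zero_iff (ha : Algebra.trace (ZMod 3) K a ≠ 0) :
    Algebra.trace (ZMod 3) K (a ^ 5) = 0 ↔ b = -1 := by
  rw [h.trace_pow_five hK]
  exact (by decide : ∀ e b c : ZMod 3, e ≠ 0 → (∀ s, s ^ 3 - e * s ^ 2 + b * s - c ≠ 0) →
    (((e ^ 2 - b) * e - e * b + c) * (e ^ 2 + b) + (e * c - (e ^ 2 - b) * b) * e = 0 ↔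
      b = -1)) _ _ _ ha (h.eval_ne_zero hK ha)

lemma quadraticChar_eq [Fintype K] [DecidableEq K] (ha : a ≠ 0) :
    quadraticChar K a = quadraticChar (ZMod 3) c := by
  have hF := ringChar_ne_two_of_algebra K
  have hc : c ≠ 0 := by
    rintro rfl
    exact pow_ne_zero 13 ha (h.algebraMap_norm.symm.trans (map_zero _))
  have hpow := quadraticChar_eq_pow_of_char_ne_two' hF a
  rw [card_cubic hK, show 27 / 2 = 13 from rfl, ← h.algebraMap_norm] at hpow
  have hcast : algebraMap (ZMod 3) K c = ((quadraticChar (ZMod 3) c : ℤ) : K) := by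
    rw [← map_intCast (algebraMap (ZMod 3) K)]
    congr 1
    exact (by decide : ∀ c : ZMod 3, c = ((quadraticChar (ZMod 3) c : ℤ) : ZMod 3)) c
  rw [hcast] at hpow
  have hne : (1 : K) ≠ -1 := fun h => Ring.two_ne_zero hF (by linear_combination h)
  rcases quadraticChar_dichotomy ha with h₁ | h₁ <;>
    rcases quadraticChar_dichotomy hc with h₂ | h₂ <;>
    simp_all

end HasCharpolyCoeffs

lemma trace_pow_five_eq_zero_iff {a : K} (ha : Algebra.trace (ZMod 3) K a ≠ 0) :
    Algebra.trace (ZMod 3) K (a ^ 5) = 0 ↔ Algebra.trace (ZMod 3) K (a ^ 2) = 0 := by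
  obtain ⟨b, c, h⟩ := exists_hasCharpolyCoeffs hK a
  rw [h.trace_pow_five_eq_zero_iff hK ha, h.trace_sq_eq_zero_iff hK ha]

lemma eq_conjugate_of_trace_sq_eq {a a' : K} (ha : Algebra.trace (ZMod 3) K a ≠ 0)
    (htr : Algebra.trace (ZMod 3) K a' = Algebra.trace (ZMod 3) K a)
    (htr2 : Algebra.trace (ZMod 3) K (a' ^ 2) = Algebra.trace (ZMod 3) K (a ^ 2)) :
    a' = a ∨ a' = a ^ 3 ∨ a' = a ^ 9 := by
  obtain ⟨b, c, h⟩ := exists_hasCharpolyCoeffs hK a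
  obtain ⟨b', c', h'⟩ := exists_hasCharpolyCoeffs hK a'
  have ha' : Algebra.trace (ZMod 3) K a' ≠ 0 := htr ▸ ha
  obtain rfl : b' = b := by
    rw [h.trace_sq_of_trace_ne_zero hK ha, h'.trace_sq_of_trace_ne_zero hK ha'] at htr2
    exact add_left_cancel htr2
  obtain rfl : c' = c := by rw [h.norm_eq hK ha, h'.norm_eq hK ha', htr]
  have hcube := h'.cube_eq hK
  rw [htr, trace_cubic hK, h.algebraMap_linear, h.algebraMap_norm] at hcube
  have hprod : (a' - a) * ((a' - a ^ 3) * (a' - a ^ 9)) = 0 := by linear_combination hcube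
  simpa only [mul_eq_zero, sub_eq_zero] using hprod

lemma quadraticChar_cubic [Fintype K] [DecidableEq K] {a : K}
    (ha : Algebra.trace (ZMod 3) K a ≠ 0) :
    quadraticChar K a = (if Algebra.trace (ZMod 3) K (a ^ 2) = 0 then 1 else -1) *
      quadraticChar (ZMod 3) (Algebra.trace (ZMod 3) K a) := by
  obtain ⟨b, c, h⟩ := exists_hasCharpolyCoeffs hK a
  rw [h.quadraticChar_eq hK (ne_zero_of_trace_ne_zero ha), h.norm_eq hK ha]
  simp only [h.trace_sq_eq_zero_iff hK ha]
  exact (by decide : ∀ b e : ZMod 3, quadraticChar (ZMod 3) ((if b = -1 then 1 else -1) * e) =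
    (if b = -1 then 1 else -1) * quadraticChar (ZMod 3) e) _ _

lemma card_trace_eq_cubic [Fintype K] (ε : ZMod 3) :
    (Finset.univ.filter fun a : K => Algebra.trace (ZMod 3) K a = ε).card = 9 := by
  have h := card_mul_card_trace_mul_eq (K := K) one_ne_zero ε
  rw [card_cubic hK, Nat.card_zmod] at h
  simp only [one_mul, Nat.card_eq_fintype_card, Fintype.card_subtype] at h
  lia

-- Translation by `s ∈ 𝔽₃` preserves the trace and moves the trace of the square by `2sε`.
lemma card_trace_eq_and_trace_sq_eq_cubic [Fintype K] {ε : ZMod 3} (hε : ε ≠ 0) (t : ZMod 3) :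
    (Finset.univ.filter fun a : K => Algebra.trace (ZMod 3) K a = ε ∧
      Algebra.trace (ZMod 3) K (a ^ 2) = t).card = 3 := by
  let f : ZMod 3 → ℕ := fun t => (Finset.univ.filter fun a : K =>
    Algebra.trace (ZMod 3) K a = ε ∧ Algebra.trace (ZMod 3) K (a ^ 2) = t).card
  have hshift (t s : ZMod 3) : f t ≤ f (t + 2 * s * ε) := by
    refine Finset.card_le_card_of_injOn (fun a => a + algebraMap (ZMod 3) K s) ?_
      (add_left_injective _).injOn
    intro a ha
    obtain ⟨htr, htr2⟩ := (Finset.mem_filter.1 ha).2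
    have hsq : (a + algebraMap (ZMod 3) K s) ^ 2 =
        a ^ 2 + algebraMap (ZMod 3) K (2 * s) * a + algebraMap (ZMod 3) K (s * s) := by
      simp only [map_mul, map_ofNat]
      ring
    refine Finset.mem_filter.2 ⟨Finset.mem_univ _, ?_, ?_⟩
    · rw [map_add, trace_algebraMap_cubic hK, htr, add_zero]
    · rw [hsq, map_add, map_add, trace_algebraMap_mul, trace_algebraMap_cubic hK, htr, htr2,
        add_zero]
  have hle (t t' : ZMod 3) : f t ≤ f t' := by
    have h := hshift t ((t - t') * ε)
    rwa [(by decide : ∀ t t' e : ZMod 3, e ≠ 0 → t + 2 * ((t - t') * e) * e = t') _ _ _ hε] at h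
  have hsum : ∑ u, f u = 9 := by
    rw [← card_trace_eq_cubic hK ε, Finset.card_eq_sum_card_fiberwise (t := Finset.univ)
      (f := fun a => Algebra.trace (ZMod 3) K (a ^ 2)) fun _ _ => Finset.mem_univ _]
    simp only [f, Finset.filter_filter]
  have hconst (u : ZMod 3) : f u = f t := (hle u t).antisymm (hle t u)
  simp only [hconst, Finset.sum_const, Finset.card_univ, ZMod.card, smul_eq_mul] at hsum
  change f t = 3
  lia

lemma sum_quadraticChar_cubic [Fintype K] [DecidableEq K] {ε : ZMod 3} (hε : ε ≠ 0) :
    ∑ a : K with Algebra.trace (ZMod 3) K a = ε, quadraticChar K a =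
      -3 * quadraticChar (ZMod 3) ε := by
  have hterm : ∀ a ∈ Finset.univ.filter fun a : K => Algebra.trace (ZMod 3) K a = ε,
      quadraticChar K a = (2 * (if Algebra.trace (ZMod 3) K (a ^ 2) = 0 then 1 else 0) - 1) *
        quadraticChar (ZMod 3) ε := by
    intro a ha
    obtain rfl : Algebra.trace (ZMod 3) K a = ε := (Finset.mem_filter.1 ha).2
    rw [quadraticChar_cubic hK hε]
    split_ifs <;> ring
  rw [Finset.sum_congr rfl hterm, ← Finset.sum_mul, Finset.sum_sub_distrib, ← Finset.mul_sum,
    Finset.sum_boole, Finset.filter_filter, card_trace_eq_and_trace_sq_eq_cubic hK hε,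
    Finset.sum_const, card_trace_eq_cubic hK]
  norm_num

end CubicField

section CubicOrbits

variable {K : Type*} [Field K]

/-- The conjugates over `𝔽₃` of an element of the field with 27 elements. -/
def conjugates [DecidableEq K] (a : K) : Finset K := {a, a ^ 3, a ^ 9}

lemma mem_conjugates [DecidableEq K] {a c : K} :
    c ∈ conjugates a ↔ c = a ∨ c = a ^ 3 ∨ c = a ^ 9 := by
  simp only [conjugates, Finset.mem_insert, Finset.mem_singleton]

lemma quadraticChar_eq_of_mem_conjugates [Fintype K] [DecidableEq K] {a c : K}
    (hc : c ∈ conjugates a) : quadraticChar K c = quadraticChar K a := by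
  have hodd (j : ℕ) : quadraticChar K (a ^ (2 * j + 1)) = quadraticChar K a := by
    by_cases ha : a = 0
    · simp [ha]
    · rw [pow_succ, mul_comm 2, pow_mul, map_mul, quadraticChar_sq_one' (pow_ne_zero j ha), one_mul]
  rcases mem_conjugates.1 hc with rfl | rfl | rfl
  exacts [rfl, hodd 1, hodd 4]

variable [Algebra (ZMod 3) K]

section Conjugates

variable (hK : Module.finrank (ZMod 3) K = 3) {a : K} (ha : Algebra.trace (ZMod 3) K a ≠ 0)

include hK ha

lemma cube_ne_self : a ^ 3 ≠ a := by
  intro h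
  obtain ⟨r, rfl⟩ := exists_algebraMap_eq_of_cube_eq h
  exact ha (trace_algebraMap_cubic hK r)

lemma pow_nine_ne_cube : a ^ 9 ≠ a ^ 3 := by
  have := charP_three K
  intro h
  refine cube_ne_self hK ha (frobenius_inj K 3 ?_)
  rw [frobenius_def, frobenius_def, ← pow_mul, h]

lemma pow_nine_ne_self : a ^ 9 ≠ a := by
  intro h
  refine cube_ne_self hK ha ?_
  calc a ^ 3 = (a ^ 9) ^ 3 := by rw [h]
    _ = a ^ 27 := by ring
    _ = a := pow_card_cubic hK a

variable [DecidableEq K]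

lemma mem_conjugates_iff_trace {c : K} : c ∈ conjugates a ↔
    Algebra.trace (ZMod 3) K c = Algebra.trace (ZMod 3) K a ∧
      Algebra.trace (ZMod 3) K (c ^ 2) = Algebra.trace (ZMod 3) K (a ^ 2) := by
  have := finite_cubic hK
  rw [mem_conjugates]
  refine ⟨?_, fun h => eq_conjugate_of_trace_sq_eq hK ha h.1 h.2⟩
  have hnine (b : K) : Algebra.trace (ZMod 3) K (b ^ 9) = Algebra.trace (ZMod 3) K b := by
    rw [show b ^ 9 = (b ^ 3) ^ 3 by ring, trace_cube, trace_cube]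
  rintro (rfl | rfl | rfl)
  · exact ⟨rfl, rfl⟩
  · rw [pow_right_comm, trace_cube, trace_cube]
    exact ⟨rfl, rfl⟩
  · rw [pow_right_comm, hnine, hnine]
    exact ⟨rfl, rfl⟩

lemma card_conjugates : (conjugates a).card = 3 :=
  Finset.card_eq_three.2 ⟨a, a ^ 3, a ^ 9, (cube_ne_self hK ha).symm,
    (pow_nine_ne_self hK ha).symm, (pow_nine_ne_cube hK ha).symm, rfl⟩

omit hK in
lemma mul_self_mul_mem_conjugates (b : K) : b * b * a ∈ conjugates a ↔
    b = 1 ∨ b = -1 ∨ b = a ∨ b = -a ∨ b = a ^ 4 ∨ b = -a ^ 4 := by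
  have hsquare (z c : K) (hc : z * z * a = c) : b * b * a = c ↔ b = z ∨ b = -z := by
    rw [← hc, mul_left_inj' (ne_zero_of_trace_ne_zero ha), mul_self_eq_mul_self_iff]
  rw [mem_conjugates, hsquare 1 a (by ring), hsquare a (a ^ 3) (by ring),
    hsquare (a ^ 4) (a ^ 9) (by ring)]
  simp only [or_assoc]

lemma conjugate_multiplier_iff (b : K) :
    (b * b * a ∈ conjugates a ∧ Algebra.trace (ZMod 3) K (a * b) = 0) ↔
      Algebra.trace (ZMod 3) K (a ^ 2) = 0 ∧ (b = a ∨ b = -a ∨ b = a ^ 4 ∨ b = -a ^ 4) := by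
  have hneg (b : K) : Algebra.trace (ZMod 3) K (a * -b) = 0 ↔
      Algebra.trace (ZMod 3) K (a * b) = 0 := by rw [mul_neg, map_neg, neg_eq_zero]
  have hone : Algebra.trace (ZMod 3) K (a * 1) ≠ 0 := by rwa [mul_one]
  have hself : Algebra.trace (ZMod 3) K (a * a) = 0 ↔ Algebra.trace (ZMod 3) K (a ^ 2) = 0 := by
    rw [sq]
  have hfour : Algebra.trace (ZMod 3) K (a * a ^ 4) = 0 ↔
      Algebra.trace (ZMod 3) K (a ^ 2) = 0 := by
    rw [← pow_succ', trace_pow_five_eq_zero_iff hK ha]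
  rw [mul_self_mul_mem_conjugates ha]
  constructor
  · rintro ⟨rfl | rfl | rfl | rfl | rfl | rfl, hb⟩ <;> simp_all
  · rintro ⟨hb, rfl | rfl | rfl | rfl⟩ <;> simp_all

lemma card_conjugate_multipliers :
    Nat.card {b : K // b * b * a ∈ conjugates a ∧ Algebra.trace (ZMod 3) K (a * b) = 0} =
      if Algebra.trace (ZMod 3) K (a ^ 2) = 0 then 4 else 0 := by
  simp only [conjugate_multiplier_iff hK ha]
  split_ifs with htr
  · have hne (z : K) (hz : z ≠ 0) : z ≠ -z := fun h =>
      mul_ne_zero (Ring.two_ne_zero (ringChar_ne_two_of_algebra K)) hz (by linear_combination h)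
    have ha0 := ne_zero_of_trace_ne_zero ha
    have hself := hne a ha0
    have hfour := hne (a ^ 4) (pow_ne_zero 4 ha0)
    have hdiff : a ≠ a ^ 4 := fun h => pow_nine_ne_cube hK ha (by
      linear_combination -(a ^ 5 + a ^ 2) * h)
    have hsum : a ≠ -a ^ 4 := fun h => pow_nine_ne_cube hK ha (by
      linear_combination (a ^ 5 - a ^ 2) * h)
    have hset : {b : K | b = a ∨ b = -a ∨ b = a ^ 4 ∨ b = -a ^ 4} =
        (({a, -a, a ^ 4, -a ^ 4} : Finset K) : Set K) := by
      ext b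
      simp
    simp only [htr, true_and]
    rw [← Set.coe_ofPred, Nat.card_coe_set_eq, hset, Set.ncard_coe_finset,
      Finset.card_insert_of_notMem, Finset.card_insert_of_notMem, Finset.card_insert_of_notMem,
      Finset.card_singleton]
    · simpa using hfour
    · simpa [neg_eq_iff_eq_neg] using ⟨hsum, hdiff⟩
    · simpa using ⟨hself, hdiff, hsum⟩
  · simp [htr]

end Conjugates

variable [DecidableEq K] {V : Type*} [AddCommGroup V] [Module (ZMod 3) V] [Module K V]
  [IsScalarTower (ZMod 3) K V] {Q : QuadraticForm (ZMod 3) V} {Qs : QuadraticForm K V}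
  (hK : Module.finrank (ZMod 3) K = 3) (hQs : ∀ v, Q v = Algebra.trace (ZMod 3) K (Qs v))
  {T : ℤ} (hT : HasDiscrepancy Q T)

include hK hQs hT

-- Compare the two counts of the vectors `v` with `Q v = 1`.
lemma HasDiscrepancy.eq_neg_three_mul_of_trace [Fintype K] [Finite V]
    (hd : Odd (Module.finrank K V)) {Ts : ℤ} (hTs : HasDiscrepancy Qs Ts) : Ts = -3 * T := by
  have hdim := Module.finrank_mul_finrank (ZMod 3) K V
  rw [hK] at hdim
  have hd' : ¬ Even (Module.finrank (ZMod 3) V) := by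
    rw [← hdim, Nat.not_even_iff_odd]
    exact Odd.mul (by decide) hd
  have hcount : valueCount Q 1 = ∑ a : K with Algebra.trace (ZMod 3) K a = 1, valueCount Qs a := by
    simp only [valueCount, ← card_mem_eq_sum, Finset.mem_filter, Finset.mem_univ, true_and, hQs]
  have hsum : (27 : ℤ) * valueCount Q 1 = 9 * 27 ^ Module.finrank K V - 3 * Ts := by
    rw [hcount, Nat.cast_sum, Finset.mul_sum]
    have hterm (a : K) : (27 : ℤ) * valueCount Qs a =
        27 ^ Module.finrank K V + Ts * quadraticChar K a := by
      have h := hTs.card_mul a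
      rwa [card_cubic hK, discrepancyKernel, if_neg (Nat.not_even_iff_odd.2 hd)] at h
    simp only [hterm, Finset.sum_add_distrib, Finset.sum_const, ← Finset.mul_sum,
      card_trace_eq_cubic hK, sum_quadraticChar_cubic hK one_ne_zero, map_one, nsmul_eq_mul]
    push_cast
    ring
  have hQ1 := hT.card_mul 1
  rw [discrepancyKernel, if_neg hd', ← hdim, pow_mul, ZMod.card, map_one] at hQ1
  norm_num at hQ1
  linarith

-- After passing to points this is equation (1) for the orbit of `⟨x⟩`.
lemma HasDiscrepancy.three_mul_card_conjugate_norms [Finite V] (hQ : Q.polarBilin.Nondegenerate)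
    (hd : Odd (Module.finrank K V)) {x : V} (hx : Q x ≠ 0) :
    3 * (Nat.card {y : V // Qs y ∈ conjugates (Qs x)} : ℤ) =
      9 * Nat.card {y : V // Qs y ∈ conjugates (Qs x) ∧
        Algebra.trace (ZMod 3) K (QuadraticMap.polar Qs x y) = 0} +
      2 * quadraticChar (ZMod 3) (Q x) * T := by
  have := finite_cubic hK
  have := Fintype.ofFinite K
  have hF := ringChar_ne_two_of_algebra K
  have htr : Algebra.trace (ZMod 3) K (Qs x) ≠ 0 := by rwa [← hQs]
  have hx0 := ne_zero_of_trace_ne_zero htr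
  obtain ⟨T', hT'⟩ := exists_hasDiscrepancy hF
    (nondegenerate_restrict_vperp (Ring.two_ne_zero hF) (nondegenerate_of_trace hQs hQ) hx0)
  have heven : Even (Module.finrank K (vperp Qs x)) := by
    rwa [← finrank_vperp (Ring.two_ne_zero hF) hx0, Nat.odd_add_one, Nat.not_odd_iff_even] at hd
  have hTT' := hT.eq_neg_three_mul_of_trace hK hQs hd (hT'.of_even hF hx0 heven)
  have hall := hT'.card_norm_mem hF hx0 heven (conjugates (Qs x))
    fun _ => quadraticChar_eq_of_mem_conjugates
  have hperp := hT'.card_norm_mem_and_trace_polar_eq_zero (F := ZMod 3) hF hx0 heven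
    (conjugates (Qs x))
  rw [card_conjugate_multipliers hK htr, Nat.card_zmod] at hperp
  rw [card_conjugates hK htr] at hall hperp
  rw [card_cubic hK, quadraticChar_cubic hK htr, ← hQs] at hTT'
  have hsq := quadraticChar_sq_one hx
  push_cast at hall hperp hTT'
  split_ifs at hperp hTT'
  · have hval : T = -9 * quadraticChar (ZMod 3) (Q x) * T' := by linarith
    linear_combination 3 * hall - 3 * hperp - 2 * quadraticChar (ZMod 3) (Q x) * hval +
      18 * T' * hsq
  · have hval : T = 9 * quadraticChar (ZMod 3) (Q x) * T' := by linarith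
    linear_combination 3 * hall - 3 * hperp - 2 * quadraticChar (ZMod 3) (Q x) * hval -
      18 * T' * hsq

end CubicOrbits

/-! ### Equation (1) -/

section Equation

variable {n : ℕ} {ξ : ℤˣ} {k l mu : ℕ}

lemma PointParams.cast_k (hP : PointParams n ξ k l mu) :
    (k : ℝ) = 3 ^ n * (3 * 3 ^ n - ξ) / 2 := by
  have h := congrArg (Int.cast : ℤ → ℝ) hP.two_mul_k
  push_cast at h
  linear_combination h / 2

lemma PointParams.cast_l (hP : PointParams n ξ k l mu) :
    (l : ℝ) = (3 * 3 ^ n - ξ) * (3 ^ n + ξ) := by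
  have h := congrArg (Int.cast : ℤ → ℝ) hP.l_eq
  push_cast at h
  linear_combination h

lemma PointParams.cast_mu (hP : PointParams n ξ k l mu) :
    (mu : ℝ) = 3 ^ n * (3 ^ n - ξ) / 2 := by
  have h := congrArg (Int.cast : ℤ → ℝ) hP.two_mul_mu
  push_cast at h
  linear_combination h / 2

lemma PointParams.sqrt_discr (hP : PointParams n ξ k l mu) : √(discr k mu mu) = 2 * 3 ^ n := by
  have h : discr k mu mu = (2 * 3 ^ n) ^ 2 := by
    rw [discr, hP.cast_k, hP.cast_mu]
    ring
  rw [h, Real.sqrt_sq (by positivity)]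

lemma PointParams.eigS_eq (hP : PointParams n ξ k l mu) : eigS k mu mu = 3 ^ n := by
  rw [eigS, hP.sqrt_discr]
  ring

lemma PointParams.eigT_eq (hP : PointParams n ξ k l mu) : eigT k mu mu = -3 ^ n := by
  rw [eigT, hP.sqrt_discr]
  ring

lemma PointParams.ite_eigS_eigT_eq (hP : PointParams n ξ k l mu) :
    (if ξ = 1 then eigS k mu mu else eigT k mu mu) = ξ * 3 ^ n := by
  rw [hP.eigS_eq, hP.eigT_eq]
  rcases Int.units_eq_one_or ξ with rfl | rfl
  · simp
  · simp [show (-1 : ℤˣ) ≠ 1 by decide]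

lemma units_cast_mul_self (ξ : ℤˣ) : (ξ : ℝ) * ξ = 1 := by
  rcases Int.units_eq_one_or ξ with rfl | rfl <;> simp

lemma three_mul_three_pow_sub_ne_zero (n : ℕ) (ξ : ℤˣ) : 3 * (3 : ℝ) ^ n - ξ ≠ 0 := by
  have h : (1 : ℝ) ≤ 3 ^ n := one_le_pow₀ (by norm_num)
  rcases Int.units_eq_one_or ξ with rfl | rfl <;> push_cast <;> linarith

lemma three_pow_add_ne_zero (hn : 1 ≤ n) (ξ : ℤˣ) : (3 : ℝ) ^ n + ξ ≠ 0 := by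
  have h : (1 : ℝ) < 3 ^ n := one_lt_pow₀ (by norm_num) (by lia)
  rcases Int.units_eq_one_or ξ with rfl | rfl <;> push_cast <;> linarith

lemma PointParams.k_ne_zero (hP : PointParams n ξ k l mu) : k ≠ 0 := by
  rw [← Nat.cast_ne_zero (R := ℝ), hP.cast_k]
  have := three_mul_three_pow_sub_ne_zero n ξ
  positivity

lemma PointParams.l_ne_zero (hP : PointParams n ξ k l mu) (hn : 1 ≤ n) : l ≠ 0 := by
  rw [← Nat.cast_ne_zero (R := ℝ), hP.cast_l]
  exact mul_ne_zero (three_mul_three_pow_sub_ne_zero n ξ) (three_pow_add_ne_zero hn ξ)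

lemma PointParams.eigenvalue_sq (hP : PointParams n ξ k l mu) :
    ((ξ : ℝ) * 3 ^ n) ^ 2 = (mu - mu) * (ξ * 3 ^ n) + (k - mu) := by
  rw [hP.cast_k, hP.cast_mu]
  linear_combination (3 ^ n) ^ 2 * units_cast_mul_self ξ

lemma PointParams.one_add_mul_div (hP : PointParams n ξ k l mu) (d e : ℝ) :
    1 + d * (e * 3 ^ n) / k = (3 * 3 ^ n - ξ + 2 * d * e) / (3 * 3 ^ n - ξ) := by
  have hk := three_mul_three_pow_sub_ne_zero n ξ
  have hp : (3 : ℝ) ^ n ≠ 0 := by positivity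
  rw [hP.cast_k]
  generalize 3 * (3 : ℝ) ^ n - ξ = w at *
  field_simp

lemma PointParams.equation_pos_iff (hP : PointParams n ξ k l mu) (hn : 1 ≤ n) (d c : ℝ) :
    1 + d * (ξ * 3 ^ n) / k = (ξ * 3 ^ n + 1) * c / l ↔ c = 2 * d + 3 * ξ * 3 ^ n - 1 := by
  have hξ := units_cast_mul_self ξ
  have hk := three_mul_three_pow_sub_ne_zero n ξ
  have hl := three_pow_add_ne_zero hn ξ
  have hright : (ξ * 3 ^ n + 1) * c / l = ξ * c / (3 * 3 ^ n - ξ) := by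
    rw [hP.cast_l, div_eq_div_iff (mul_ne_zero hk hl) hk]
    linear_combination (-(3 * 3 ^ n - ξ) * c) * hξ
  rw [hP.one_add_mul_div, hright, div_left_inj' hk]
  constructor
  · intro h
    linear_combination (-ξ : ℝ) * h - (c - 2 * d + 1) * hξ
  · rintro rfl
    linear_combination (-3 * 3 ^ n) * hξ

lemma PointParams.equation_neg (hP : PointParams n ξ k l mu) (hn : 1 ≤ n) {d c : ℝ}
    (h : 1 + d * -(ξ * 3 ^ n) / k = (-(ξ * 3 ^ n) + 1) * c / l) :
    (3 * 3 ^ n - ξ - 2 * d * ξ) * (3 ^ n + ξ) = -ξ * (3 ^ n - ξ) * c := by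
  have hk := three_mul_three_pow_sub_ne_zero n ξ
  have hl := three_pow_add_ne_zero hn ξ
  rw [← neg_mul, hP.one_add_mul_div, hP.cast_l, div_eq_div_iff hk (mul_ne_zero hk hl)] at h
  refine mul_left_cancel₀ hk ?_
  linear_combination h - (3 * 3 ^ n - ξ) * c * units_cast_mul_self ξ

end Equation

/-! ### Orbits on points -/

section OrbitPoints

variable {V : Type*} [AddCommGroup V] [Module (ZMod 3) V] {K : Type*} [Field K] [Module K V]
  {Qs : QuadraticForm K V}

lemma exists_rep_norm_eq {v : V} (hv : Qs v ≠ 0) : ∃ x : ℙ (ZMod 3) V, Qs x.rep = Qs v := by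
  have hv0 : v ≠ 0 := by
    rintro rfl
    exact hv (QuadraticMap.map_zero Qs)
  refine ⟨Projectivization.mk (ZMod 3) v hv0, ?_⟩
  rcases rep_mk_eq_or_eq_neg v hv0 with h | h
  · rw [h]
  · rw [h, QuadraticMap.map_neg]

lemma exists_point_norm_eq [Finite K] [Finite V] (hK : ringChar K ≠ 2)
    (hQs : Qs.polarBilin.Nondegenerate) (hd : 2 ≤ Module.finrank K V) {a : K} (ha : a ≠ 0) :
    ∃ x : ℙ (ZMod 3) V, Qs x.rep = a := by
  obtain ⟨v, rfl⟩ := exists_norm_eq hK hQs hd ha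
  exact exists_rep_norm_eq ha

lemma two_mul_ncard_norm_mem {C : Finset K} (hC : (0 : K) ∉ C) :
    2 * {y : ℙ (ZMod 3) V | Qs y.rep ∈ C}.ncard = Nat.card {y : V // Qs y ∈ C} :=
  two_mul_ncard_points (p := fun v => Qs v ∈ C) (fun v => by rw [QuadraticMap.map_neg])
    (fun h => hC (by rwa [QuadraticMap.map_zero] at h))

variable [Algebra (ZMod 3) K] {Q : QuadraticForm (ZMod 3) V}
  (hQs : ∀ v, Q v = Algebra.trace (ZMod 3) K (Qs v)) {ξ : ℤˣ} {ε : ZMod 3}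

include hQs

lemma two_mul_ncard_norm_mem_inter_Delta (hε : IsPointNorm Q ξ ε) {C : Finset K}
    (hCε : ∀ c ∈ C, Algebra.trace (ZMod 3) K c = ε) (x : ℙ (ZMod 3) V) :
    2 * ({y : ℙ (ZMod 3) V | Qs y.rep ∈ C} ∩ Delta Q ξ x).ncard =
      Nat.card {y : V // Qs y ∈ C ∧
        Algebra.trace (ZMod 3) K (QuadraticMap.polar Qs x.rep y) = 0} := by
  rw [← two_mul_ncard_points (p := fun v => Qs v ∈ C ∧
    Algebra.trace (ZMod 3) K (QuadraticMap.polar Qs x.rep v) = 0)]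
  · congr 2
    ext y
    simp only [Delta_eq hε, Set.mem_inter_iff, Set.mem_ofPred_eq, polar_eq_trace hQs]
    refine ⟨fun h => ⟨h.1, h.2.1⟩, fun h => ⟨h.1, h.2, ?_⟩⟩
    rw [hQs, hCε _ h.1]
  · intro v
    rw [QuadraticMap.map_neg, QuadraticMap.polar_neg_right, map_neg, neg_eq_zero]
  · rintro ⟨h, -⟩
    rw [QuadraticMap.map_zero] at h
    exact hε.ne_zero (by rw [← hCε _ h, map_zero])

lemma norm_ne_zero_of_map_ne_zero {v : V} (hv : Q v ≠ 0) : Qs v ≠ 0 := fun h =>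
  hv (by rw [hQs, h, map_zero])

variable {G : Subgroup (V ≃ₗ[ZMod 3] V)} (hGI : G ≤ isometryGroup Q)

include hGI

lemma orbit_subset_nonsingPoints [Finite K] (hε : IsPointNorm Q ξ ε) {x : ℙ (ZMod 3) V}
    (hx : x ∈ nonsingPoints Q ξ) :
    MulAction.orbit (fieldExtSubgroup K G) x ⊆ nonsingPoints Q ξ := by
  intro y hy
  obtain ⟨σ, hσ⟩ := exists_norm_eq_of_mem_orbit hQs hGI hy
  rw [hε.mem_iff] at hx ⊢
  rw [hQs, hσ, trace_ringEquiv, ← hQs, hx]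

variable [Finite V] [IsScalarTower (ZMod 3) K V] (hK : Module.finrank (ZMod 3) K = 3)
  (hQ : Q.polarBilin.Nondegenerate) (hΩG : Omega Q ≤ G) (hd : 3 ≤ Module.finrank K V)

include hK hQ hΩG hd

lemma mem_orbit_iff_trace_cubic {x y : ℙ (ZMod 3) V} (hx : Q x.rep ≠ 0) :
    y ∈ MulAction.orbit (fieldExtSubgroup K G) x ↔ Q y.rep = Q x.rep ∧
      Algebra.trace (ZMod 3) K (Qs y.rep ^ 2) = Algebra.trace (ZMod 3) K (Qs x.rep ^ 2) := by
  have := finite_cubic hK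
  constructor
  · intro h
    obtain ⟨σ, hσ⟩ := exists_norm_eq_of_mem_orbit hQs hGI h
    rw [hQs, hQs, hσ, trace_ringEquiv, ← map_pow, trace_ringEquiv]
    exact ⟨rfl, rfl⟩
  · rintro ⟨htr, htr2⟩
    have hx' := norm_ne_zero_of_map_ne_zero hQs hx
    have hy' := norm_ne_zero_of_map_ne_zero hQs (htr ▸ hx)
    rw [hQs, hQs x.rep] at htr
    rcases eq_conjugate_of_trace_sq_eq hK (by rwa [← hQs]) htr htr2 with h | h | h
    · exact mem_orbit_of_norm_eq hQs hQ hΩG hd h.symm hx'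
    · exact mem_orbit_of_norm_eq_cube hQs hQ hΩG hd (pow_card_cubic hK) h.symm hx'
    · rw [MulAction.mem_orbit_symm]
      refine mem_orbit_of_norm_eq_cube hQs hQ hΩG hd (pow_card_cubic hK) ?_ hy'
      rw [h, ← pow_mul, pow_card_cubic hK]

lemma orbit_eq_conjugates [DecidableEq K] {x : ℙ (ZMod 3) V} (hx : Q x.rep ≠ 0) :
    MulAction.orbit (fieldExtSubgroup K G) x = {y | Qs y.rep ∈ conjugates (Qs x.rep)} := by
  ext y
  rw [mem_orbit_iff_trace_cubic hQs hGI hK hQ hΩG hd hx, Set.mem_ofPred_eq,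
    mem_conjugates_iff_trace hK (by rwa [← hQs]), ← hQs, ← hQs]

theorem ncard_orbit_cubic {n : ℕ} (hm : Module.finrank (ZMod 3) V = 2 * (n + 1) + 1)
    (hε : IsPointNorm Q ξ ε)
    (hT : HasDiscrepancy Q (ξ * quadraticChar (ZMod 3) ε * 3 ^ (n + 2))) {x : ℙ (ZMod 3) V}
    (hx : x ∈ nonsingPoints Q ξ) :
    ((MulAction.orbit (fieldExtSubgroup K G) x).ncard : ℤ) =
      3 * (MulAction.orbit (fieldExtSubgroup K G) x ∩ Delta Q ξ x).ncard + ξ * 3 ^ (n + 1) := by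
  classical
  have hxε := (hε.mem_iff x).1 hx
  have hodd : Odd (Module.finrank K V) := by
    refine (Nat.odd_mul (m := Module.finrank (ZMod 3) K).1 ?_).2
    rw [Module.finrank_mul_finrank, hm]
    exact odd_two_mul_add_one _
  have htr : ∀ c ∈ conjugates (Qs x.rep), Algebra.trace (ZMod 3) K c = ε := fun c hc => by
    rw [((mem_conjugates_iff_trace hK (by rw [← hQs]; exact hx.1)).1 hc).1, ← hQs, hxε]
  have hzero : (0 : K) ∉ conjugates (Qs x.rep) := fun h =>
    hε.ne_zero (by rw [← htr 0 h, map_zero])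
  have hcount := hT.three_mul_card_conjugate_norms hK hQs hQ hodd hx.1
  rw [← two_mul_ncard_norm_mem hzero, ← two_mul_ncard_norm_mem_inter_Delta hQs hε htr,
    ← orbit_eq_conjugates hQs hGI hK hQ hΩG hd hx.1, hxε] at hcount
  push_cast at hcount
  refine mul_left_cancel₀ (by norm_num : (6 : ℤ) ≠ 0) ?_
  linear_combination hcount + 2 * ξ * 3 ^ (n + 2) * quadraticChar_sq_one hε.ne_zero

theorem ncard_orbits_cubic (hε : IsPointNorm Q ξ ε) :
    ((fun x => MulAction.orbit (fieldExtSubgroup K G) x) '' nonsingPoints Q ξ).ncard = 3 := by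
  have := finite_cubic hK
  have := Fintype.ofFinite K
  let fibre (t : ZMod 3) : Set (ℙ (ZMod 3) V) :=
    {y | Q y.rep = ε ∧ Algebra.trace (ZMod 3) K (Qs y.rep ^ 2) = t}
  have horbit (x) (hx : x ∈ nonsingPoints Q ξ) : MulAction.orbit (fieldExtSubgroup K G) x =
      fibre (Algebra.trace (ZMod 3) K (Qs x.rep ^ 2)) := by
    ext y
    rw [mem_orbit_iff_trace_cubic hQs hGI hK hQ hΩG hd hx.1, (hε.mem_iff x).1 hx]
    rfl
  have hpoint (t : ZMod 3) :
      ∃ x ∈ nonsingPoints Q ξ, Algebra.trace (ZMod 3) K (Qs x.rep ^ 2) = t := by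
    obtain ⟨a, ha⟩ := Finset.card_pos.1 <|
      three_pos.trans_eq (card_trace_eq_and_trace_sq_eq_cubic hK hε.ne_zero t).symm
    obtain ⟨-, htr, htr2⟩ := Finset.mem_filter.1 ha
    obtain ⟨x, hx⟩ := exists_point_norm_eq (V := V) (ringChar_ne_two_of_algebra K)
      (nondegenerate_of_trace hQs hQ) (by lia)
      (ne_zero_of_trace_ne_zero (htr.trans_ne hε.ne_zero))
    exact ⟨x, by rw [hε.mem_iff, hQs, hx, htr], by rw [hx, htr2]⟩
  have hinj : Function.Injective fibre := by
    intro t t' h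
    obtain ⟨x, hx, rfl⟩ := hpoint t
    exact (h ▸ ⟨(hε.mem_iff x).1 hx, rfl⟩ : x ∈ fibre t').2
  have hrange : (fun x => MulAction.orbit (fieldExtSubgroup K G) x) '' nonsingPoints Q ξ =
      Set.range fibre := by
    ext S
    constructor
    · rintro ⟨x, hx, rfl⟩
      exact ⟨_, (horbit x hx).symm⟩
    · rintro ⟨t, rfl⟩
      obtain ⟨x, hx, rfl⟩ := hpoint t
      exact ⟨x, hx, horbit x hx⟩
  rw [hrange, ← Set.image_univ, Set.ncard_image_of_injective _ hinj, Set.ncard_univ, Nat.card_zmod]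

end OrbitPoints

section EquationFailure

variable {n : ℕ} {ξ : ℤˣ} {k l mu : ℕ}

lemma PointParams.eig_cases (hP : PointParams n ξ k l mu) {r : ℝ}
    (hr : r = eigS k mu mu ∨ r = eigT k mu mu) : r = ξ * 3 ^ n ∨ r = -(ξ * 3 ^ n) := by
  rw [hP.eigS_eq, hP.eigT_eq] at hr
  rcases Int.units_eq_one_or ξ with rfl | rfl
  · simpa using hr
  · simpa using hr.symm

lemma PointParams.equation_cases (hP : PointParams n ξ k l mu) (hn : 1 ≤ n) {r : ℝ}
    (hr : r = eigS k mu mu ∨ r = eigT k mu mu) {d c : ℕ}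
    (h : 1 + (d : ℝ) * r / k = (r + 1) * c / l) :
    (c : ℤ) = 2 * d + 3 * ξ * 3 ^ n - 1 ∨
      (3 * 3 ^ n - (ξ : ℤ) - 2 * d * ξ) * (3 ^ n + ξ) = -ξ * (3 ^ n - ξ) * c := by
  rcases hP.eig_cases hr with rfl | rfl
  · rw [hP.equation_pos_iff hn] at h
    exact .inl (mod_cast h)
  · have h := hP.equation_neg hn h
    exact .inr (mod_cast h)

-- For the orbit of all points with a given norm in the prime field, `T` is the discrepancy of `x^⊥`
-- over the extension field.
lemma PointParams.not_equation_of_quadratic (hP : PointParams n ξ k l mu) (hn : 1 ≤ n) {T : ℤ}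
    (hT3 : 3 ∣ T) (hT : T ^ 2 ≠ 3 ^ (2 * (n + 1))) {o d c : ℕ} (ho : 2 * (o : ℤ) = T ^ 2 + T)
    (hd : 6 * (d : ℤ) = T ^ 2 - T) (hodc : o = d + c + 1) {r : ℝ}
    (hr : r = eigS k mu mu ∨ r = eigT k mu mu) :
    ¬ (1 + (d : ℝ) * r / k = (r + 1) * c / l) := by
  intro h
  have hne : (3 : ℤ) * 3 ^ n - ξ * T ≠ 0 := by
    refine fun h => hT ?_
    rw [mul_comm 2, pow_mul, pow_succ]
    rcases Int.units_eq_one_or ξ with rfl | rfl <;> push_cast at h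
    · linear_combination (-T - 3 * 3 ^ n) * h
    · linear_combination (T - 3 * 3 ^ n) * h
  have hc : 3 * (c : ℤ) = T ^ 2 + 2 * T - 3 := by
    zify at hodc
    linarith
  rcases hP.equation_cases hn hr h with h | h
  · refine hne ?_
    rcases Int.units_eq_one_or ξ with rfl | rfl <;> push_cast at h ⊢ <;> linarith
  · have hprod : ((3 : ℤ) * 3 ^ n - ξ * T) * (3 * 3 ^ n + 2 * ξ * T + ξ) = 0 := by
      rcases Int.units_eq_one_or ξ with rfl | rfl <;> push_cast at h ⊢
      · linear_combination 3 * h + (3 ^ n + 1) * hd - (3 ^ n - 1) * hc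
      · linear_combination 3 * h - (3 ^ n - 1) * hd + (3 ^ n + 1) * hc
    obtain ⟨t, rfl⟩ := hT3
    rcases mul_eq_zero.1 hprod with h | h
    · exact hne h
    · rcases Int.units_eq_one_or ξ with rfl | rfl <;> push_cast at h <;> lia

lemma PointParams.not_equation_of_small (hP : PointParams n ξ k l mu) (hn : 1 ≤ n)
    {d c : ℕ} (hdc : d + c ≤ 2 * n + 2) (hd : n = 1 → d ≤ 3) {r : ℝ}
    (hr : r = eigS k mu mu ∨ r = eigT k mu mu) :
    ¬ (1 + (d : ℝ) * r / k = (r + 1) * c / l) := by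
  intro h
  have hpow : 2 * (n : ℤ) + 1 ≤ 3 ^ n := by
    have h := one_add_mul_le_pow (show (-2 : ℤ) ≤ 2 by norm_num) n
    norm_num at h
    linarith
  have hcases := hP.equation_cases hn hr h
  generalize (3 : ℤ) ^ n = p at hpow hcases
  rcases Int.units_eq_one_or ξ with rfl | rfl <;> push_cast at hcases
  · rcases hcases with h | h
    · lia
    · have hd' : 3 * p - 1 ≤ 2 * (d : ℤ) := by
        by_contra! hlt
        nlinarith
      lia
  · rcases hcases with h | h
    · lia
    · have hc : (3 * p + 1) * (p - 1) ≤ (p + 1) * c := by nlinarith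
      nlinarith [(by lia : (c : ℤ) ≤ p + 1)]

end EquationFailure

section Fields

variable {V : Type*} [AddCommGroup V] [Module (ZMod 3) V] [Finite V]
  {Q : QuadraticForm (ZMod 3) V} {ξ : ℤˣ} {ε : ZMod 3}
  {K : Type*} [Field K] [Algebra (ZMod 3) K] [Module K V]
  {Qs : QuadraticForm K V} (hQs : ∀ v, Q v = Algebra.trace (ZMod 3) K (Qs v))

include hQs

lemma two_mul_ncard_norm_eq [Fintype K] [DecidableEq K] (hε : IsPointNorm Q ξ ε) {x : ℙ (ZMod 3) V}
    (hx : Q x.rep = ε) {j : ℕ} (hj : Module.finrank K V = 2 * j + 1) {T : ℤ}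
    (hT : HasDiscrepancy (Qs.restrict (vperp Qs x.rep)) T) :
    2 * ({y : ℙ (ZMod 3) V | Qs y.rep = Qs x.rep}.ncard : ℤ) = T ^ 2 + T ∧
      6 * (({y : ℙ (ZMod 3) V | Qs y.rep = Qs x.rep} ∩ Delta Q ξ x).ncard : ℤ) = T ^ 2 - T := by
  have hK := ringChar_ne_two_of_algebra K
  have hx0 := norm_ne_zero_of_map_ne_zero hQs (hx.trans_ne hε.ne_zero)
  have htr : Algebra.trace (ZMod 3) K (Qs x.rep) = ε := by rw [← hQs, hx]
  have hfr := finrank_vperp (Ring.two_ne_zero hK) hx0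
  have hdim : Module.finrank K (vperp Qs x.rep) = 2 * j := by lia
  have hT2 : (Fintype.card K : ℤ) ^ (2 * j) = T ^ 2 := by
    rw [hT.sq_eq, hdim]
    congr 1
    lia
  have heven : Even (Module.finrank K (vperp Qs x.rep)) := hdim ▸ even_two_mul j
  have hperp : Nat.card {b : K // b * b * Qs x.rep ∈ ({Qs x.rep} : Finset K) ∧
      Algebra.trace (ZMod 3) K (Qs x.rep * b) = 0} = 0 := by
    refine @Nat.card_of_isEmpty _ ⟨fun ⟨b, hb, htrb⟩ => ?_⟩
    rw [Finset.mem_singleton, mul_eq_right₀ hx0, mul_self_eq_one_iff] at hb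
    rcases hb with rfl | rfl
    · exact hε.ne_zero (by rw [← htr, ← htrb, mul_one])
    · exact hε.ne_zero (by rw [← htr, ← neg_eq_zero, ← map_neg, ← mul_neg_one, htrb])
  have hset : {y : ℙ (ZMod 3) V | Qs y.rep = Qs x.rep} =
      {y : ℙ (ZMod 3) V | Qs y.rep ∈ ({Qs x.rep} : Finset K)} := by
    simp only [Finset.mem_singleton]
  have hnorm := hT.card_norm_mem hK hx0 heven {Qs x.rep} (by simp)
  have hDelta := hT.card_norm_mem_and_trace_polar_eq_zero (F := ZMod 3) hK hx0 heven {Qs x.rep}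
  rw [← two_mul_ncard_norm_mem (by simpa using hx0.symm), ← hset, Finset.card_singleton, hdim, hT2]
    at hnorm
  rw [← two_mul_ncard_norm_mem_inter_Delta hQs hε (by simp [htr]), ← hset, Finset.card_singleton,
    hdim, hT2, hperp, Nat.card_zmod] at hDelta
  push_cast at hnorm hDelta
  exact ⟨by linear_combination hnorm, by linear_combination hDelta⟩

variable [Finite K] (hQ : Q.polarBilin.Nondegenerate)

include hQ

lemma exists_norm_eq_algebraMap (hε : IsPointNorm Q ξ ε) (hα : ¬ 3 ∣ Module.finrank (ZMod 3) K)
    (hd : 2 ≤ Module.finrank K V) :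
    ∃ s, ∃ x ∈ nonsingPoints Q ξ, Qs x.rep = algebraMap (ZMod 3) K s := by
  have hα0 : (Module.finrank (ZMod 3) K : ZMod 3) ≠ 0 := by rwa [Ne, ZMod.natCast_eq_zero_iff]
  have htr : Algebra.trace (ZMod 3) K
      (algebraMap (ZMod 3) K ((Module.finrank (ZMod 3) K : ZMod 3)⁻¹ * ε)) = ε := by
    rw [Algebra.trace_algebraMap, nsmul_eq_mul, mul_inv_cancel_left₀ hα0]
  obtain ⟨x, hx⟩ := exists_point_norm_eq (V := V) (ringChar_ne_two_of_algebra K)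
    (nondegenerate_of_trace hQs hQ) hd (ne_zero_of_trace_ne_zero (htr.trans_ne hε.ne_zero))
  exact ⟨_, x, by rw [hε.mem_iff, hQs, hx, htr], hx⟩

variable [IsScalarTower (ZMod 3) K V] {G : Subgroup (V ≃ₗ[ZMod 3] V)}
  (hΩG : Omega Q ≤ G) (hGI : G ≤ isometryGroup Q)
  (hd : 3 ≤ Module.finrank K V)

include hΩG hGI hd

lemma orbit_eq_of_norm_eq_algebraMap {x : ℙ (ZMod 3) V} (hx : Q x.rep ≠ 0) {s : ZMod 3}
    (hs : Qs x.rep = algebraMap (ZMod 3) K s) :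
    MulAction.orbit (fieldExtSubgroup K G) x = {y | Qs y.rep = Qs x.rep} := by
  ext y
  constructor
  · intro h
    obtain ⟨σ, hσ⟩ := exists_norm_eq_of_mem_orbit hQs hGI h
    rw [Set.mem_ofPred_eq, hσ, hs]
    exact RingHom.congr_fun (Subsingleton.elim ((σ : K →+* K).comp (algebraMap (ZMod 3) K))
      (algebraMap (ZMod 3) K)) s
  · intro h
    exact mem_orbit_of_norm_eq hQs hQ hΩG hd h.symm (norm_ne_zero_of_map_ne_zero hQs hx)

theorem exists_not_orbitEquation_of_three_le {n k l mu : ℕ}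
    (hα : 2 ≤ Module.finrank (ZMod 3) K) (hα3 : ¬ 3 ∣ Module.finrank (ZMod 3) K)
    (hm : Module.finrank (ZMod 3) V = 2 * (n + 1) + 1) (hn : 1 ≤ n) (hε : IsPointNorm Q ξ ε)
    (hP : PointParams n ξ k l mu) :
    ∃ x ∈ nonsingPoints Q ξ, ∀ r : ℝ, (r = eigS k mu mu ∨ r = eigT k mu mu) →
      ¬ OrbitEquation (M := fieldExtSubgroup K G) (Delta Q ξ) (Gamma Q ξ) k l r x := by
  classical
  have := Fintype.ofFinite K
  have hK := ringChar_ne_two_of_algebra K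
  obtain ⟨s, x, hxE, hs⟩ := exists_norm_eq_algebraMap hQs hQ hε hα3 (by lia)
  refine ⟨x, hxE, fun r hr => ?_⟩
  have htower := Module.finrank_mul_finrank (ZMod 3) K V
  obtain ⟨j, hj⟩ : Odd (Module.finrank K V) :=
    Nat.Odd.of_mul_right (htower ▸ hm ▸ odd_two_mul_add_one _)
  obtain ⟨T, hT⟩ := exists_hasDiscrepancy hK (nondegenerate_restrict_vperp (Ring.two_ne_zero hK)
    (nondegenerate_of_trace hQs hQ) (norm_ne_zero_of_map_ne_zero hQs hxE.1))
  have hT2 : T ^ 2 = 3 ^ (Module.finrank (ZMod 3) K * (2 * j)) := by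
    have hfr := finrank_vperp (Ring.two_ne_zero hK) (norm_ne_zero_of_map_ne_zero hQs hxE.1)
    rw [hT.sq_eq, ← Nat.card_eq_fintype_card, Module.natCard_eq_pow_finrank (K := ZMod 3),
      Nat.card_zmod, Nat.cast_pow, ← pow_mul]
    congr 2
    lia
  have hexp : Module.finrank (ZMod 3) K * (2 * j) + Module.finrank (ZMod 3) K =
      2 * (n + 1) + 1 := by rw [← hm, ← htower, hj, mul_add_one]
  obtain ⟨hO, hOD⟩ := two_mul_ncard_norm_eq hQs hε ((hε.mem_iff x).1 hxE) hj hT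
  rw [← orbit_eq_of_norm_eq_algebraMap hQs hQ hΩG hGI hd hxE.1 hs] at hO hOD
  refine hP.not_equation_of_quadratic hn ?_ ?_ hO hOD (ncard_eq_add_one
    (orbit_subset_nonsingPoints hQs hGI hε hxE) (MulAction.mem_orbit_self x)) hr
  · refine Int.prime_three.dvd_of_dvd_pow (n := 2) ?_
    rw [hT2]
    exact dvd_pow_self _ (mul_ne_zero (by lia) (by lia))
  · rw [hT2]
    exact fun h => by have := Int.pow_right_injective (a := 3) (by norm_num) h; lia

end Fields

/-! ### Spaces of dimension one over the extension field -/

section Quintic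

variable {K : Type*} [Field K] [Algebra (ZMod 3) K] [Finite K]

lemma trace_pow_four_of_pow_eleven_eq_one {z : K} (hz : z ^ 11 = 1) :
    Algebra.trace (ZMod 3) K (z ^ 4) = Algebra.trace (ZMod 3) K z := by
  have hpow : z ^ 4 = (((z ^ 3) ^ 3) ^ 3) ^ 3 := by
    linear_combination (-(1 : K) - z ^ 11 - z ^ 22 - z ^ 33 - z ^ 44 - z ^ 55 - z ^ 66) * z ^ 4 * hz
  rw [hpow, trace_cube, trace_cube, trace_cube, trace_cube]

variable (hK : Module.finrank (ZMod 3) K = 5)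

include hK

lemma natCard_quintic : Nat.card K = 243 := by
  rw [Module.natCard_eq_pow_finrank (K := ZMod 3), Nat.card_zmod, hK]
  rfl

lemma trace_quintic (a : K) : algebraMap (ZMod 3) K (Algebra.trace (ZMod 3) K a) =
    a + a ^ 3 + a ^ 9 + a ^ 27 + a ^ 81 := by
  rw [FiniteField.algebraMap_trace_eq_sum_pow, hK, Nat.card_zmod]
  simp [Finset.sum_range_succ]

lemma trace_algebraMap_quintic (s : ZMod 3) :
    Algebra.trace (ZMod 3) K (algebraMap (ZMod 3) K s) = -s := by
  rw [Algebra.trace_algebraMap, hK, nsmul_eq_mul, show ((5 : ℕ) : ZMod 3) = -1 from rfl,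
    neg_one_mul]

lemma exists_pow_eleven_eq_one : ∃ z : K, z ^ 11 = 1 ∧ z ≠ 1 := by
  have : Fact (Nat.Prime 11) := ⟨by norm_num⟩
  obtain ⟨z, hz⟩ := exists_prime_orderOf_dvd_card' (G := Kˣ) 11 <| by
    rw [Nat.card_units, natCard_quintic hK]
    norm_num
  refine ⟨z, by rw [← Units.val_pow_eq_pow_val, ← hz, pow_orderOf_eq_one, Units.val_one], ?_⟩
  rw [Ne, Units.val_eq_one]
  rintro rfl
  rw [orderOf_one] at hz
  lia

-- The traces of `z` and `z ^ 2` are the two Gaussian periods of order five.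
lemma trace_add_and_mul_trace_sq_of_pow_eleven_eq_one {z : K} (hz : z ^ 11 = 1) (hne : z ≠ 1) :
    Algebra.trace (ZMod 3) K z + Algebra.trace (ZMod 3) K (z ^ 2) = -1 ∧
      Algebra.trace (ZMod 3) K z * Algebra.trace (ZMod 3) K (z ^ 2) = 0 := by
  have hsum : 1 + z + z ^ 2 + z ^ 3 + z ^ 4 + z ^ 5 + z ^ 6 + z ^ 7 + z ^ 8 + z ^ 9 + z ^ 10 = 0 :=
    mul_left_cancel₀ (sub_ne_zero.2 hne) (by linear_combination hz)
  have hred (i : ℕ) : z ^ (i + 11) = z ^ i := by rw [pow_add, hz, mul_one]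
  have htr : algebraMap (ZMod 3) K (Algebra.trace (ZMod 3) K z) =
      z + z ^ 3 + z ^ 9 + z ^ 5 + z ^ 4 := by
    rw [trace_quintic hK]
    simp only [hred]
  have htr_sq : algebraMap (ZMod 3) K (Algebra.trace (ZMod 3) K (z ^ 2)) =
      z ^ 2 + z ^ 6 + z ^ 7 + z ^ 10 + z ^ 8 := by
    rw [trace_quintic hK]
    simp only [← pow_mul, Nat.reduceMul]
    simp only [hred]
  constructor <;> apply (algebraMap (ZMod 3) K).injective
  · rw [map_add, htr, htr_sq, map_neg, map_one]
    linear_combination hsum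
  · rw [map_mul, htr, htr_sq, map_zero]
    linear_combination (5 + 2 * z + 2 * z ^ 2 + z ^ 3 + 2 * z ^ 4 + z ^ 5 + z ^ 6 + z ^ 8) * hz +
      2 * hsum + three_eq_zero_of_algebra K

lemma exists_trace_pow_eq_of_quintic :
    ∃ z : K, Algebra.trace (ZMod 3) K z = 0 ∧ Algebra.trace (ZMod 3) K (z ^ 2) = -1 ∧
      Algebra.trace (ZMod 3) K (z ^ 4) = 0 := by
  obtain ⟨z, hz, hne⟩ := exists_pow_eleven_eq_one hK
  have hz_sq : (z ^ 2) ^ 11 = 1 := by rw [pow_right_comm, hz, one_pow]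
  obtain ⟨hadd, hmul⟩ := trace_add_and_mul_trace_sq_of_pow_eleven_eq_one hK hz hne
  rcases mul_eq_zero.1 hmul with h | h
  · exact ⟨z, h, by simpa [h] using hadd, by rw [trace_pow_four_of_pow_eleven_eq_one hz, h]⟩
  · refine ⟨z ^ 2, h, ?_, by rw [trace_pow_four_of_pow_eleven_eq_one hz_sq, h]⟩
    rw [← pow_mul, trace_pow_four_of_pow_eleven_eq_one hz]
    simpa [h] using hadd

lemma exists_trace_eq_and_trace_sq_ne_zero {ε δ : ZMod 3} (hε : ε ≠ 0) (hδ : δ ≠ 0) : ∃ c : K,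
    Algebra.trace (ZMod 3) K (algebraMap (ZMod 3) K δ * c ^ 2) = ε ∧
      Algebra.trace (ZMod 3) K ((algebraMap (ZMod 3) K δ * c ^ 2) ^ 2) ≠ 0 := by
  have hone : Algebra.trace (ZMod 3) K (1 : K) = -1 := by
    rw [← map_one (algebraMap (ZMod 3) K), trace_algebraMap_quintic hK]
  simp only [mul_pow, ← pow_mul, ← map_pow, trace_algebraMap_mul]
  rcases (by decide : ∀ ε δ : ZMod 3, ε ≠ 0 → δ ≠ 0 → δ = -ε ∨ δ = ε) ε δ hε hδ with rfl | rfl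
  · refine ⟨1, ?_, ?_⟩
    · rw [one_pow, hone, neg_mul_neg, mul_one]
    · rw [one_pow, hone]
      exact mul_ne_zero (pow_ne_zero 2 hδ) (by decide)
  · obtain ⟨z, hz, hz2, hz4⟩ := exists_trace_pow_eq_of_quintic hK
    refine ⟨1 + z, ?_, ?_⟩
    · rw [show (1 + z) ^ 2 = 1 + z + z + z ^ 2 by ring, map_add, map_add, map_add, hz, hz2, hone]
      exact (by decide : ∀ δ : ZMod 3, δ * (-1 + 0 + 0 + -1) = δ) δ
    · rw [show (1 + z) ^ (2 * 2) = 1 + z + z ^ 3 + z ^ 4 by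
          linear_combination (z + 2 * z ^ 2 + z ^ 3) * three_eq_zero_of_algebra K,
        map_add, map_add, map_add, trace_cube, hz, hz4, hone]
      exact mul_ne_zero (pow_ne_zero 2 hδ) (by decide)

end Quintic

section OneDimensional

lemma eq_or_eq_neg_of_norm_eq {K V : Type*} [Field K] [AddCommGroup V] [Module K V]
    {Qs : QuadraticForm K V} (hd : Module.finrank K V = 1) {v w : V} (h : Qs v = Qs w)
    (hv : Qs v ≠ 0) : v = w ∨ v = -w := by
  have hv0 : v ≠ 0 := by
    rintro rfl
    exact hv (QuadraticMap.map_zero _)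
  obtain ⟨b, rfl⟩ := (finrank_eq_one_iff_of_nonzero' v hv0).1 hd w
  rw [QuadraticMap.map_smul, smul_eq_mul] at h
  rcases mul_self_eq_one_iff.1 ((mul_eq_right₀ hv).1 h.symm) with rfl | rfl
  · exact .inl (one_smul K v).symm
  · exact .inr (by rw [neg_smul, one_smul, neg_neg])

lemma exists_pow_eq_of_ringEquiv {K : Type*} [Field K] [Algebra (ZMod 3) K] [Finite K]
    (σ : K ≃+* K) : ∃ i < Module.finrank (ZMod 3) K, ∀ a, σ a = a ^ 3 ^ i := by
  let σ' : K ≃ₐ[ZMod 3] K := AlgEquiv.ofRingEquiv (f := σ) fun r =>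
    RingHom.congr_fun (Subsingleton.elim ((σ : K →+* K).comp (algebraMap (ZMod 3) K))
      (algebraMap (ZMod 3) K)) r
  obtain ⟨i, hi⟩ := (FiniteField.bijective_frobeniusAlgEquivOfAlgebraic_pow (ZMod 3) K).2 σ'
  refine ⟨i, i.2, fun a => ?_⟩
  change σ' a = _
  simp [← hi, AlgEquiv.coe_pow, FiniteField.coe_frobeniusAlgEquivOfAlgebraic_iterate]

variable {V : Type*} [AddCommGroup V] [Module (ZMod 3) V] {K : Type*} [Field K] [Module K V]
  {Qs : QuadraticForm K V}

lemma exists_norm_eq_algebraMap_of_quintic [Algebra (ZMod 3) K] [Finite K] [Nontrivial V]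
    (hK : Module.finrank (ZMod 3) K = 5) {Q : QuadraticForm (ZMod 3) V}
    (hQs : ∀ v, Q v = Algebra.trace (ZMod 3) K (Qs v)) (hQ : Q.polarBilin.Nondegenerate) :
    ∃ v : V, ∃ δ : ZMod 3, δ ≠ 0 ∧ Qs v = algebraMap (ZMod 3) K δ := by
  obtain ⟨u, hu⟩ := exists_map_ne_zero hQ
  have hu0 := norm_ne_zero_of_map_ne_zero hQs hu
  have hpow : Qs u ^ 243 = Qs u := by
    have := Fintype.ofFinite K
    rw [← natCard_quintic hK, Nat.card_eq_fintype_card, FiniteField.pow_card]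
  have hcube : (Qs u ^ 121) ^ 3 = Qs u ^ 121 := by linear_combination Qs u ^ 120 * hpow
  obtain ⟨δ, hδ⟩ := exists_algebraMap_eq_of_cube_eq hcube
  refine ⟨Qs u ^ 60 • u, δ, ?_, ?_⟩
  · rintro rfl
    exact pow_ne_zero 121 hu0 (hδ.symm.trans (map_zero _))
  · rw [QuadraticMap.map_smul, smul_eq_mul, hδ]
    ring

variable (hd : Module.finrank K V = 1)

include hd

lemma point_eq_of_norm_eq {x y : ℙ (ZMod 3) V} (h : Qs x.rep = Qs y.rep) (hx : Qs x.rep ≠ 0) :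
    x = y := by
  rw [← y.mk_rep, eq_mk_iff]
  exact eq_or_eq_neg_of_norm_eq hd h hx

variable [Algebra (ZMod 3) K] {Q : QuadraticForm (ZMod 3) V} {ξ : ℤˣ} {ε : ZMod 3}
  (hQs : ∀ v, Q v = Algebra.trace (ZMod 3) K (Qs v))

include hQs

lemma notMem_Delta_of_norm_eq_cube (hε : IsPointNorm Q ξ ε) {x y : ℙ (ZMod 3) V}
    (hx : Algebra.trace (ZMod 3) K (Qs x.rep ^ 2) ≠ 0) (h : Qs y.rep = Qs x.rep ^ 3) :
    y ∉ Delta Q ξ x := by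
  rw [Delta_eq hε, Set.mem_ofPred_eq, polar_eq_trace hQs]
  rintro ⟨hpolar, -⟩
  have hx0 : Qs x.rep ≠ 0 := pow_ne_zero_iff two_ne_zero |>.1 (ne_zero_of_trace_ne_zero hx)
  have hrep : Qs y.rep = Qs (Qs x.rep • x.rep) := by
    rw [h, QuadraticMap.map_smul, smul_eq_mul]
    ring
  have htr : Algebra.trace (ZMod 3) K (QuadraticMap.polar Qs x.rep (Qs x.rep • x.rep)) ≠ 0 := by
    rw [QuadraticMap.polar_smul_right, polar_self_eq_two_mul, smul_eq_mul, mul_left_comm, ← sq,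
      ← map_ofNat (algebraMap (ZMod 3) K) 2, trace_algebraMap_mul]
    exact mul_ne_zero two_ne_zero_zmod_three hx
  rcases eq_or_eq_neg_of_norm_eq hd hrep (h ▸ pow_ne_zero 3 hx0) with hy | hy
  · exact htr (hy ▸ hpolar)
  · rw [hy, QuadraticMap.polar_neg_right, map_neg, neg_eq_zero] at hpolar
    exact htr hpolar

variable {G : Subgroup (V ≃ₗ[ZMod 3] V)} (hGI : G ≤ isometryGroup Q) [Finite K]

include hGI

-- The norms of the points of the orbit of `x` are the conjugates `Qs x ^ 3 ^ i` of the norm of `x`,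
-- and in dimension one a point is determined by its norm.
lemma ncard_le_card_of_subset_orbit {x : ℙ (ZMod 3) V} (hx : Qs x.rep ≠ 0)
    {S : Set (ℙ (ZMod 3) V)} (hS : S ⊆ MulAction.orbit (fieldExtSubgroup K G) x) (I : Finset ℕ)
    (hI : ∀ i < Module.finrank (ZMod 3) K, i ∉ I → ∀ y ∈ S, Qs y.rep ≠ Qs x.rep ^ 3 ^ i) :
    S.ncard ≤ I.card := by
  have hnorm (y) (hy : y ∈ S) : ∃ i ∈ I, Qs y.rep = Qs x.rep ^ 3 ^ i := by
    obtain ⟨σ, hσ⟩ := exists_norm_eq_of_mem_orbit hQs hGI (hS hy)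
    obtain ⟨i, hi, hpow⟩ := exists_pow_eq_of_ringEquiv σ
    rw [hpow] at hσ
    exact ⟨i, by_contra fun hiI => hI i hi hiI y hy hσ, hσ⟩
  choose! f hfI hf using hnorm
  rw [← Set.ncard_coe_finset I]
  refine Set.ncard_le_ncard_of_injOn f hfI (fun y hy z hz hyz => ?_) I.finite_toSet
  exact point_eq_of_norm_eq hd (by rw [hf y hy, hf z hz, hyz]) (hf y hy ▸ pow_ne_zero _ hx)

variable (hQ : Q.polarBilin.Nondegenerate) (hε : IsPointNorm Q ξ ε)

include hQ hε

lemma exists_ncard_orbit_inter_Delta_le (hK : Module.finrank (ZMod 3) K = 5) :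
    ∃ x ∈ nonsingPoints Q ξ,
      (MulAction.orbit (fieldExtSubgroup K G) x ∩ Delta Q ξ x).ncard ≤ 3 := by
  have : Nontrivial V := Module.nontrivial_of_finrank_pos (R := K) (by lia)
  obtain ⟨v, δ, hδ, hv⟩ := exists_norm_eq_algebraMap_of_quintic hK hQs hQ
  obtain ⟨c, hc, hc2⟩ := exists_trace_eq_and_trace_sq_ne_zero hK hε.ne_zero hδ
  have hcv : Qs (c • v) = algebraMap (ZMod 3) K δ * c ^ 2 := by
    rw [QuadraticMap.map_smul, smul_eq_mul, hv]
    ring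
  obtain ⟨x, hx⟩ := exists_rep_norm_eq
    (hcv.trans_ne (ne_zero_of_trace_ne_zero (hc.trans_ne hε.ne_zero)))
  rw [hcv] at hx
  rw [← hx] at hc hc2
  have hxE : x ∈ nonsingPoints Q ξ := by rw [hε.mem_iff, hQs, hc]
  have hx0 := norm_ne_zero_of_map_ne_zero hQs hxE.1
  refine ⟨x, hxE, ?_⟩
  refine (ncard_le_card_of_subset_orbit hd hQs hGI hx0 Set.inter_subset_left {2, 3, 4} ?_).trans
    Finset.card_le_three
  rintro i hi hiI y ⟨-, hy⟩ h
  simp only [Finset.mem_insert, Finset.mem_singleton] at hiI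
  obtain rfl | rfl : i = 0 ∨ i = 1 := by lia
  · rw [pow_zero, pow_one] at h
    exact notMem_Delta_self hxE (point_eq_of_norm_eq hd h (h ▸ hx0) ▸ hy)
  · exact notMem_Delta_of_norm_eq_cube hd hQs hε hc2 h hy

theorem exists_not_orbitEquation_of_one_dim [Finite V] {n k l mu : ℕ}
    (hm : Module.finrank (ZMod 3) K = 2 * (n + 1) + 1) (hn : 1 ≤ n)
    (hne : (nonsingPoints Q ξ).Nonempty) (hP : PointParams n ξ k l mu) :
    ∃ x ∈ nonsingPoints Q ξ, ∀ r : ℝ, (r = eigS k mu mu ∨ r = eigT k mu mu) →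
      ¬ OrbitEquation (M := fieldExtSubgroup K G) (Delta Q ξ) (Gamma Q ξ) k l r x := by
  obtain ⟨x, hx, hxd⟩ : ∃ x ∈ nonsingPoints Q ξ, n = 1 →
      (MulAction.orbit (fieldExtSubgroup K G) x ∩ Delta Q ξ x).ncard ≤ 3 := by
    rcases eq_or_ne n 1 with rfl | h
    · obtain ⟨x, hx, hle⟩ := exists_ncard_orbit_inter_Delta_le hd hQs hGI hQ hε (by rw [hm])
      exact ⟨x, hx, fun _ => hle⟩
    · obtain ⟨x, hx⟩ := hne
      exact ⟨x, hx, fun h' => absurd h' h⟩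
  refine ⟨x, hx, fun r hr => hP.not_equation_of_small hn ?_ hxd hr⟩
  have hpart := ncard_eq_add_one (orbit_subset_nonsingPoints hQs hGI hε hx)
    (MulAction.mem_orbit_self (M := fieldExtSubgroup K G) x)
  have hle := ncard_le_card_of_subset_orbit hd hQs hGI (norm_ne_zero_of_map_ne_zero hQs hx.1)
    subset_rfl (Finset.range (Module.finrank (ZMod 3) K))
    (fun i hi h => absurd (Finset.mem_range.2 hi) h)
  rw [Finset.card_range, hm] at hle
  lia

end OneDimensional

/-! ### Permutation characters and strongly regular graphs -/

section Characters

variable {𝕜 G E : Type*} [CommRing 𝕜] [Group G] [AddCommGroup E] [Module 𝕜 E]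
  (σ : Representation 𝕜 G E)

lemma apply_out_smul {P : Subgroup G} {u : E} (hu : ∀ p ∈ P, σ p u = u) (g : G) (h : G ⧸ P) :
    σ (g • h).out u = σ g (σ h.out u) := by
  have hcoset : (((g • h).out : G) : G ⧸ P) = ((g * h.out : G) : G ⧸ P) := by
    rw [QuotientGroup.out_eq', ← smul_eq_mul, ← MulAction.Quotient.smul_coe,
      QuotientGroup.out_eq']
  have hfix := congrArg (σ (g • h).out) (hu _ (QuotientGroup.eq.1 hcoset))
  rw [← Module.End.mul_apply, ← map_mul, mul_inv_cancel_left, map_mul, Module.End.mul_apply] at hfix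
  exact hfix.symm

lemma exists_intertwiningMap_ne_zero {P : Subgroup G} {u : E} (hu : ∀ p ∈ P, σ p u = u)
    (hu0 : u ≠ 0) :
    ∃ φ : Representation.IntertwiningMap (Representation.ofMulAction 𝕜 G (G ⧸ P)) σ, φ ≠ 0 := by
  let f : MonoidAlgebra 𝕜 (G ⧸ P) →ₗ[𝕜] E :=
    (Finsupp.linearCombination 𝕜 fun h : G ⧸ P => σ h.out u) ∘ₗ
      (MonoidAlgebra.coeffLinearEquiv 𝕜).toLinearMap
  have hf (h : G ⧸ P) (r : 𝕜) : f (MonoidAlgebra.single h r) = r • σ h.out u := by simp [f]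
  let φ : Representation.IntertwiningMap (Representation.ofMulAction 𝕜 G (G ⧸ P)) σ :=
    { f with
      isIntertwining' := fun g => by
        ext h
        simp [hf, apply_out_smul σ hu, Representation.ofMulAction_single] }
  refine ⟨φ, fun hφ => hu0 ?_⟩
  have hzero : σ ((1 : G) : G ⧸ P).out u = 0 := by
    rw [← one_smul 𝕜 (σ _ u), ← hf]
    exact DFunLike.congr_fun hφ (MonoidAlgebra.single ((1 : G) : G ⧸ P) 1)
  rw [← σ.inv_self_apply ((1 : G) : G ⧸ P).out u, hzero, map_zero]

lemma intertwiningMap_eq_zero {M : Subgroup G} (hM : ∀ v, (∀ m ∈ M, σ m v = v) → v = 0)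
    (φ : Representation.IntertwiningMap (Representation.ofMulAction 𝕜 G (G ⧸ M)) σ) : φ = 0 := by
  have hsingle (g : G) : Representation.ofMulAction 𝕜 G (G ⧸ M) g
      (MonoidAlgebra.single ((1 : G) : G ⧸ M) 1) = MonoidAlgebra.single (g : G ⧸ M) 1 := by
    rw [Representation.ofMulAction_single, MulAction.Quotient.smul_coe, smul_eq_mul, mul_one]
  have hzero : φ (MonoidAlgebra.single ((1 : G) : G ⧸ M) 1) = 0 := by
    refine hM _ fun m hm => ?_
    rw [← φ.isIntertwining, hsingle, QuotientGroup.eq.2 (show m⁻¹ * 1 ∈ M by simpa using hm)]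
  apply Representation.IntertwiningMap.ext
  ext h
  obtain ⟨g, rfl⟩ := QuotientGroup.mk_surjective h
  have hφ := Representation.IntertwiningMap.isIntertwining _ _ φ g
    (MonoidAlgebra.single ((1 : G) : G ⧸ M) 1)
  rw [hzero, map_zero, hsingle] at hφ
  exact hφ

-- By Frobenius reciprocity, `σ` has a constituent in common with `1_P^G` but none with `1_M^G`.
theorem not_charLE_of_invariants [Finite G] {P M : Subgroup G} [Module ℂ E] [FiniteDimensional ℂ E]
    (σ : Representation ℂ G E) (hM : ∀ v, (∀ m ∈ M, σ m v = v) → v = 0) {u : E}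
    (hu : ∀ p ∈ P, σ p u = u) (hu0 : u ≠ 0) : ¬ CharLE (permChar P) (permChar M) := by
  rintro ⟨n, ρ, hρ⟩
  have := Fintype.ofFinite G
  have : Invertible (Nat.card G : ℂ) := invertibleOfNonzero (by exact_mod_cast Nat.card_pos.ne')
  have hMz : Module.finrank ℂ
      (Representation.IntertwiningMap (Representation.ofMulAction ℂ G (G ⧸ M)) σ) = 0 :=
    have := subsingleton_of_forall_eq 0 (intertwiningMap_eq_zero σ hM)
    Module.finrank_zero_of_subsingleton
  have hPpos : 0 < Module.finrank ℂ
      (Representation.IntertwiningMap (Representation.ofMulAction ℂ G (G ⧸ P)) σ) := by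
    obtain ⟨φ, hφ⟩ := exists_intertwiningMap_ne_zero σ hu hu0
    have : Nontrivial (Representation.IntertwiningMap
      (Representation.ofMulAction ℂ G (G ⧸ P)) σ) := ⟨φ, 0, hφ⟩
    exact Module.finrank_pos
  have hchar (g : G) : (Representation.ofMulAction ℂ G (G ⧸ M)).character g =
      (Representation.ofMulAction ℂ G (G ⧸ P)).character g + ρ.character g :=
    sub_eq_iff_eq_add'.1 (congrFun hρ g)
  have hsum := Representation.card_inv_mul_sum_char_mul_char_eq_finrank
    (Representation.ofMulAction ℂ G (G ⧸ M)) σ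
  simp only [hchar, mul_add, Finset.sum_add_distrib, hMz,
    Representation.card_inv_mul_sum_char_mul_char_eq_finrank] at hsum
  norm_cast at hsum
  lia

end Characters

section InvariantMatrix

open Matrix
open scoped ComplexOrder

variable {X G : Type*} [Group G] [MulAction G X]

variable (G X) in
/-- The permutation representation of `G` on the complex functions on `X`. -/
def functionRep : Representation ℂ G (X → ℂ) where
  toFun g := LinearMap.funLeft ℂ ℂ (g⁻¹ • ·)
  map_one' := by ext f x; simp [LinearMap.funLeft_apply]
  map_mul' g g' := by ext f x; simp [LinearMap.funLeft_apply, mul_smul]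

variable [Fintype X] {A : Matrix X X ℂ}

lemma mulVec_functionRep (hA : ∀ (g : G) x y, A (g • x) (g • y) = A x y) (g : G) (f : X → ℂ) :
    A *ᵥ functionRep X G g f = functionRep X G g (A *ᵥ f) := by
  ext x
  refine Fintype.sum_equiv (MulAction.toPerm g⁻¹) _ _ fun y => ?_
  change A x y * f (g⁻¹ • y) = A (g⁻¹ • x) (g⁻¹ • y) * f (g⁻¹ • y)
  rw [hA]

/-- The eigenspace of an invariant matrix, as a subrepresentation of the functions on `X`. -/
def eigenRep (hA : ∀ (g : G) x y, A (g • x) (g • y) = A x y) (c : ℂ) :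
    Subrepresentation (functionRep X G) where
  toSubmodule := Module.End.eigenspace A.mulVecLin c
  apply_mem_toSubmodule g f hf := by
    rw [Module.End.mem_eigenspace_iff, Matrix.mulVecLin_apply] at hf ⊢
    rw [mulVec_functionRep hA, hf, map_smul]

lemma mulVec_indicator_eq_zero {c : ℂ} (hA : A.IsHermitian) (hAA : A * A = c • A) {O : Set X}
    (hO : ∀ x ∈ O, (A *ᵥ O.indicator 1) x = 0) : A *ᵥ O.indicator 1 = 0 := by
  rw [← dotProduct_star_self_eq_zero, star_mulVec, ← dotProduct_mulVec, hA.eq, mulVec_mulVec, hAA,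
    smul_mulVec, dotProduct_smul]
  refine smul_eq_zero_of_right c (Finset.sum_eq_zero fun x _ => ?_)
  by_cases hx : x ∈ O
  · rw [hO x hx, mul_zero]
  · simp [hx]

lemma eq_zero_of_mulVec_indicator_eq_zero {c : ℂ} (hA : A.IsHermitian) (hc : c ≠ 0) {f : X → ℂ}
    (hf : A *ᵥ f = c • f) {O : Set X} (hO : A *ᵥ O.indicator 1 = 0) {x : X} (hx : x ∈ O)
    (hfO : ∀ y ∈ O, f y = f x) : f x = 0 := by
  classical
  have hsum : star (O.indicator 1) ⬝ᵥ f = O.ncard * f x := by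
    have hterm (y : X) : star (O.indicator 1) y * f y = if y ∈ O then f x else 0 := by
      by_cases hy : y ∈ O
      · simp [hy, hfO y hy]
      · simp [hy]
    simp only [dotProduct, hterm, ← Finset.sum_filter, Finset.sum_const, nsmul_eq_mul,
      Set.ncard_eq_toFinset_card', Set.toFinset, Set.filter_mem_univ_eq_toFinset]
  have horth : c * (star (O.indicator 1) ⬝ᵥ f) = 0 := by
    rw [← smul_eq_mul, ← dotProduct_smul, ← hf, dotProduct_mulVec, ← hA.eq, ← star_mulVec, hO,
      star_zero, zero_dotProduct]
  have hcard : (O.ncard : ℂ) ≠ 0 := by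
    exact_mod_cast ((Set.ncard_pos (Set.toFinite O)).2 ⟨x, hx⟩).ne'
  rw [hsum] at horth
  exact (mul_eq_zero.1 ((mul_eq_zero.1 horth).resolve_left hc)).resolve_left hcard

theorem not_charLE_of_isHermitian [Finite G] {c : ℂ} (hA : A.IsHermitian) (hAA : A * A = c • A)
    (hc : c ≠ 0) (hAG : ∀ (g : G) x y, A (g • x) (g • y) = A x y) {M : Subgroup G}
    (hM : ∀ x, (A *ᵥ (MulAction.orbit M x).indicator 1) x = 0) {x : X} (hx : A x x ≠ 0) :
    ¬ CharLE (permChar (MulAction.stabilizer G x)) (permChar M) := by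
  classical
  have hcol : A *ᵥ A.col x = c • A.col x := by
    rw [← mulVec_single_one, mulVec_mulVec, hAA, smul_mulVec]
  refine not_charLE_of_invariants (eigenRep hAG c).toRepresentation ?_
    (u := ⟨A.col x, Module.End.mem_eigenspace_iff.2 hcol⟩) ?_ ?_
  · rintro ⟨f, hf⟩ hfM
    ext y
    have hconst : ∀ z ∈ MulAction.orbit M y, f z = f y := by
      rintro _ ⟨m, rfl⟩
      have hfix := congrFun (congrArg Subtype.val (hfM m m.2)) (m • y)
      exact hfix.symm.trans (congrArg f (inv_smul_smul (m : G) y))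
    refine eq_zero_of_mulVec_indicator_eq_zero hA hc (Module.End.mem_eigenspace_iff.1 hf)
      (mulVec_indicator_eq_zero hA hAA fun z hz => ?_) (MulAction.mem_orbit_self y) hconst
    rw [← MulAction.orbit_eq_iff.2 hz, hM]
  · intro p hp
    ext y
    change A (p⁻¹ • y) x = A y x
    rw [← hAG p, smul_inv_smul, hp]
  · intro hzero
    exact hx (congrFun (congrArg Subtype.val hzero) x)

end InvariantMatrix

section StronglyRegular

open Matrix

variable {X : Type*} {Γ : SimpleGraph X} [DecidableRel Γ.Adj] {k l lam mu : ℕ}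

section

variable [DecidableEq X]

lemma adjMatrix_compl : Γᶜ.adjMatrix ℂ = of 1 - 1 - Γ.adjMatrix ℂ := by
  ext x y
  obtain rfl | hxy := eq_or_ne x y
  · simp
  · by_cases hadj : Γ.Adj x y <;> simp [hxy, hadj]

variable (Γ k l) in
/-- The multiple with diagonal entries `1` of the orthogonal projection to the eigenspace of `r` in
a strongly regular graph of valency `k`, whose complement has valency `l`. -/
def eigenMatrix (r : ℝ) : Matrix X X ℂ :=
  1 + (r / k : ℂ) • Γ.adjMatrix ℂ - ((r + 1) / l : ℂ) • Γᶜ.adjMatrix ℂ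

lemma isHermitian_eigenMatrix (r : ℝ) : (eigenMatrix Γ k l r).IsHermitian := by
  have hsmul (c : ℝ) (Γ' : SimpleGraph X) [DecidableRel Γ'.Adj] :
      ((c : ℂ) • Γ'.adjMatrix ℂ).IsHermitian := by
    ext x y
    by_cases hadj : Γ'.Adj x y
    · simp [hadj, hadj.symm]
    · simp [hadj, mt SimpleGraph.Adj.symm hadj]
  have hsum := (isHermitian_one.add (hsmul (r / k) Γ)).sub (hsmul ((r + 1) / l) Γᶜ)
  push_cast at hsum
  exact hsum

end

variable [Fintype X]

lemma allOnes_mul_adjMatrix (h : Γ.IsRegularOfDegree k) :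
    (of 1 : Matrix X X ℂ) * Γ.adjMatrix ℂ = (k : ℂ) • of 1 := by
  ext x y
  simp [h.degree_eq]

lemma adjMatrix_mul_allOnes (h : Γ.IsRegularOfDegree k) :
    Γ.adjMatrix ℂ * (of 1 : Matrix X X ℂ) = (k : ℂ) • of 1 := by
  ext x y
  simp [h.degree_eq]

lemma isRegularOfDegree_compl [DecidableEq X] (h : Γ.IsSRGWith (k + l + 1) k lam mu) :
    Γᶜ.IsRegularOfDegree l := by
  convert h.compl_is_regular using 1
  lia

lemma mul_self_eq_of_isSRGWith (h : Γ.IsSRGWith (k + l + 1) k lam mu) :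
    (k * k : ℂ) = k + lam * k + mu * l := by
  classical
  have : Nonempty X := Fintype.card_pos_iff.1 (by rw [h.card]; lia)
  have hsq := congrArg (fun A => (of 1 : Matrix X X ℂ) * A) (h.matrix_eq (α := ℂ))
  simp only [pow_two, mul_add, mul_smul_comm, ← Matrix.mul_assoc, smul_mul_assoc, mul_one,
    allOnes_mul_adjMatrix h.regular, allOnes_mul_adjMatrix (isRegularOfDegree_compl h)] at hsq
  obtain ⟨x⟩ := this
  simpa [mul_comm] using congrFun (congrFun hsq x) x

variable [DecidableEq X]

lemma adjMatrix_mul_adjMatrix_compl (h : Γ.IsSRGWith (k + l + 1) k lam mu) :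
    Γ.adjMatrix ℂ * Γᶜ.adjMatrix ℂ =
      (k - lam - 1 : ℂ) • Γ.adjMatrix ℂ + (k - mu : ℂ) • Γᶜ.adjMatrix ℂ := by
  have hsq := h.matrix_eq (α := ℂ)
  rw [pow_two] at hsq
  have hone : (of 1 : Matrix X X ℂ) = 1 + Γ.adjMatrix ℂ + Γᶜ.adjMatrix ℂ := by
    rw [adjMatrix_compl]; abel
  conv_lhs =>
    rw [adjMatrix_compl, mul_sub, mul_sub, adjMatrix_mul_allOnes h.regular, hsq, hone, mul_one]
  module

lemma adjMatrix_mul_eigenMatrix (h : Γ.IsSRGWith (k + l + 1) k lam mu) (hk : k ≠ 0) (hl : l ≠ 0)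
    {r : ℝ} (hr : r ^ 2 = (lam - mu) * r + (k - mu)) :
    Γ.adjMatrix ℂ * eigenMatrix Γ k l r = (r : ℂ) • eigenMatrix Γ k l r := by
  have hk : (k : ℂ) ≠ 0 := by exact_mod_cast hk
  have hl : (l : ℂ) ≠ 0 := by exact_mod_cast hl
  have hr : (r : ℂ) ^ 2 = (lam - mu) * r + (k - mu) := by exact_mod_cast hr
  have hkk := mul_self_eq_of_isSRGWith h
  have hsq := h.matrix_eq (α := ℂ)
  rw [pow_two] at hsq
  rw [eigenMatrix, mul_sub, mul_add, mul_one, mul_smul_comm, mul_smul_comm, hsq,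
    adjMatrix_mul_adjMatrix_compl h]
  match_scalars
  · field_simp
    linear_combination (-l : ℂ) * hr - (r + 1) * hkk
  · field_simp
  · field_simp
    linear_combination (k : ℂ) * hr - r * hkk

lemma allOnes_mul_eigenMatrix (h : Γ.IsSRGWith (k + l + 1) k lam mu) (hk : k ≠ 0) (hl : l ≠ 0)
    (r : ℝ) : (of 1 : Matrix X X ℂ) * eigenMatrix Γ k l r = 0 := by
  have hk : (k : ℂ) ≠ 0 := by exact_mod_cast hk
  have hl : (l : ℂ) ≠ 0 := by exact_mod_cast hl
  rw [eigenMatrix, mul_sub, mul_add, mul_one, mul_smul_comm, mul_smul_comm,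
    allOnes_mul_adjMatrix h.regular, allOnes_mul_adjMatrix (isRegularOfDegree_compl h), smul_smul,
    smul_smul, div_mul_cancel₀ _ hk, div_mul_cancel₀ _ hl]
  module

lemma eigenMatrix_mul_self (h : Γ.IsSRGWith (k + l + 1) k lam mu) (hk : k ≠ 0) (hl : l ≠ 0)
    {r : ℝ} (hr : r ^ 2 = (lam - mu) * r + (k - mu)) :
    eigenMatrix Γ k l r * eigenMatrix Γ k l r =
      ((1 + r ^ 2 / k + (r + 1) ^ 2 / l : ℝ) : ℂ) • eigenMatrix Γ k l r := by
  conv_lhs =>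
    enter [1]
    rw [eigenMatrix, adjMatrix_compl]
  rw [sub_mul, add_mul, one_mul, smul_mul_assoc, smul_mul_assoc, sub_mul, sub_mul, one_mul,
    adjMatrix_mul_eigenMatrix h hk hl hr, allOnes_mul_eigenMatrix h hk hl]
  push_cast
  module

lemma eigenMatrix_mulVec_indicator {O : Set X} {x : X} (hx : x ∈ O) (r : ℝ) :
    (eigenMatrix Γ k l r *ᵥ O.indicator 1) x =
      1 + (O ∩ Γ.neighborSet x).ncard * r / k - (r + 1) * (O ∩ Γᶜ.neighborSet x).ncard / l := by
  classical
  have hadj (Γ' : SimpleGraph X) [DecidableRel Γ'.Adj] :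
      (Γ'.adjMatrix ℂ *ᵥ O.indicator 1) x = (O ∩ Γ'.neighborSet x).ncard := by
    simp only [SimpleGraph.adjMatrix_mulVec_apply, Set.indicator_apply, Pi.one_apply,
      Finset.sum_boole, Set.ncard_eq_toFinset_card']
    congr 2
    ext y
    simp [and_comm]
  rw [eigenMatrix, sub_mulVec, add_mulVec, one_mulVec, smul_mulVec, smul_mulVec]
  simp only [Pi.sub_apply, Pi.add_apply, Pi.smul_apply, hadj, Set.indicator_of_mem hx, Pi.one_apply,
    smul_eq_mul]
  ring

omit [DecidableEq X] in
theorem not_charLE_of_orbitEquation {G : Type*} [Group G] [Finite G] [MulAction G X]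
    (h : Γ.IsSRGWith (k + l + 1) k lam mu) (hk : k ≠ 0) (hl : l ≠ 0) {r : ℝ}
    (hr : r ^ 2 = (lam - mu) * r + (k - mu))
    (hG : ∀ (g : G) x y, Γ.Adj (g • x) (g • y) ↔ Γ.Adj x y) {M : Subgroup G}
    (hM : ∀ x, OrbitEquation (M := M) Γ.neighborSet Γᶜ.neighborSet k l r x) (x : X) :
    ¬ CharLE (permChar (MulAction.stabilizer G x)) (permChar M) := by
  classical
  refine not_charLE_of_isHermitian (isHermitian_eigenMatrix r) (eigenMatrix_mul_self h hk hl hr)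
    ?_ ?_ (fun x => ?_) ?_
  · have hpos : 0 < 1 + r ^ 2 / k + (r + 1) ^ 2 / l := by positivity
    exact_mod_cast hpos.ne'
  · intro g x y
    simp [eigenMatrix, hG, Matrix.one_apply]
  · rw [eigenMatrix_mulVec_indicator (MulAction.mem_orbit_self x), sub_eq_zero]
    exact_mod_cast hM x
  · simp [eigenMatrix]

end StronglyRegular

/-! ### The graph of the points -/

section PointGraph

variable {V : Type*} [AddCommGroup V] [Module (ZMod 3) V] {Q : QuadraticForm (ZMod 3) V} {ξ : ℤˣ}
  {ε : ZMod 3} {G : Subgroup (V ≃ₗ[ZMod 3] V)} {k l lam mu : ℕ}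

lemma rep_smul (g : G) (x : ℙ (ZMod 3) V) : (g • x).rep = g.1 x.rep ∨ (g • x).rep = -g.1 x.rep := by
  have hgx : g • x = Projectivization.mk (ZMod 3) (g.1 x.rep) (by simpa using x.rep_nonzero) := by
    conv_lhs => rw [← x.mk_rep]
    rfl
  rw [hgx]
  exact rep_mk_eq_or_eq_neg _ _

lemma norm_rep_smul (hGI : G ≤ isometryGroup Q) (g : G) (x : ℙ (ZMod 3) V) :
    Q (g • x).rep = Q x.rep := by
  rcases rep_smul g x with hrep | hrep
  · rw [hrep, hGI g.2]
  · rw [hrep, QuadraticMap.map_neg, hGI g.2]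

lemma polar_rep_smul (hGI : G ≤ isometryGroup Q) (g : G) (x y : ℙ (ZMod 3) V) :
    QuadraticMap.polar Q (g • x).rep (g • y).rep = 0 ↔ QuadraticMap.polar Q x.rep y.rep = 0 := by
  rw [← polar_map (hGI g.2) x.rep y.rep]
  rcases rep_smul g x with hx | hx <;> rcases rep_smul g y with hy | hy <;> rw [hx, hy] <;>
    simp [QuadraticMap.polar_neg_left, QuadraticMap.polar_neg_right]

lemma smul_mem_nonsingPoints (hGI : G ≤ isometryGroup Q) (hε : IsPointNorm Q ξ ε) (g : G)
    {x : ℙ (ZMod 3) V} (hx : x ∈ nonsingPoints Q ξ) : g • x ∈ nonsingPoints Q ξ := by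
  rwa [hε.mem_iff, norm_rep_smul hGI, ← hε.mem_iff]

/-- The action of `G` on the points of type `ξ`. -/
abbrev nonsingPointsAction (hGI : G ≤ isometryGroup Q) (hε : IsPointNorm Q ξ ε) :
    MulAction G (nonsingPoints Q ξ) where
  smul g x := ⟨g • x.1, smul_mem_nonsingPoints hGI hε g x.2⟩
  one_smul x := Subtype.ext (one_smul G x.1)
  mul_smul g h x := Subtype.ext (mul_smul g h x.1)

/-- The rank three graph on the points of type `ξ`, in which adjacency is orthogonality. -/
def pointGraph (hε : IsPointNorm Q ξ ε) : SimpleGraph (nonsingPoints Q ξ) where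
  Adj x y := y.1 ∈ Delta Q ξ x.1
  symm := ⟨fun x y hxy => by
    rw [Delta_eq hε] at hxy ⊢
    exact ⟨by rw [QuadraticMap.polar_comm]; exact hxy.1, (hε.mem_iff x).1 x.2⟩⟩
  loopless := ⟨fun x => notMem_Delta_self x.2⟩

lemma neighborSet_compl_pointGraph (hε : IsPointNorm Q ξ ε) (x : nonsingPoints Q ξ) :
    (pointGraph hε)ᶜ.neighborSet x = Subtype.val ⁻¹' Gamma Q ξ x := by
  ext y
  simp [pointGraph, Delta, Gamma, Subtype.ext_iff, eq_comm]

lemma isSRGWith_pointGraph [Fintype (nonsingPoints Q ξ)] [Finite V] (hε : IsPointNorm Q ξ ε)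
    [DecidableRel (pointGraph hε).Adj] (hne : (nonsingPoints Q ξ).Nonempty)
    (hH : IsHigmanParams (nonsingPoints Q ξ) (Delta Q ξ) (Gamma Q ξ) k l lam mu) :
    (pointGraph hε).IsSRGWith (k + l + 1) k lam mu := by
  have hcard {A : Set (ℙ (ZMod 3) V)} (hA : A ⊆ nonsingPoints Q ξ) :
      (Subtype.val ⁻¹' A : Set (nonsingPoints Q ξ)).ncard = A.ncard :=
    Set.ncard_preimage_of_injective_subset_range Subtype.val_injective (by simpa using hA)
  have hΔ (x : ℙ (ZMod 3) V) : Delta Q ξ x ⊆ nonsingPoints Q ξ := fun _ hy => hy.1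
  have hΓ (x : ℙ (ZMod 3) V) : Gamma Q ξ x ⊆ nonsingPoints Q ξ := fun _ hy => hy.1
  have hcommon (x y : nonsingPoints Q ξ) :
      Fintype.card ((pointGraph hε).commonNeighbors x y) = (Delta Q ξ x ∩ Delta Q ξ y).ncard := by
    rw [← Nat.card_eq_fintype_card, Nat.card_coe_set_eq,
      ← hcard (Set.inter_subset_left.trans (hΔ x))]
    rfl
  refine ⟨?_, fun x => ?_, fun x y hxy => ?_, fun x y hne hxy => ?_⟩
  · obtain ⟨x, hx⟩ := hne
    rw [← Nat.card_eq_fintype_card, Nat.card_coe_set_eq, ncard_eq_add_one subset_rfl hx,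
      Set.inter_eq_right.2 (hΔ x), Set.inter_eq_right.2 (hΓ x), hH.card_Delta x hx,
      hH.card_Gamma x hx]
  · rw [← SimpleGraph.card_neighborSet_eq_degree, ← Nat.card_eq_fintype_card, Nat.card_coe_set_eq,
      ← hH.card_Delta x x.2, ← hcard (hΔ x)]
    rfl
  · rw [hcommon, hH.card_inter_of_mem_Delta x x.2 y hxy]
  · have hy : y.1 ∈ Gamma Q ξ x := by
      rw [← Set.mem_preimage, ← neighborSet_compl_pointGraph hε]
      exact ⟨hne, hxy⟩
    rw [hcommon, hH.card_inter_of_mem_Gamma x x.2 y hy]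

theorem not_charLE_of_forall_orbitEquation [Finite V] (hGI : G ≤ isometryGroup Q)
    (hε : IsPointNorm Q ξ ε)
    (hH : IsHigmanParams (nonsingPoints Q ξ) (Delta Q ξ) (Gamma Q ξ) k l lam mu) (hk : k ≠ 0)
    (hl : l ≠ 0) {r : ℝ} (hr : r ^ 2 = (lam - mu) * r + (k - mu)) {M : Subgroup G}
    (hM : ∀ x ∈ nonsingPoints Q ξ, OrbitEquation (M := M) (Delta Q ξ) (Gamma Q ξ) k l r x)
    {x : ℙ (ZMod 3) V} (hx : x ∈ nonsingPoints Q ξ) :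
    ¬ CharLE (permChar (MulAction.stabilizer G x)) (permChar M) := by
  classical
  let := nonsingPointsAction hGI hε
  have := Fintype.ofFinite (nonsingPoints Q ξ)
  have : Finite (V ≃ₗ[ZMod 3] V) := DFunLike.finite _
  have hstab : MulAction.stabilizer G x =
      MulAction.stabilizer G (⟨x, hx⟩ : nonsingPoints Q ξ) := by
    ext g
    rw [MulAction.mem_stabilizer_iff, MulAction.mem_stabilizer_iff, Subtype.ext_iff]
    rfl
  have horbit (y : nonsingPoints Q ξ) (A : Set (ℙ (ZMod 3) V)) :
      (MulAction.orbit M y ∩ Subtype.val ⁻¹' A).ncard = (MulAction.orbit M y.1 ∩ A).ncard := by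
    have himage : MulAction.orbit M y.1 = Subtype.val '' MulAction.orbit M y :=
      Set.range_comp Subtype.val fun g : M => g • y
    rw [himage, ← Set.image_inter_preimage, Set.ncard_image_of_injective _ Subtype.val_injective]
  rw [hstab]
  refine not_charLE_of_orbitEquation (isSRGWith_pointGraph hε ⟨x, hx⟩ hH) hk hl hr
    (fun g y z => ?_) (fun y => ?_) _
  · change g • z.1 ∈ Delta Q ξ (g • y.1) ↔ z.1 ∈ Delta Q ξ y.1
    simp only [Delta_eq hε, Set.mem_ofPred_eq, polar_rep_smul hGI, norm_rep_smul hGI]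
  · have hneighbor : (pointGraph hε).neighborSet y = Subtype.val ⁻¹' Delta Q ξ y := rfl
    rw [OrbitEquation, hneighbor, neighborSet_compl_pointGraph, horbit, horbit]
    exact hM y y.2

end PointGraph

section FieldExtension

variable {K V : Type*} [Field K] [Algebra (ZMod 3) K] [AddCommGroup V] [Module (ZMod 3) V]
  [Module K V] [IsScalarTower (ZMod 3) K V] [Finite V] {Q : QuadraticForm (ZMod 3) V}
  {Qs : QuadraticForm K V} {G : Subgroup (V ≃ₗ[ZMod 3] V)} {ξ : ℤˣ} {ε : ZMod 3} {n k l mu : ℕ}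

lemma IsPointNorm.nonempty (hε : IsPointNorm Q ξ ε) (hQ : Q.polarBilin.Nondegenerate)
    (hd : 2 ≤ Module.finrank (ZMod 3) V) : (nonsingPoints Q ξ).Nonempty := by
  obtain ⟨x, hx⟩ := exists_point_norm_eq ringChar_zmod_three hQ hd hε.ne_zero
  exact ⟨x, (hε.mem_iff x).2 hx⟩

variable (hQs : ∀ v, Q v = Algebra.trace (ZMod 3) K (Qs v)) (hQ : Q.polarBilin.Nondegenerate)
  (hΩG : Omega Q ≤ G) (hGI : G ≤ isometryGroup Q)
  (hm : Module.finrank (ZMod 3) V = 2 * (n + 1) + 1) (hn : 1 ≤ n) (hε : IsPointNorm Q ξ ε)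
  (hP : PointParams n ξ k l mu)

include hQs hQ hΩG hGI hm hn hε hP

theorem exists_not_orbitEquation [Finite K] (hα : (Module.finrank (ZMod 3) K).Prime)
    (hα3 : Module.finrank (ZMod 3) K ≠ 3) :
    ∃ x ∈ nonsingPoints Q ξ, ∀ r : ℝ, (r = eigS k mu mu ∨ r = eigT k mu mu) →
      ¬ OrbitEquation (M := fieldExtSubgroup K G) (Delta Q ξ) (Gamma Q ξ) k l r x := by
  have htower := Module.finrank_mul_finrank (ZMod 3) K V
  have hdvd : ¬ 3 ∣ Module.finrank (ZMod 3) K := fun h =>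
    hα3 ((Nat.prime_dvd_prime_iff_eq Nat.prime_three hα).1 h).symm
  obtain ⟨j, hj⟩ : Odd (Module.finrank K V) :=
    Nat.Odd.of_mul_right (htower ▸ hm ▸ odd_two_mul_add_one _)
  rcases Nat.eq_zero_or_pos j with rfl | hj0
  · exact exists_not_orbitEquation_of_one_dim hj hQs hGI hQ hε (by rw [← hm, ← htower, hj]; simp) hn
      (hε.nonempty hQ (by lia)) hP
  · exact exists_not_orbitEquation_of_three_le hQs hQ hΩG hGI (by lia) hα.two_le hdvd hm hn hε hP

theorem orbitEquation_cubic (hK : Module.finrank (ZMod 3) K = 3) (hd : 3 ≤ Module.finrank K V)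
    (hT : HasDiscrepancy Q (ξ * quadraticChar (ZMod 3) ε * 3 ^ (n + 2))) {x : ℙ (ZMod 3) V}
    (hx : x ∈ nonsingPoints Q ξ) :
    OrbitEquation (M := fieldExtSubgroup K G) (Delta Q ξ) (Gamma Q ξ) k l (ξ * 3 ^ n) x := by
  have := finite_cubic hK
  have hcard := ncard_orbit_cubic hQs hGI hK hQ hΩG hd hm hε hT hx
  rw [ncard_eq_add_one (orbit_subset_nonsingPoints hQs hGI hε hx) (MulAction.mem_orbit_self x)]
    at hcard
  rw [OrbitEquation, hP.equation_pos_iff hn]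
  have hcard' := congrArg (Int.cast : ℤ → ℝ) hcard
  push_cast at hcard'
  linear_combination hcard'

end FieldExtension

end OrthRankThree

end

theorem proposition5p11
    {K V : Type*} [Field K] [Algebra (ZMod 3) K]
    [AddCommGroup V] [Module (ZMod 3) V] [Module K V] [IsScalarTower (ZMod 3) K V]
    (m α : ℕ) (hm : 2 ≤ m) (hα : α.Prime)
    (hV : Module.finrank (ZMod 3) V = 2 * m + 1)
    (hK : Module.finrank (ZMod 3) K = α)
    (Q : QuadraticForm (ZMod 3) V) (hQ : Q.polarBilin.Nondegenerate)
    (Qs : QuadraticForm K V) (hQs : ∀ v, Q v = Algebra.trace (ZMod 3) K (Qs v))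
    (G : Subgroup (V ≃ₗ[ZMod 3] V))
    (hΩG : OrthRankThree.Omega Q ≤ G) (hGI : G ≤ OrthRankThree.isometryGroup Q)
    (M : Subgroup G) (hM : M = OrthRankThree.fieldExtSubgroup K G)
    (ξ : ℤˣ) :
    ∃ k l lam mu : ℕ,
      OrthRankThree.IsHigmanParams (OrthRankThree.nonsingPoints Q ξ)
        (OrthRankThree.Delta Q ξ) (OrthRankThree.Gamma Q ξ) k l lam mu ∧
      (α ≠ 3 →
        ∃ x ∈ OrthRankThree.nonsingPoints Q ξ,
          ∀ r : ℝ, (r = OrthRankThree.eigS k lam mu ∨ r = OrthRankThree.eigT k lam mu) →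
            ¬ OrthRankThree.OrbitEquation (M := M) (OrthRankThree.Delta Q ξ)
                (OrthRankThree.Gamma Q ξ) k l r x) ∧
      (α = 3 →
        ((fun x => MulAction.orbit M x) '' OrthRankThree.nonsingPoints Q ξ).ncard = 3 ∧
        (∀ x ∈ OrthRankThree.nonsingPoints Q ξ,
          OrthRankThree.OrbitEquation (M := M) (OrthRankThree.Delta Q ξ)
            (OrthRankThree.Gamma Q ξ) k l
            (if ξ = 1 then OrthRankThree.eigS k lam mu else OrthRankThree.eigT k lam mu) x) ∧
        (∀ x ∈ OrthRankThree.nonsingPoints Q ξ,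
          ¬ OrthRankThree.CharLE (OrthRankThree.permChar (MulAction.stabilizer G x))
              (OrthRankThree.permChar M))) := by
  open OrthRankThree in
  subst hM hK
  have : FiniteDimensional (ZMod 3) V := FiniteDimensional.of_finrank_pos (by lia)
  have : Finite V := Module.finite_of_finite (ZMod 3)
  have : FiniteDimensional (ZMod 3) K := FiniteDimensional.of_finrank_pos hα.pos
  have : Finite K := Module.finite_of_finite (ZMod 3)
  obtain ⟨n, rfl⟩ : ∃ n, m = n + 1 := ⟨m - 1, by lia⟩
  have hn : 1 ≤ n := by lia
  obtain ⟨ε, hε0, hT⟩ := exists_hasDiscrepancy_units_mul hQ hV ξ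
  have hε := isPointNorm_of_hasDiscrepancy hQ hV hε0 hT
  obtain ⟨k, l, mu, hP⟩ := exists_pointParams n ξ
  have hH := hP.isHigmanParams hV hQ hε hT
  refine ⟨k, l, mu, mu, hH, exists_not_orbitEquation hQs hQ hΩG hGI hV hn hε hP hα, fun hα3 => ?_⟩
  have hd : 3 ≤ Module.finrank K V := by
    have htower := Module.finrank_mul_finrank (ZMod 3) K V
    rw [hα3, hV] at htower
    lia
  have hequation (x) (hx : x ∈ nonsingPoints Q ξ) :=
    orbitEquation_cubic hQs hQ hΩG hGI hV hn hε hP hα3 hd hT hx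
  rw [hP.ite_eigS_eigT_eq]
  exact ⟨ncard_orbits_cubic hQs hGI hα3 hQ hΩG hd hε, hequation, fun x hx =>
    not_charLE_of_forall_orbitEquation hGI hε hH hP.k_ne_zero (hP.l_ne_zero hn) hP.eigenvalue_sq
      hequation hx⟩
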